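/- **Tie sequences.** A tie move is one of $L_i,L_o,R_i,R_o,C_i,C_o$ (a half-turn into the left, right or center region, with direction "in" or "out"). A tie sequence is a finite list of tie moves, of any length, followed by a tuck move $T$, such that the first move is $L_i$ or $L_o$; consecutive moves have different regions; directions alternate between $i$ and $o$; and the sequence ends in $L_oR_iC_oT$ or $R_oL_iC_oT$. **Tie diagrams.** The passive strand runs from a point $b$ at the bottom up the straight strand and then clockwise around the neck loop (up its left side, down its right side) to a point $a$; the straight strand separates the regions $L$ and $R$, the left and right sides of the neck loop separate the center region $C$ from $L$ and from $R$. The active strand runs from $a$ to $b$; its first move crosses the straight strand to the left, closing the neck loop, and each later move crosses the part of the passive strand that separates the current region from the next one. It passes over the passive strand in an in-move and under it in an out-move. Starting from the first crossing, successive crossings follow each other downwards on the straight strand, clockwise on the left side of the neck loop and counterclockwise on its right side. A final $T$ contributes three more crossings: let $q$ be the first of the two regions $L,R$ in the ending $LRCT$ or $RLCT$; the active strand leaves the center over the neck loop into $q$ (crossing $t_1$), then passes over ($t_2$) and then under ($t_3$) the arc of the active strand in $q$ that joins the third-to-last move to the second-to-last move before $T$, with $t_2$ preceding $t_3$ along that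 arc. Without $T$ the active strand goes directly to $b$ after its last move. The diagram of the empty sequence $\emptyset$ is a round circle. The tie knot of a tie sequence is the knot represented by its tie diagram. **Reductions.** Let $f(L,R)$ denote any nonempty list of moves that alternates between left and right and whose directions alternate, and let $[\dots]$ denote an arbitrary initial part. The reductions are: (0) $L_oR_iC_oT\to\emptyset$; (I) $[\dots]L_iR_oL_iC_oT\to[\dots]L_iC_ot_1$ and $[\dots]R_iL_oR_iC_oT\to[\dots]R_iC_ot_1$, where $t_1$ may be either of $L_i,R_i$; (II) $[\dots]C_iR_oL_iC_oT\to[\dots]$ and $[\dots]C_iL_oR_iC_oT\to[\dots]$; (III) $f(L,R)\to\emptyset$; (IV) $[\dots]C\,f(L,R)\to[\dots]C*$, where $C$ is $C_i$ or $C_o$, $f(L,R)$ has at least two moves and $*$ is its first move. A reduced tie sequence of a tie sequence $s$ is a sequence obtained from $s$ by finitely many reductions to which no further reduction applies; its diagram is a reduced tie diagram of the tie knot. **Knots and diagrams.** Two knot diagrams represent the same knot if they are related by planar (spherical) isotopy, forgetting orientations, and finitely many Reidemeister moves. The crossing number of a knot is the least number of crossings among all diagrams that represent it. A diagram is alternating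 if over- and under-passages alternate along the knot. A crossing is nugatory if some circle passes through it transversely and meets the diagram nowhere else, and a diagram is reduced if it has no nugatory crossing. **Corollary.** Let $s$ be a tie sequence. Its tie diagram is a knot diagram, and $s$ has a reduced tie sequence. For every reduced tie sequence $r$ of $s$, the tie diagram of $r$ is a knot diagram of the tie knot of $s$, it is reduced and alternating, and its number of crossings equals the crossing number of that tie knot. Thus any tie knot has a minimal crossing diagram corresponding to the reduced tie sequence. -/

import Mathlib

namespace TieKnot

/-! ### Knot diagrams

An oriented knot diagram is recorded by its signed Gauss code: travelling once around the knot
from some base point one notes, at every passage through a crossing, the name of the crossing,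
whether one is on the over-strand, and the sign of the crossing. The code is read cyclically; the
empty code is the round circle. A crossing is positive when the pair of directions
(over-strand, under-strand) is a positively oriented basis of the plane. -/

/-- One passage through a crossing. -/
structure Letter where
  label : ℕ
  isOver : Bool
  positive : Bool
deriving DecidableEq

/-- The other passage through the same crossing. -/
def Letter.partner (x : Letter) : Letter := ⟨x.label, !x.isOver, x.positive⟩

/-- The same passage, with the crossings renamed. -/
def Letter.relabel (σ : Equiv.Perm ℕ) (x : Letter) : Letter := ⟨σ x.label, x.isOver, x.positive⟩

abbrev GaussCode := List Letter

namespace GaussCode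

/-- Every crossing that occurs is passed exactly twice, once over and once under, with the same
sign. -/
def WellFormed (w : GaussCode) : Prop :=
  (w.map fun x => (x.label, x.isOver)).Nodup ∧ ∀ x ∈ w, x.partner ∈ w

/-- The number of crossings. -/
def numCrossings (w : GaussCode) : ℕ := w.countP Letter.isOver

/-- The cyclically next position. -/
def next (w : GaussCode) (i : Fin w.length) : Fin w.length := finRotate w.length i

/-- The cyclically previous position. -/
def prev (w : GaussCode) (i : Fin w.length) : Fin w.length := (finRotate w.length).symm i

/-- A directed edge: `(i, true)` runs from position `i` to the next position, along the
orientation of the knot, and `(i, false)` is the same edge run backwards, ending at position `i`. -/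
abbrev Dart (w : GaussCode) := Fin w.length × Bool

/-- The position at which a directed edge arrives. -/
def head (w : GaussCode) (d : Dart w) : Fin w.length := if d.2 then next w d.1 else d.1

/-- `LeftTurn w d e`: after arriving at a crossing along `d` one turns left into `e`. The turn goes
into the other strand of that crossing; one follows that strand forwards if it crosses the
direction of arrival from right to left, and backwards otherwise. -/
def LeftTurn (w : GaussCode) (d e : Dart w) : Prop :=
  ∃ j : Fin w.length, j ≠ head w d ∧ (w.get j).label = (w.get (head w d)).label ∧
    e = if ((w.get (head w d)).isOver == (w.get (head w d)).positive) == d.2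
        then (j, true) else (prev w j, false)

/-- The faces (complementary regions) of the diagram on its supporting closed oriented surface:
directed edges up to turning left, every one standing for the face on its left. -/
def Face (w : GaussCode) : Type := Quot (LeftTurn w)

/-- The face to the left of a directed edge. -/
def faceLeft (w : GaussCode) (d : Dart w) : Face w := Quot.mk _ d

/-- The supporting surface is a sphere. With `n ≥ 1` crossings there are `n` vertices and `2 n`
edges, so that Euler's formula asks for `n + 2` faces. -/
def Planar (w : GaussCode) : Prop :=
  w = [] ∨ Nat.card (Face w) = numCrossings w + 2

/-- The code is the code of a (planar, equivalently spherical) knot diagram. -/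
def IsKnotDiagram (w : GaussCode) : Prop := WellFormed w ∧ Planar w

/-- Along the knot, over- and under-passages alternate. -/
def IsAlternating (w : GaussCode) : Prop :=
  ∀ i : Fin w.length, (w.get (next w i)).isOver ≠ (w.get i).isOver

/-- The crossing at position `i` is nugatory, seen along the strand through position `i`: the two
opposite corners to the left of arriving forwards and to the left of arriving backwards belong to
the same face, so that a circle through the crossing meets the diagram nowhere else. -/
def NugatoryAt (w : GaussCode) (i : Fin w.length) : Prop :=
  faceLeft w (prev w i, true) = faceLeft w (i, false)

/-- No crossing is nugatory. (A crossing has two pairs of opposite corners, one for either of its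
two positions.) -/
def IsReduced (w : GaussCode) : Prop := ∀ i : Fin w.length, ¬ NugatoryAt w i

/-- For `b = true` the two letters in this order, otherwise in the opposite order. -/
def inOrder (b : Bool) (x y : Letter) : GaussCode := if b then [x, y] else [y, x]

/-- The top strand of a Reidemeister 3 triangle with crossings `a` (top over middle), `b`
(top over bottom) and `c` (middle over bottom). -/
def topStrand (b : Bool) (la lb : ℕ) (sa sb : Bool) : GaussCode :=
  inOrder b ⟨la, true, sa⟩ ⟨lb, true, sb⟩

/-- The middle strand of a Reidemeister 3 triangle. -/
def midStrand (b : Bool) (la lc : ℕ) (sa sc : Bool) : GaussCode :=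
  inOrder b ⟨la, false, sa⟩ ⟨lc, true, sc⟩

/-- The bottom strand of a Reidemeister 3 triangle. -/
def botStrand (b : Bool) (lb lc : ℕ) (sb sc : Bool) : GaussCode :=
  inOrder b ⟨lb, false, sb⟩ ⟨lc, false, sc⟩

/-- Elementary changes of a diagram: change of base point, renaming of crossings, reversal of the
orientation, and the three Reidemeister moves. -/
inductive Step : GaussCode → GaussCode → Prop
  | rotate (u v : GaussCode) : Step (u ++ v) (v ++ u)
  | relabel (σ : Equiv.Perm ℕ) (u : GaussCode) : Step u (u.map (Letter.relabel σ))
  | reverse (u : GaussCode) : Step u u.reverse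
  /-- Removal of a kink. -/
  | r1 (c : ℕ) (o s : Bool) (u : GaussCode) :
      Step ([⟨c, o, s⟩, ⟨c, !o, s⟩] ++ u) u
  /-- Removal of a bigon of which one strand passes over the other; `b` tells whether the two
  strands run in parallel. -/
  | r2 (c d : ℕ) (s b : Bool) (u v : GaussCode) :
      Step ([⟨c, true, s⟩, ⟨d, true, !s⟩] ++ u ++ inOrder b ⟨c, false, s⟩ ⟨d, false, !s⟩ ++ v)
        (u ++ v)
  /-- Moving a strand across a crossing; the order in which the crossings are met is reversed on
  each of the three strands. The two equations say that the three crossings bound a triangle. Here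
  the strands are met in the cyclic order top, middle, bottom. -/
  | r3 (a b c : ℕ) (sa sb sc x y z : Bool) (u v w : GaussCode)
      (h₁ : (sa == y) = (sb == z)) (h₂ : (sc == y) = (sb == x)) :
      Step
        (topStrand x a b sa sb ++ u ++ midStrand y a c sa sc ++ v ++ botStrand z b c sb sc ++ w)
        (topStrand (!x) a b sa sb ++ u ++ midStrand (!y) a c sa sc ++ v ++
          botStrand (!z) b c sb sc ++ w)
  /-- The same with the strands met in the cyclic order top, bottom, middle. -/
  | r3' (a b c : ℕ) (sa sb sc x y z : Bool) (u v w : GaussCode)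
      (h₁ : (sa == y) = (sb == z)) (h₂ : (sc == y) = (sb == x)) :
      Step
        (topStrand x a b sa sb ++ u ++ botStrand z b c sb sc ++ v ++ midStrand y a c sa sc ++ w)
        (topStrand (!x) a b sa sb ++ u ++ botStrand (!z) b c sb sc ++ v ++
          midStrand (!y) a c sa sc ++ w)

/-- Two diagrams represent the same knot: they are joined by a finite sequence of elementary
changes and their inverses, all between knot diagrams. -/
def Equivalent : GaussCode → GaussCode → Prop :=
  Relation.EqvGen fun w w' => IsKnotDiagram w ∧ IsKnotDiagram w' ∧ Step w w'

/-- The crossing number of the knot represented by a diagram: the least number of crossings of a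
diagram of that knot. -/
noncomputable def crossingNumber (w : GaussCode) : ℕ :=
  sInf {n | ∃ w', IsKnotDiagram w' ∧ Equivalent w w' ∧ numCrossings w' = n}

end GaussCode

/-! ### Tie sequences -/

/-- The regions left, right and center. -/
inductive Region
  | L | R | C
deriving DecidableEq

/-- The directions in and out. -/
inductive Dir
  | i | o
deriving DecidableEq

/-- A tie move: a half-turn into a region, in or out. -/
structure Move where
  region : Region
  dir : Dir
deriving DecidableEq

/-- The symbols of tie sequences: the tie moves and the tuck move `T`. -/
inductive Symb
  | move (m : Move)
  | T
deriving DecidableEq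

abbrev Li : Symb := .move ⟨.L, .i⟩
abbrev Lo : Symb := .move ⟨.L, .o⟩
abbrev Ri : Symb := .move ⟨.R, .i⟩
abbrev Ro : Symb := .move ⟨.R, .o⟩
abbrev Ci : Symb := .move ⟨.C, .i⟩
abbrev Co : Symb := .move ⟨.C, .o⟩

/-- The tie sequences (of any length): a list of tie moves followed by `T` such that the first
region is `L`, no region is repeated, the directions alternate, and the end is `L_o R_i C_o T` or
`R_o L_i C_o T`. -/
def IsTieSequence (s : List Symb) : Prop :=
  ∃ ms : List Move, s = ms.map Symb.move ++ [.T] ∧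
    (∃ d, ms.head? = some ⟨.L, d⟩) ∧
    ms.IsChain (fun m m' => m.region ≠ m'.region ∧ m.dir ≠ m'.dir) ∧
    ([Lo, Ri, Co, .T] <:+ s ∨ [Ro, Li, Co, .T] <:+ s)

/-- A nonempty sequence of moves alternating between left and right (`f(L,R)`), with alternating
directions. -/
def IsAlternatingLR (f : List Symb) : Prop :=
  ∃ ms : List Move, f = ms.map Symb.move ∧ ms ≠ [] ∧ (∀ m ∈ ms, m.region ≠ .C) ∧
    ms.IsChain (fun m m' => m.region ≠ m'.region ∧ m.dir ≠ m'.dir)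

/-- The reductions of tie sequences. The crossing `t₁` left over by reduction I is `L_i` or
`R_i`. -/
inductive Reduction : List Symb → List Symb → Prop
  | zero : Reduction [Lo, Ri, Co, .T] []
  | oneL (p : List Symb) (t : Symb) (ht : t = Li ∨ t = Ri) :
      Reduction (p ++ [Li, Ro, Li, Co, .T]) (p ++ [Li, Co, t])
  | oneR (p : List Symb) (t : Symb) (ht : t = Li ∨ t = Ri) :
      Reduction (p ++ [Ri, Lo, Ri, Co, .T]) (p ++ [Ri, Co, t])
  | twoRL (p : List Symb) : Reduction (p ++ [Ci, Ro, Li, Co, .T]) p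
  | twoLR (p : List Symb) : Reduction (p ++ [Ci, Lo, Ri, Co, .T]) p
  | three (f : List Symb) (hf : IsAlternatingLR f) : Reduction f []
  /-- A move to the center followed by `f(L,R)`: of `f(L,R)` only the first move is kept. -/
  | four (p : List Symb) (d : Dir) (x : Symb) (f : List Symb) (hf : f ≠ [])
      (hxf : IsAlternatingLR (x :: f)) :
      Reduction (p ++ [.move ⟨.C, d⟩] ++ x :: f) (p ++ [.move ⟨.C, d⟩, x])

/-- `r` is obtained from `s` by reductions, and no further reduction applies to `r`. -/
def IsReducedSequenceOf (r s : List Symb) : Prop :=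
  Relation.ReflTransGen Reduction s r ∧ ∀ r', ¬ Reduction r r'

/-! ### Tie diagrams

The passive strand starts at `b` at the bottom, goes up the straight strand, then clockwise around
the neck loop, first up its left side and then down its right side to `a`. The active strand
starts at `a`, goes to the left across the straight strand (the first crossing, which closes the
neck loop), and ends at `b`. The straight strand separates the regions `L` and `R`, the left side
of the neck loop separates `L` and `C`, and its right side separates `R` and `C`. The crossings on
the straight strand follow each other downwards, those on the left side of the neck loop clockwise
and those on its right side counterclockwise, always starting from the first crossing. -/

/-- The parts of the passive strand. -/
inductive Part
  | straight | left | right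
deriving DecidableEq

/-- A crossing of the active strand, going from the region `src` to the region `dst`, over the
passive strand if `dir` is in, and under it if `dir` is out. -/
structure Crossing where
  label : ℕ
  src : Region
  dst : Region
  dir : Dir

/-- The part of the passive strand that is crossed. -/
def Crossing.part (c : Crossing) : Part :=
  if c.src ≠ .C ∧ c.dst ≠ .C then .straight
  else if c.src = .L ∨ c.dst = .L then .left
  else .right

/-- Whether the directions (active strand, passive strand) form a positively oriented basis. The
active strand crosses the upward straight strand to the right, or the clockwise neck loop from the
outside to the inside. -/
def Crossing.turn (c : Crossing) : Bool :=
  match c.part with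
  | .straight => c.dst == .R
  | _ => c.dst == .C

/-- The sign of the crossing. -/
def Crossing.positive (c : Crossing) : Bool := (c.dir == .i) == c.turn

/-- The passage along the active strand. -/
def Crossing.active (c : Crossing) : Letter := ⟨c.label, c.dir == .i, c.positive⟩

/-- The passage along the passive strand. -/
def Crossing.passive (c : Crossing) : Letter := ⟨c.label, c.dir == .o, c.positive⟩

/-- The crossings made by a list of moves, numbered from `n` on, for an active strand that is in
the region `src`. -/
def crossingsFrom (n : ℕ) (src : Region) : List Move → List Crossing
  | [] => []
  | m :: ms => ⟨n, src, m.region, m.dir⟩ :: crossingsFrom (n + 1) m.region ms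

/-- The crossings made by a list of moves; the first move comes from the right. -/
def crossings (ms : List Move) : List Crossing := crossingsFrom 0 .R ms

/-- The crossings on a part of the passive strand, in the order in which they are made. -/
def onPart (p : Part) (cs : List Crossing) : GaussCode :=
  (cs.filter fun c => c.part == p).map Crossing.passive

/-- The passive strand, from `b` to `a`. -/
def passiveCode (cs : List Crossing) : GaussCode :=
  (onPart .straight cs).reverse ++ onPart .left cs ++ (onPart .right cs).reverse

/-- The diagram of a list of moves without a tuck move. -/
def openDiagram (ms : List Move) : GaussCode :=
  (crossings ms).map Crossing.active ++ passiveCode (crossings ms)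

/-- The diagram of a list of moves followed by a tuck move. Let `q` be the region of the third
move from the end, that is the first `L` or `R` in the end `L R C T` or `R L C T`. In the tuck move
the active strand leaves the center over the neck loop into `q` (the crossing `t₁`); in `q` it meets
the arc of the active strand between the third and the second move from the end, where it passes
over that arc (`t₂`) and then under it (`t₃`); along the arc one meets `t₂` and then `t₃`. -/
def tuckDiagram (ms : List Move) : GaussCode :=
  let k := ms.length
  let q : Region := ((ms[k - 3]?).map Move.region).getD .R
  let cs := crossings (ms ++ [⟨q, .i⟩])
  let act := cs.map Crossing.active
  let s : Bool := q == .R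
  act.take (k - 2) ++ [⟨k + 1, false, s⟩, ⟨k + 2, true, s⟩] ++ act.drop (k - 2) ++
    [⟨k + 1, true, s⟩, ⟨k + 2, false, s⟩] ++ passiveCode cs

/-- The tie moves of a sequence. -/
def tieMoves (s : List Symb) : List Move :=
  s.filterMap fun x => match x with
    | .move m => some m
    | .T => none

/-- The tie diagram of a tie sequence or of a reduced tie sequence. -/
def tieDiagram (s : List Symb) : GaussCode :=
  if Symb.T ∈ s then tuckDiagram (tieMoves s) else openDiagram (tieMoves s)

end TieKnot

set_option linter.unusedSimpArgs false

/-! Everything is read off the interlacement matrix of a Gauss code over the field with two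
elements, whose off-diagonal entries `beta w c d` tell whether the chords of two crossings are
interlaced.

Bracket polynomial. A state, i.e. a choice of smoothings, has one circle more than the nullity of
this matrix with a diagonal given by the state. Taking this as the definition of `br` turns
invariance under Reidemeister moves into linear algebra (`br_step`): a kink is an isolated index, a
bigon gives two equal rows, and a triangle gives three rows `v₁`, `v₁ + v₂`, `v₂` whose mutual
entries all flip. So `br` is an invariant up to a factor `± T k`, on well-formed codes, planar or
not.

Minimality (`numCrossings_le_of_equivalent`). The two extreme states have complementary matrices `N`
and `N + 1`. Their kernels meet in zero, so the two nullities add up to at most the number `n` of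
crossings, and the degrees of the bracket span at most `4 n`. If `N` is a projection the nullities
add up to exactly `n`. If moreover every crossing is interlaced with another one, both kernels have
vectors supported at every crossing; then the extreme terms do not cancel and the span is exactly `4
n`. As the span is an invariant, no equivalent diagram has fewer crossings.

Planarity (`card_face`, `Good.isKnotDiagram`). When the turning directions alternate along the code
(`Par`), the faces can be coloured with two colours, and the faces of one colour behave like the
circles of a state. The states of the two colours again have matrices `N` and `N + 1`, so the number
of faces is 2 plus the sum of two nullities, and it is `n + 2` when `N` is a projection. This is the
condition `Good`. If the signs agree with the colouring, the diagram is alternating and `N`, `N + 1`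
are, up to order, the matrices of its two extreme bracket states. Thus one projection property
yields planarity, reducedness and minimality.

Tie diagrams. A diagram without tuck is built crossing by crossing; each step borders the matrix by
a multiple of one fixed vector, the indicator of the crossings on the straight strand and the left
side of the loop. `Inv` and `Spectrum` carry the projection property along. A tuck adds two equal
rows (`Good.tuck`). Each reduction is realised by explicit moves between good diagrams
(`leads_tuck_straight`, `leads_tuck_center`, `leads_straight`). Every tie sequence is reducible, so
the tuck always disappears. An irreducible sequence without tuck is empty or ends with a move to the
center and one move out of it; the crossing of that last move is interlaced with all crossings of
the fixed vector, and every other crossing is interlaced with the first one (`exists_interlaced`),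
so the criterion applies. -/

namespace TieKnot.GaussCode

/-! ### The interlacement form of a Gauss code -/

/-- The parity of the number of occurrences of a label. -/
def tot (w : GaussCode) (c : ℕ) : ZMod 2 :=
  (w.map fun x => if x.label = c then (1 : ZMod 2) else 0).sum

@[simp] theorem tot_nil (c : ℕ) : tot [] c = 0 := rfl

@[simp] theorem tot_cons (x : Letter) (w : GaussCode) (c : ℕ) :
    tot (x :: w) c = (if x.label = c then 1 else 0) + tot w c := by
  simp [tot]

@[simp] theorem tot_append (u v : GaussCode) (c : ℕ) : tot (u ++ v) c = tot u c + tot v c := by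
  simp [tot]

@[simp] theorem tot_reverse (u : GaussCode) (c : ℕ) : tot u.reverse c = tot u c := by
  induction u with
  | nil => rfl
  | cons x u ih => simp [ih, add_comm]

/-- The parity of the number of pairs of positions `i < j` with labels `c` and `d`. When every label
occurs an even number of times and `c ≠ d`, it tells whether `c` and `d` are interlaced. -/
def beta : GaussCode → ℕ → ℕ → ZMod 2
  | [], _, _ => 0
  | x :: w, c, d => (if x.label = c then tot w d else 0) + beta w c d

@[simp] theorem beta_nil (c d : ℕ) : beta [] c d = 0 := rfl

@[simp] theorem beta_cons (x : Letter) (w : GaussCode) (c d : ℕ) :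
    beta (x :: w) c d = (if x.label = c then tot w d else 0) + beta w c d := rfl

@[simp] theorem beta_append (u v : GaussCode) (c d : ℕ) :
    beta (u ++ v) c d = beta u c d + beta v c d + tot u c * tot v d := by
  induction u with
  | nil => simp
  | cons x u ih =>
    simp only [List.cons_append, beta_cons, ih, tot_append, tot_cons]
    split_ifs <;> ring

theorem beta_reverse (u : GaussCode) (c d : ℕ) : beta u.reverse c d = beta u d c := by
  induction u with
  | nil => simp
  | cons x u ih =>
    simp only [List.reverse_cons, beta_append, ih, beta_cons, beta_nil, tot_reverse, tot_cons,
      tot_nil]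
    split_ifs <;> ring

/-- The crossings of a code. -/
def labels (w : GaussCode) : Finset ℕ := (w.map Letter.label).toFinset

theorem mem_labels {w : GaussCode} {c : ℕ} : c ∈ labels w ↔ ∃ x ∈ w, x.label = c := by
  simp [labels]

@[simp] theorem labels_nil : labels [] = ∅ := rfl

@[simp] theorem labels_cons (x : Letter) (w : GaussCode) :
    labels (x :: w) = insert x.label (labels w) := by
  simp [labels]

@[simp] theorem labels_append (u v : GaussCode) : labels (u ++ v) = labels u ∪ labels v := by
  simp [labels]

@[simp] theorem labels_reverse (u : GaussCode) : labels u.reverse = labels u := by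
  ext; simp [mem_labels]

theorem labels_perm {u v : GaussCode} (h : u.Perm v) : labels u = labels v := by
  ext c; simp [mem_labels, h.mem_iff]

theorem tot_eq_zero {u : GaussCode} {c : ℕ} (h : c ∉ labels u) : tot u c = 0 := by
  induction u with
  | nil => rfl
  | cons x u ih =>
    simp only [labels_cons, Finset.mem_insert, not_or] at h
    simp [Ne.symm h.1, ih h.2]

theorem beta_eq_zero_left {u : GaussCode} {c : ℕ} (h : c ∉ labels u) (d : ℕ) :
    beta u c d = 0 := by
  induction u with
  | nil => rfl
  | cons x u ih =>
    simp only [labels_cons, Finset.mem_insert, not_or] at h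
    simp [Ne.symm h.1, ih h.2]

theorem beta_eq_zero_right {u : GaussCode} {c : ℕ} (h : c ∉ labels u) (d : ℕ) :
    beta u d c = 0 := by
  rw [← beta_reverse]
  exact beta_eq_zero_left (by simpa using h) d

/-- Each pair consisting of an occurrence of `c` and one of `d` is counted in exactly one of the two
orders. -/
theorem beta_add_beta (w : GaussCode) {c d : ℕ} (h : c ≠ d) :
    beta w c d + beta w d c = tot w c * tot w d := by
  induction w with
  | nil => simp
  | cons x w ih =>
    have : beta (x :: w) c d + beta (x :: w) d c =
      (beta w c d + beta w d c) + (if x.label = c then tot w d else 0) +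
        (if x.label = d then tot w c else 0) := by
      simp only [beta_cons]; ring
    rw [this, ih]
    simp only [tot_cons]
    by_cases h1 : x.label = c
    · subst h1; simp [h]; ring
    · by_cases h2 : x.label = d
      · subst h2; simp [h1]; ring
      · simp [h1, h2]

theorem beta_comm {w : GaussCode} (hw : ∀ c, tot w c = 0) {c d : ℕ} (h : c ≠ d) :
    beta w c d = beta w d c := by
  have := beta_add_beta w h
  rw [hw, zero_mul] at this
  exact CharTwo.add_eq_zero.1 this

/-- Only the cross term changes, and it is symmetric because `u` and `v` contain every label with
the same parity. -/
theorem beta_rotate {u v : GaussCode} (hw : ∀ c, tot (u ++ v) c = 0) (c d : ℕ) :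
    beta (v ++ u) c d = beta (u ++ v) c d := by
  have h : ∀ c, tot v c = tot u c := fun c => by
    have := hw c
    rw [tot_append] at this
    exact (CharTwo.add_eq_zero.1 this).symm
  simp [h]; ring

/-! ### Well-formed codes -/

theorem WellFormed.perm {u v : GaussCode} (hu : WellFormed u) (h : u.Perm v) : WellFormed v :=
  ⟨(h.map _).nodup_iff.1 hu.1, fun x hx => h.mem_iff.1 (hu.2 x (h.mem_iff.2 hx))⟩

theorem partner_partner (x : Letter) : x.partner.partner = x := by
  simp [Letter.partner]

theorem WellFormed.tail {x : Letter} {u : GaussCode} (h : WellFormed (x :: x.partner :: u)) :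
    WellFormed u ∧ x.label ∉ labels u := by
  obtain ⟨h1, h2⟩ := h
  simp only [List.map_cons, List.nodup_cons, List.mem_cons, not_or, List.mem_map, not_exists,
    not_and] at h1
  have key : x.label ∉ labels u := by
    rw [mem_labels]
    rintro ⟨y, hy, hyx⟩
    by_cases ho : y.isOver = x.isOver
    · exact h1.1.2 y hy (by rw [hyx, ho])
    · refine h1.2.1 y hy ?_
      simp only [Letter.partner, hyx, Prod.mk.injEq, true_and]
      revert ho; cases y.isOver <;> cases x.isOver <;> simp
  refine ⟨⟨h1.2.2, fun y hy => ?_⟩, key⟩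
  have := h2 y (by simp [hy])
  simp only [List.mem_cons] at this
  have hne : y.label ≠ x.label := fun h => key (h ▸ mem_labels.2 ⟨y, hy, rfl⟩)
  rcases this with h | h | h
  · exact absurd (congrArg Letter.label h) hne
  · exact absurd (congrArg Letter.label h) hne
  · exact h

theorem wellFormed_nil : WellFormed [] := ⟨by simp, by simp⟩

theorem WellFormed.cons {x : Letter} {u : GaussCode} (h : WellFormed u)
    (hx : x.label ∉ labels u) : WellFormed (x :: x.partner :: u) := by
  have hx' : ∀ y ∈ u, y.label ≠ x.label := fun y hy he => hx (mem_labels.2 ⟨y, hy, he⟩)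
  refine ⟨?_, ?_⟩
  · simp only [List.map_cons, List.nodup_cons, List.mem_cons, not_or, List.mem_map, not_exists,
      not_and, Prod.mk.injEq, Letter.partner]
    exact ⟨⟨by simp, fun y hy he => absurd he (hx' y hy)⟩,
      fun y hy he => absurd he (hx' y hy), h.1⟩
  · intro y hy
    simp only [List.mem_cons] at hy ⊢
    rcases hy with rfl | rfl | hy
    · simp
    · simp [partner_partner]
    · exact Or.inr (Or.inr (h.2 y hy))

theorem WellFormed.exists_perm {x : Letter} {u : GaussCode} (h : WellFormed u) (hx : x ∈ u) :
    ∃ v, u.Perm (x :: x.partner :: v) := by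
  have h2 := h.2 x hx
  obtain ⟨v, hv⟩ : ∃ v, u.Perm (x :: v) := ⟨_, List.perm_cons_erase hx⟩
  have : x.partner ∈ v := by
    have := hv.mem_iff.1 h2
    simp only [List.mem_cons] at this
    rcases this with h | h
    · have := congrArg Letter.isOver h
      simp [Letter.partner] at this
    · exact h
  obtain ⟨v', hv'⟩ : ∃ v', v.Perm (x.partner :: v') := ⟨_, List.perm_cons_erase this⟩
  exact ⟨v', hv.trans (hv'.cons x)⟩

/-- Up to order a well-formed code is a list of pairs `x, x.partner` with distinct labels. This
principle serves for all counts that do not depend on the order. -/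
theorem WellFormed.induction {P : GaussCode → Prop} (nil : P [])
    (perm : ∀ u v, u.Perm v → P u → P v)
    (cons : ∀ (x : Letter) u, WellFormed u → x.label ∉ labels u → P u →
      P (x :: x.partner :: u)) {w : GaussCode} (h : WellFormed w) : P w := by
  induction hn : w.length using Nat.strong_induction_on generalizing w with
  | _ n ih =>
    rcases w with _ | ⟨x, w⟩
    · exact nil
    · obtain ⟨v, hv⟩ := h.exists_perm (x := x) (by simp)
      have hwf := h.perm hv
      refine perm _ _ hv.symm (cons x v hwf.tail.1 hwf.tail.2 (ih v.length ?_ hwf.tail.1 rfl))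
      have := hv.length_eq
      simp only [List.length_cons] at this hn
      omega

theorem tot_perm {u v : GaussCode} (h : u.Perm v) (c : ℕ) : tot u c = tot v c :=
  (h.map _).sum_eq

theorem WellFormed.tot_eq {w : GaussCode} (h : WellFormed w) (c : ℕ) : tot w c = 0 := by
  refine h.induction (P := fun w => tot w c = 0) rfl (fun u v h hu => tot_perm h c ▸ hu) ?_
  intro x u _ _ ih
  simp only [tot_cons, ih, Letter.partner]
  rw [add_zero, CharTwo.add_self_eq_zero]

theorem WellFormed.length_eq {w : GaussCode} (h : WellFormed w) :
    w.length = 2 * numCrossings w := by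
  refine h.induction (P := fun w => w.length = 2 * numCrossings w) rfl
    (fun u v h hu => ?_) ?_
  · simp only [numCrossings] at hu ⊢
    rw [← h.length_eq, hu, h.countP_eq]
  · intro x u _ _ ih
    simp only [numCrossings, List.length_cons, List.countP_cons, Letter.partner] at ih ⊢
    cases x.isOver <;> simp <;> omega

theorem WellFormed.card_labels {w : GaussCode} (h : WellFormed w) :
    (labels w).card = numCrossings w := by
  refine h.induction (P := fun w => (labels w).card = numCrossings w) rfl
    (fun u v h hu => ?_) ?_
  · rw [← labels_perm h, hu]; exact h.countP_eq _
  · intro x u _ hx ih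
    simp only [numCrossings, labels_cons, List.countP_cons, Letter.partner, Finset.insert_idem,
      Finset.card_insert_of_notMem hx] at ih ⊢
    cases x.isOver <;> simp <;> omega

/-- The sign of a crossing. -/
def sgn (w : GaussCode) (c : ℕ) : Bool := w.any fun x => x.label == c && x.positive

theorem sgn_perm {u v : GaussCode} (h : u.Perm v) (c : ℕ) : sgn u c = sgn v c :=
  h.any_eq

@[simp] theorem sgn_append (u v : GaussCode) (c : ℕ) : sgn (u ++ v) c = (sgn u c || sgn v c) := by
  simp [sgn]

@[simp] theorem sgn_cons (x : Letter) (u : GaussCode) (c : ℕ) :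
    sgn (x :: u) c = ((decide (x.label = c) && x.positive) || sgn u c) := by
  simp [sgn, Bool.beq_eq_decide_eq]

@[simp] theorem sgn_nil (c : ℕ) : sgn [] c = false := rfl

theorem sgn_eq_false {u : GaussCode} {c : ℕ} (h : c ∉ labels u) : sgn u c = false := by
  induction u with
  | nil => rfl
  | cons x u ih =>
    simp only [labels_cons, Finset.mem_insert, not_or] at h
    simp [Ne.symm h.1, ih h.2]

theorem WellFormed.sgn_eq {w : GaussCode} (h : WellFormed w) {x : Letter} (hx : x ∈ w) :
    sgn w x.label = x.positive := by
  obtain ⟨v, hv⟩ := h.exists_perm hx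
  have h2 := (h.perm hv).tail.2
  rw [sgn_perm hv]
  simp [Letter.partner, sgn_eq_false h2]

end TieKnot.GaussCode

section

open LaurentPolynomial

namespace TieKnot

/-! ### Kernels over the field with two elements -/

/-- The indicator function of a finite set. -/
def ind (S : Finset ℕ) (c : ℕ) : ZMod 2 := if c ∈ S then 1 else 0

/-- The kernel of a square matrix with index set `L`; vectors are recorded by their supports. -/
def ker (L : Finset ℕ) (N : ℕ → ℕ → ZMod 2) : Finset (Finset ℕ) :=
  L.powerset.filter fun T => ∀ c ∈ L, ∑ d ∈ T, N c d = 0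

/-- The dimension of the kernel. -/
def nul (L : Finset ℕ) (N : ℕ → ℕ → ZMod 2) : ℕ := Nat.log 2 (ker L N).card

/-- The matrix `M` with its diagonal replaced by `t`. -/
def withDiag (M : ℕ → ℕ → ZMod 2) (t : ℕ → ZMod 2) (c d : ℕ) : ZMod 2 := if c = d then t c else M c d

theorem mem_ker {L : Finset ℕ} {N : ℕ → ℕ → ZMod 2} {T : Finset ℕ} :
    T ∈ ker L N ↔ T ⊆ L ∧ ∀ c ∈ L, ∑ d ∈ T, N c d = 0 := by
  simp [ker]

theorem card_ker_pos (L : Finset ℕ) (N : ℕ → ℕ → ZMod 2) : 0 < (ker L N).card :=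
  Finset.card_pos.2 ⟨∅, by simp [mem_ker]⟩

theorem ker_congr {L : Finset ℕ} {N N' : ℕ → ℕ → ZMod 2} (h : ∀ c ∈ L, ∀ d ∈ L, N c d = N' c d) :
    ker L N = ker L N' := by
  ext T
  simp only [mem_ker]
  refine and_congr_right fun hT => forall₂_congr fun c hc => ?_
  rw [Finset.sum_congr rfl fun d hd => h c hc d (hT hd)]

theorem card_filter_powerset_insert {L : Finset ℕ} {a : ℕ} (ha : a ∉ L) (P : Finset ℕ → Prop)
    [DecidablePred P] :
    ((insert a L).powerset.filter P).card =
      (L.powerset.filter P).card + (L.powerset.filter fun T => P (insert a T)).card := by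
  simp only [Finset.card_filter]
  exact Finset.sum_powerset_insert ha _

/-- The number of solutions of an inhomogeneous linear system. -/
def sols (L : Finset ℕ) (N : ℕ → ℕ → ZMod 2) (v₁ v₂ : ℕ → ZMod 2) (s t α γ : ZMod 2) : ℕ :=
  (L.powerset.filter fun T => (∀ e ∈ L, s * v₁ e + t * v₂ e + ∑ d ∈ T, N e d = 0) ∧
    ∑ d ∈ T, v₁ d = α ∧ ∑ d ∈ T, v₂ d = γ).card

theorem sols_pos (L : Finset ℕ) (N : ℕ → ℕ → ZMod 2) (v₁ v₂ : ℕ → ZMod 2) :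
    0 < sols L N v₁ v₂ 0 0 0 0 :=
  Finset.card_pos.2 ⟨∅, by simp⟩

/-- The matrix is block diagonal, so the new coordinate is free or forced to vanish according to its
diagonal entry. -/
theorem card_ker_insert {L : Finset ℕ} {a : ℕ} (ha : a ∉ L) (N : ℕ → ℕ → ZMod 2)
    (h₁ : ∀ e ∈ L, N e a = 0) (h₂ : ∀ e ∈ L, N a e = 0) :
    (ker (insert a L) N).card = if N a a = 0 then 2 * (ker L N).card else (ker L N).card := by
  have key : ∀ T ∈ L.powerset, (∑ d ∈ T, N a d = 0) ∧ ∀ c, ∑ d ∈ insert a T, N c d =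
      N c a + ∑ d ∈ T, N c d := by
    intro T hT
    rw [Finset.mem_powerset] at hT
    exact ⟨Finset.sum_eq_zero fun d hd => h₂ d (hT hd), fun c => Finset.sum_insert fun h => ha (hT h)⟩
  have e1 : (L.powerset.filter fun T => ∀ c ∈ insert a L, ∑ d ∈ T, N c d = 0) = ker L N := by
    refine Finset.filter_congr fun T hT => ?_
    simp [key T hT]
  have e2 : (L.powerset.filter fun T => ∀ c ∈ insert a L, ∑ d ∈ insert a T, N c d = 0) =
      if N a a = 0 then ker L N else ∅ := by
    split_ifs with h
    · refine Finset.filter_congr fun T hT => ?_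
      have : ∀ c ∈ L, (N c a + ∑ d ∈ T, N c d = 0 ↔ ∑ d ∈ T, N c d = 0) := fun c hc => by
        rw [h₁ c hc, zero_add]
      simp only [key T hT, Finset.forall_mem_insert, h, zero_add, true_and]
      exact forall₂_congr this
    · refine Finset.filter_eq_empty_iff.2 fun T hT h' => h ?_
      have := h' a (Finset.mem_insert_self _ _)
      rwa [(key T hT).2, (key T hT).1, add_zero] at this
  rw [ker, card_filter_powerset_insert ha, e1, e2]
  split_ifs
  · ring
  · simp

/-- Split kernel vectors by their coordinates `x`, `y` at `a`, `b`. The equations on `L` see only `x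
+ y`. Both new equations prescribe the same sum of `v` over the support, whence the compatibility
condition in `f`. -/
theorem card_ker_insert_two {L : Finset ℕ} {a b : ℕ} (ha : a ∉ L) (hb : b ∉ L) (hab : a ≠ b)
    (N : ℕ → ℕ → ZMod 2) (v : ℕ → ZMod 2)
    (h₁ : ∀ e ∈ L, N e a = v e) (h₂ : ∀ e ∈ L, N a e = v e)
    (h₃ : ∀ e ∈ L, N e b = v e) (h₄ : ∀ e ∈ L, N b e = v e) :
    let f : ZMod 2 → ZMod 2 → ℕ := fun x y =>
      if N a a * x + N a b * y = N b a * x + N b b * y then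
        sols L N v 0 (x + y) 0 (N a a * x + N a b * y) 0 else 0
    (ker (insert a (insert b L)) N).card = f 0 0 + f 0 1 + f 1 0 + f 1 1 := by
  intro f
  have hab' : a ∉ insert b L := by simp [hab, ha]
  rw [ker, card_filter_powerset_insert hab', card_filter_powerset_insert hb,
    card_filter_powerset_insert hb]
  have key : ∀ (x y : ZMod 2) (F : Finset ℕ → ℕ → ZMod 2),
      (∀ T ∈ L.powerset, ∀ c, F T c = N c a * x + N c b * y + ∑ d ∈ T, N c d) →
      (L.powerset.filter fun T => ∀ c ∈ insert a (insert b L), F T c = 0).card = f x y := by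
    intro x y F hF
    -- The summand `0 * 0` only matches the shape of `sols`, whose second vector is zero here.
    have aux : ∀ T ∈ L.powerset, (∀ c ∈ insert a (insert b L), F T c = 0) ↔
        ((∑ d ∈ T, v d = N a a * x + N a b * y ∧ ∑ d ∈ T, v d = N b a * x + N b b * y) ∧
          ∀ e ∈ L, (x + y) * v e + 0 * 0 + ∑ d ∈ T, N e d = 0) := by
      intro T hT
      have hT' := Finset.mem_powerset.1 hT
      simp only [Finset.forall_mem_insert, hF T hT]
      rw [Finset.sum_congr rfl fun d hd => h₂ d (hT' hd),
        Finset.sum_congr (f := fun d => N b d) rfl fun d hd => h₄ d (hT' hd), ← and_assoc]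
      refine and_congr (and_congr ?_ ?_) (forall₂_congr fun e he => ?_)
      · rw [CharTwo.add_eq_zero, eq_comm]
      · rw [CharTwo.add_eq_zero, eq_comm]
      · rw [h₁ e he, h₃ e he]; ring_nf
    by_cases h : N a a * x + N a b * y = N b a * x + N b b * y
    · simp only [f, if_pos h, sols]
      congr 1
      refine Finset.filter_congr fun T hT => ?_
      rw [aux T hT, ← h]
      simp [and_comm]
    · simp only [f, if_neg h]
      rw [Finset.card_eq_zero, Finset.filter_eq_empty_iff]
      intro T hT h'
      have := (aux T hT).1 h'
      exact h (this.1.1.symm.trans this.1.2)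
  have hins : ∀ T ∈ L.powerset, a ∉ T ∧ b ∉ T ∧ a ∉ insert b T := by
    intro T hT
    rw [Finset.mem_powerset] at hT
    have i1 : a ∉ T := fun h => ha (hT h)
    exact ⟨i1, fun h => hb (hT h), by simp [hab, i1]⟩
  rw [key 0 0 fun T c => ∑ d ∈ T, N c d, key 0 1 fun T c => ∑ d ∈ insert b T, N c d,
    key 1 0 fun T c => ∑ d ∈ insert a T, N c d,
    key 1 1 fun T c => ∑ d ∈ insert a (insert b T), N c d]
  · ring
  all_goals
    intro T hT c
    obtain ⟨i1, i2, i3⟩ := hins T hT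
    simp [Finset.sum_insert, i1, i2, i3, add_assoc]

/-- As for two indices: the equations on `L` see the new coordinates only through `x + y` and `y +
z`, and the equation of `b` must be the sum of those of `a` and `c`. -/
theorem card_ker_insert_three {L : Finset ℕ} {a b c : ℕ} (ha : a ∉ L) (hb : b ∉ L) (hc : c ∉ L)
    (hab : a ≠ b) (hac : a ≠ c) (hbc : b ≠ c) (N : ℕ → ℕ → ZMod 2) (v₁ v₂ : ℕ → ZMod 2)
    (h₁ : ∀ e ∈ L, N e a = v₁ e) (h₂ : ∀ e ∈ L, N a e = v₁ e)
    (h₃ : ∀ e ∈ L, N e b = v₁ e + v₂ e) (h₄ : ∀ e ∈ L, N b e = v₁ e + v₂ e)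
    (h₅ : ∀ e ∈ L, N e c = v₂ e) (h₆ : ∀ e ∈ L, N c e = v₂ e) :
    let f : ZMod 2 → ZMod 2 → ZMod 2 → ℕ := fun x y z =>
      if N b a * x + N b b * y + N b c * z = N a a * x + N a b * y + N a c * z +
          (N c a * x + N c b * y + N c c * z) then
        sols L N v₁ v₂ (x + y) (y + z) (N a a * x + N a b * y + N a c * z)
          (N c a * x + N c b * y + N c c * z) else 0
    (ker (insert a (insert b (insert c L))) N).card =
      f 0 0 0 + f 0 0 1 + f 0 1 0 + f 0 1 1 + f 1 0 0 + f 1 0 1 + f 1 1 0 + f 1 1 1 := by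
  intro f
  have ha' : a ∉ insert b (insert c L) := by simp [hab, hac, ha]
  have hb' : b ∉ insert c L := by simp [hbc, hb]
  rw [ker, card_filter_powerset_insert ha', card_filter_powerset_insert hb',
    card_filter_powerset_insert hb', card_filter_powerset_insert hc,
    card_filter_powerset_insert hc, card_filter_powerset_insert hc, card_filter_powerset_insert hc]
  have key : ∀ (x y z : ZMod 2) (F : Finset ℕ → ℕ → ZMod 2),
      (∀ T ∈ L.powerset, ∀ e, F T e = N e a * x + N e b * y + N e c * z + ∑ d ∈ T, N e d) →
      (L.powerset.filter fun T => ∀ e ∈ insert a (insert b (insert c L)), F T e = 0).card =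
        f x y z := by
    intro x y z F hF
    have aux : ∀ T ∈ L.powerset, (∀ e ∈ insert a (insert b (insert c L)), F T e = 0) ↔
        ((∑ d ∈ T, v₁ d = N a a * x + N a b * y + N a c * z ∧
          ∑ d ∈ T, v₂ d = N c a * x + N c b * y + N c c * z) ∧
          ∑ d ∈ T, v₁ d + ∑ d ∈ T, v₂ d = N b a * x + N b b * y + N b c * z) ∧
          ∀ e ∈ L, (x + y) * v₁ e + (y + z) * v₂ e + ∑ d ∈ T, N e d = 0 := by
      intro T hT
      have hT' := Finset.mem_powerset.1 hT
      simp only [Finset.forall_mem_insert, hF T hT]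
      rw [Finset.sum_congr rfl fun d hd => h₂ d (hT' hd),
        Finset.sum_congr (f := fun d => N b d) rfl fun d hd => h₄ d (hT' hd),
        Finset.sum_congr (f := fun d => N c d) rfl fun d hd => h₆ d (hT' hd),
        Finset.sum_add_distrib]
      have : ∀ p q r s : Prop, (p ∧ q ∧ r ∧ s) ↔ ((p ∧ r) ∧ q) ∧ s := by tauto
      rw [this]
      refine and_congr (and_congr (and_congr ?_ ?_) ?_) (forall₂_congr fun e he => ?_)
      · rw [CharTwo.add_eq_zero, eq_comm]
      · rw [CharTwo.add_eq_zero, eq_comm]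
      · rw [CharTwo.add_eq_zero, eq_comm]
      · rw [h₁ e he, h₃ e he, h₅ e he]; ring_nf
    by_cases h : N b a * x + N b b * y + N b c * z = N a a * x + N a b * y + N a c * z +
          (N c a * x + N c b * y + N c c * z)
    · simp only [f, if_pos h, sols]
      congr 1
      refine Finset.filter_congr fun T hT => ?_
      rw [aux T hT, h]
      constructor
      · rintro ⟨⟨⟨p, q⟩, -⟩, r⟩
        exact ⟨r, p, q⟩
      · rintro ⟨r, p, q⟩
        exact ⟨⟨⟨p, q⟩, by rw [p, q]⟩, r⟩
    · simp only [f, if_neg h]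
      rw [Finset.card_eq_zero, Finset.filter_eq_empty_iff]
      intro T hT h'
      have := (aux T hT).1 h'
      exact h (by rw [← this.1.2, ← this.1.1.1, ← this.1.1.2])
  have hins : ∀ T ∈ L.powerset, c ∉ T ∧ b ∉ T ∧ a ∉ T ∧ b ∉ insert c T ∧ a ∉ insert c T ∧
      a ∉ insert b T ∧ a ∉ insert b (insert c T) := by
    intro T hT
    rw [Finset.mem_powerset] at hT
    have i1 : a ∉ T := fun h => ha (hT h)
    have i2 : b ∉ T := fun h => hb (hT h)
    have i3 : c ∉ T := fun h => hc (hT h)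
    simp [i1, i2, i3, hab, hac, hbc]
  rw [key 0 0 0 fun T e => ∑ d ∈ T, N e d, key 0 0 1 fun T e => ∑ d ∈ insert c T, N e d,
    key 0 1 0 fun T e => ∑ d ∈ insert b T, N e d,
    key 0 1 1 fun T e => ∑ d ∈ insert b (insert c T), N e d,
    key 1 0 0 fun T e => ∑ d ∈ insert a T, N e d,
    key 1 0 1 fun T e => ∑ d ∈ insert a (insert c T), N e d,
    key 1 1 0 fun T e => ∑ d ∈ insert a (insert b T), N e d,
    key 1 1 1 fun T e => ∑ d ∈ insert a (insert b (insert c T)), N e d]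
  · ring
  all_goals
    intro T hT e
    obtain ⟨i1, i2, i3, i4, i5, i6, i7⟩ := hins T hT
    simp [Finset.sum_insert, i1, i2, i3, i4, i5, i6, i7, add_assoc]

/-! ### The bracket polynomial of a signed interlacement matrix -/

/-- The value of a circle. -/
noncomputable def delta : ℤ[T;T⁻¹] := -(T 2 + T (-2))

/-- The weight of a crossing `c` with sign `σ c` in the state in which the crossings in `S` are not
smoothed according to the orientation. -/
noncomputable def wt (σ : ℕ → Bool) (S : Finset ℕ) (c : ℕ) : ℤ[T;T⁻¹] :=
  if decide (c ∈ S) = σ c then T (-1) else T 1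

/-- The bracket polynomial; a state `S` has one circle more than the nullity of its matrix. -/
noncomputable def bracket (L : Finset ℕ) (M : ℕ → ℕ → ZMod 2) (σ : ℕ → Bool) : ℤ[T;T⁻¹] :=
  ∑ S ∈ L.powerset, (∏ c ∈ L, wt σ S c) * delta ^ nul L (withDiag M (ind S))

/-- The weight of a smoothing of a positive or negative crossing. -/
noncomputable def wt₀ (s x : Bool) : ℤ[T;T⁻¹] := if x = s then T (-1) else T 1

theorem sum_wt_insert {L : Finset ℕ} {a : ℕ} (ha : a ∉ L) (σ : ℕ → Bool)
    (F : Finset ℕ → ℤ[T;T⁻¹]) :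
    ∑ S ∈ (insert a L).powerset, (∏ c ∈ insert a L, wt σ S c) * F S =
      ∑ S ∈ L.powerset, (∏ c ∈ L, wt σ S c) *
        (wt₀ (σ a) false * F S + wt₀ (σ a) true * F (insert a S)) := by
  rw [Finset.sum_powerset_insert ha, ← Finset.sum_add_distrib]
  refine Finset.sum_congr rfl fun S hS => ?_
  rw [Finset.mem_powerset] at hS
  have haS : a ∉ S := fun h => ha (hS h)
  rw [Finset.prod_insert ha, Finset.prod_insert ha]
  have : ∏ c ∈ L, wt σ (insert a S) c = ∏ c ∈ L, wt σ S c := by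
    refine Finset.prod_congr rfl fun c hc => ?_
    have : c ≠ a := fun h => ha (h ▸ hc)
    simp [wt, this]
  rw [this]
  simp only [wt, wt₀, haS, Finset.mem_insert_self, decide_true, decide_false]
  ring

/-- The states overwrite the diagonal, so only off-diagonal entries matter. -/
theorem bracket_congr {L : Finset ℕ} {M M' : ℕ → ℕ → ZMod 2} {σ σ' : ℕ → Bool}
    (hM : ∀ c ∈ L, ∀ d ∈ L, c ≠ d → M c d = M' c d) (hσ : ∀ c ∈ L, σ c = σ' c) :
    bracket L M σ = bracket L M' σ' := by
  refine Finset.sum_congr rfl fun S _ => ?_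
  congr 1
  · exact Finset.prod_congr rfl fun c hc => by simp [wt, hσ c hc]
  · have : ker L (withDiag M (ind S)) = ker L (withDiag M' (ind S)) := by
      refine ker_congr fun c hc d hd => ?_
      simp only [withDiag]
      split_ifs with h
      · rfl
      · exact hM c hc d hd h
    rw [nul, nul, this]

theorem ind_insert_self (S : Finset ℕ) (a : ℕ) : ind (insert a S) a = 1 := by simp [ind]

theorem ind_insert_of_ne (S : Finset ℕ) {a c : ℕ} (h : c ≠ a) : ind (insert a S) c = ind S c := by
  simp [ind, h]

theorem ind_of_notMem {S : Finset ℕ} {c : ℕ} (h : c ∉ S) : ind S c = 0 := by simp [ind, h]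

/-- The circle value to the power of the binary logarithm. -/
noncomputable def dpow (n : ℕ) : ℤ[T;T⁻¹] := delta ^ Nat.log 2 n

theorem dpow_two_mul {n : ℕ} (h : 0 < n) : dpow (2 * n) = delta * dpow n := by
  rw [dpow, dpow, mul_comm 2 n, Nat.log_mul_base (by norm_num) h.ne', pow_succ]
  ring

theorem sols_congr {L : Finset ℕ} {N N' : ℕ → ℕ → ZMod 2} {v₁ v₂ : ℕ → ZMod 2}
    (h : ∀ c ∈ L, ∀ d ∈ L, N c d = N' c d) : sols L N v₁ v₂ = sols L N' v₁ v₂ := by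
  funext s t α γ
  simp only [sols]
  congr 1
  refine Finset.filter_congr fun T hT => ?_
  rw [Finset.mem_powerset] at hT
  refine and_congr (forall₂_congr fun e he => ?_) Iff.rfl
  rw [Finset.sum_congr rfl fun d hd => h e he d (hT hd)]

theorem zmod_two_cases (x : ZMod 2) : x = 0 ∨ x = 1 := by
  revert x; decide

theorem T_identities : (T 1 * T (-1) : ℤ[T;T⁻¹]) = 1 ∧ (T 2 : ℤ[T;T⁻¹]) = T 1 * T 1 ∧
    (T (-2) : ℤ[T;T⁻¹]) = T (-1) * T (-1) ∧ (T 3 : ℤ[T;T⁻¹]) = T 1 * T 1 * T 1 ∧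
    (T (-3) : ℤ[T;T⁻¹]) = T (-1) * T (-1) * T (-1) := by
  refine ⟨?_, ?_, ?_, ?_, ?_⟩
  · rw [← T_add]; exact T_zero
  · rw [← T_add]; rfl
  · rw [← T_add]; rfl
  · rw [← T_add, ← T_add]; rfl
  · rw [← T_add, ← T_add]; rfl

/-- One smoothing of an isolated crossing splits off a circle, the other does not. Writing `A` for
`T 1`, the factor is `A δ + A⁻¹ = -A³` for a positive crossing, and its mirror image for a negative
one. -/
theorem bracket_insert_isolated {L : Finset ℕ} {a : ℕ} (ha : a ∉ L) (M : ℕ → ℕ → ZMod 2)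
    (σ : ℕ → Bool) (h₁ : ∀ e ∈ L, M e a = 0) (h₂ : ∀ e ∈ L, M a e = 0) :
    bracket (insert a L) M σ = -(T (if σ a then 3 else -3) * bracket L M σ) := by
  rw [bracket, sum_wt_insert ha, bracket, Finset.mul_sum, ← Finset.sum_neg_distrib]
  refine Finset.sum_congr rfl fun S hS => ?_
  rw [Finset.mem_powerset] at hS
  have haS : a ∉ S := fun h => ha (hS h)
  have hne : ∀ e ∈ L, e ≠ a := fun e he h => ha (h ▸ he)
  have e1 : nul (insert a L) (withDiag M (ind S)) = nul L (withDiag M (ind S)) + 1 := by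
    rw [nul, card_ker_insert ha, if_pos, mul_comm, Nat.log_mul_base (by norm_num)
      (card_ker_pos _ _).ne', nul]
    · simp [withDiag, ind, haS]
    · intro e he; simp [withDiag, hne e he, h₁ e he]
    · intro e he; simp [withDiag, (hne e he).symm, h₂ e he]
  have e2 : nul (insert a L) (withDiag M (ind (insert a S))) = nul L (withDiag M (ind S)) := by
    rw [nul, card_ker_insert ha, if_neg, nul]
    · congr 2
      refine ker_congr fun c hc d _ => ?_
      simp [withDiag, ind_insert_of_ne S (hne c hc)]
    · simp [withDiag, ind]
    · intro e he; simp [withDiag, hne e he, h₁ e he]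
    · intro e he; simp [withDiag, (hne e he).symm, h₂ e he]
  rw [e1, e2, pow_succ]
  have : wt₀ (σ a) false * delta + wt₀ (σ a) true = -T (if σ a then 3 else -3) := by
    obtain ⟨h1, h2, h3, h4, h5⟩ := T_identities
    rw [delta, h2, h3]
    cases σ a
    · simp only [wt₀, Bool.false_eq_true, if_true, if_false, reduceCtorEq, h5]; grind
    · simp only [wt₀, Bool.false_eq_true, if_true, if_false, h4]; grind
  linear_combination (∏ c ∈ L, wt σ S c) * delta ^ nul L (withDiag M (ind S)) * this

/-- Here `Z i j` is the kernel size for the diagonal entries `i`, `j` and mutual entry `p`. The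
state `(p, p)` has a kernel twice as large as that of either mixed state. Since the signs are
opposite, these three have weights `1`, `A²`, `A⁻²`, and they cancel by `δ + A² + A⁻² = 0`. The
state `(p + 1, p + 1)` of weight `1` remains and gives the diagram without the bigon. -/
theorem dpow_bigon (m : ZMod 2 → ZMod 2 → ℕ) (hm : 0 < m 0 0) (s : Bool) (p : ZMod 2) :
    let Z : ZMod 2 → ZMod 2 → ℕ := fun i j =>
      let f : ZMod 2 → ZMod 2 → ℕ := fun x y =>
        if i * x + p * y = p * x + j * y then m (x + y) (i * x + p * y) else 0
      f 0 0 + f 0 1 + f 1 0 + f 1 1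
    wt₀ s false * (wt₀ (!s) false * dpow (Z 0 0) + wt₀ (!s) true * dpow (Z 0 1)) +
      wt₀ s true * (wt₀ (!s) false * dpow (Z 1 0) + wt₀ (!s) true * dpow (Z 1 1)) =
        dpow (m 0 0 + m 0 1) := by
  intro Z
  obtain ⟨h3, h4, h5, -⟩ := T_identities
  have two : (1 : ZMod 2) + 1 = 0 := rfl
  have h1 : ∀ n, dpow (m 0 0 + n + n + m 0 0) = delta * dpow (m 0 0 + n) := fun n => by
    rw [← dpow_two_mul (by omega)]; congr 1; ring
  rcases zmod_two_cases p with rfl | rfl <;> cases s <;>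
    simp [Z, wt₀, two, h1, delta, h4, h5, -mul_eq_mul_left_iff]
  all_goals
    clear_value Z
    clear h4 h5
    generalize (T 1 : ℤ[T;T⁻¹]) = A at *
    generalize (T (-1) : ℤ[T;T⁻¹]) = B at *
    grind

/-- The number of solutions of the linear system of a state of three crossings `a`, `b`, `c` with
diagonal entries `i`, `j`, `k` and with `p`, `q`, `r` for the pairs `ab`, `ac`, `bc`. -/
def triSols (m : ZMod 2 → ZMod 2 → ZMod 2 → ZMod 2 → ℕ) (p q r i j k : ZMod 2) : ℕ :=
  let f : ZMod 2 → ZMod 2 → ZMod 2 → ℕ := fun x y z =>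
    if p * x + j * y + r * z = i * x + p * y + q * z + (q * x + r * y + k * z) then
      m (x + y) (y + z) (i * x + p * y + q * z) (q * x + r * y + k * z) else 0
  f 0 0 0 + f 0 0 1 + f 0 1 0 + f 0 1 1 + f 1 0 0 + f 1 0 1 + f 1 1 0 + f 1 1 1

/-- For the diagonal `(p + q, p + r, q + r)` the indicator of the three crossings is a kernel
vector: it is the small circle inside the triangle. Changing any one of the three entries destroys
this vector. -/
theorem triSols_same (m : ZMod 2 → ZMod 2 → ZMod 2 → ZMod 2 → ℕ) (p q r : ZMod 2) :
    triSols m p q r (p + q) (p + r) (q + r) = 2 * triSols m p q r (p + q) (p + r + 1) (q + r) ∧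
    triSols m p q r (p + q + 1) (p + r) (q + r) = triSols m p q r (p + q) (p + r + 1) (q + r) ∧
    triSols m p q r (p + q) (p + r) (q + r + 1) = triSols m p q r (p + q) (p + r + 1) (q + r) := by
  have two : (1 : ZMod 2) + 1 = 0 := rfl
  rcases zmod_two_cases p with rfl | rfl <;> rcases zmod_two_cases q with rfl | rfl <;>
    rcases zmod_two_cases r with rfl | rfl <;> simp [triSols, two] <;> omega

/-- Relative to the diagonal `(p + q, p + r, q + r)`, which is the same on both sides of the move: a
state with two changed entries matches the state with the same changes on the other side, and the
state with all three changed matches those with one change. -/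
theorem triSols_compl (m : ZMod 2 → ZMod 2 → ZMod 2 → ZMod 2 → ℕ) (p q r : ZMod 2) :
    triSols m p q r (p + q + 1) (p + r + 1) (q + r + 1) =
      triSols m (p + 1) (q + 1) (r + 1) (p + q) (p + r + 1) (q + r) ∧
    triSols m p q r (p + q) (p + r + 1) (q + r + 1) =
      triSols m (p + 1) (q + 1) (r + 1) (p + q) (p + r + 1) (q + r + 1) ∧
    triSols m p q r (p + q + 1) (p + r) (q + r + 1) =
      triSols m (p + 1) (q + 1) (r + 1) (p + q + 1) (p + r) (q + r + 1) ∧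
    triSols m p q r (p + q + 1) (p + r + 1) (q + r) =
      triSols m (p + 1) (q + 1) (r + 1) (p + q + 1) (p + r + 1) (q + r) := by
  have two : (1 : ZMod 2) + 1 = 0 := rfl
  rcases zmod_two_cases p with rfl | rfl <;> rcases zmod_two_cases q with rfl | rfl <;>
    rcases zmod_two_cases r with rfl | rfl <;> simp [triSols, two] <;> omega

theorem triSols_pos {m : ZMod 2 → ZMod 2 → ZMod 2 → ZMod 2 → ℕ} (hm : 0 < m 0 0 0 0)
    (p q r i j k : ZMod 2) : 0 < triSols m p q r i j k := by
  have : m 0 0 0 0 ≤ triSols m p q r i j k := by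
    simp only [triSols, mul_zero, add_zero, if_true]
    omega
  omega

/-- The sum over the states of three crossings with signs `sa`, `sb`, `sc`. -/
noncomputable def triSum (m : ZMod 2 → ZMod 2 → ZMod 2 → ZMod 2 → ℕ) (sa sb sc : Bool)
    (p q r : ZMod 2) : ℤ[T;T⁻¹] :=
  wt₀ sa false * (wt₀ sb false * (wt₀ sc false * dpow (triSols m p q r 0 0 0) +
        wt₀ sc true * dpow (triSols m p q r 0 0 1)) +
      wt₀ sb true * (wt₀ sc false * dpow (triSols m p q r 0 1 0) +
        wt₀ sc true * dpow (triSols m p q r 0 1 1))) +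
    wt₀ sa true * (wt₀ sb false * (wt₀ sc false * dpow (triSols m p q r 1 0 0) +
        wt₀ sc true * dpow (triSols m p q r 1 0 1)) +
      wt₀ sb true * (wt₀ sc false * dpow (triSols m p q r 1 1 0) +
        wt₀ sc true * dpow (triSols m p q r 1 1 1)))

/-- The states with two changes agree termwise on both sides. The sign conditions say that in the
state with the inner circle `b` has the type of smoothing opposite to that of `a` and `c`. Hence the
four states with at most one change collapse, by `δ = -(A² + A⁻²)`, to a single term with the weight
of the state with three changes, which is the contribution of that state on the other side. -/
theorem dpow_triangle (m : ZMod 2 → ZMod 2 → ZMod 2 → ZMod 2 → ℕ) (hm : 0 < m 0 0 0 0)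
    (sa sb sc : Bool) (p q r : ZMod 2)
    (hab : (sa == sb) = decide (q + r = 1)) (hbc : (sb == sc) = decide (p + q = 1)) :
    triSum m sa sb sc p q r = triSum m sa sb sc (p + 1) (q + 1) (r + 1) := by
  obtain ⟨h3, h4, h5, -⟩ := T_identities
  have two : (1 : ZMod 2) + 1 = 0 := rfl
  have tw : ∀ n : ZMod 2, n + 1 + 1 = n := fun n => by rw [add_assoc, two, add_zero]
  obtain ⟨a1, a2, a3⟩ := triSols_same m p q r
  obtain ⟨b1, b2, b3⟩ := triSols_same m (p + 1) (q + 1) (r + 1)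
  obtain ⟨c1, c2, c3, c4⟩ := triSols_compl m p q r
  obtain ⟨d1, -⟩ := triSols_compl m (p + 1) (q + 1) (r + 1)
  replace a1 := (congrArg dpow a1).trans (dpow_two_mul (triSols_pos hm _ _ _ _ _ _))
  replace b1 := (congrArg dpow b1).trans (dpow_two_mul (triSols_pos hm _ _ _ _ _ _))
  have hd : delta = -(T 1 * T 1 + T (-1) * T (-1)) := by rw [delta, h4, h5]
  clear h4 h5
  simp only [triSum, wt₀]
  rw [hd] at a1 b1
  clear hd
  generalize (T 1 : ℤ[T;T⁻¹]) = A at *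
  generalize (T (-1) : ℤ[T;T⁻¹]) = B at *
  -- The signs of `a` and `c` are determined by `sb`, `p`, `q`, `r`, which leaves sixteen polynomial
  -- identities.
  have hsa : sa = (sb == decide (q + r = 1)) := by rw [← hab]; cases sa <;> cases sb <;> rfl
  have hsc : sc = (sb == decide (p + q = 1)) := by rw [← hbc]; cases sc <;> cases sb <;> rfl
  subst hsa hsc
  clear hab hbc
  rcases zmod_two_cases p with rfl | rfl <;> rcases zmod_two_cases q with rfl | rfl <;>
    rcases zmod_two_cases r with rfl | rfl <;> cases sb <;>
    simp only [zero_add, add_zero, two, zero_ne_one, decide_true, decide_false, beq_true,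
      beq_false, if_true, Bool.not_true, Bool.not_false, reduceIte, reduceCtorEq]
      at a1 a2 a3 b1 b2 b3 c1 c2 c3 c4 d1 ⊢ <;>
    simp only [a1, a2, a3, b1, b2, b3, c1, c2, c3, c4, d1] <;> grind

/-- The kernel is divided according to the value of the linear form `v`. -/
theorem card_ker_eq_sols (L : Finset ℕ) (N : ℕ → ℕ → ZMod 2) (v : ℕ → ZMod 2) :
    (ker L N).card = sols L N v 0 0 0 0 0 + sols L N v 0 0 0 1 0 := by
  rw [sols, sols, ← Finset.card_union_of_disjoint]
  · congr 1
    ext T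
    simp only [mem_ker, Finset.mem_union, Finset.mem_filter, Finset.mem_powerset, zero_mul,
      zero_add, Pi.zero_apply, Finset.sum_const_zero, and_true]
    rcases zmod_two_cases (∑ d ∈ T, v d) with h | h <;> simp [h]
  · rw [Finset.disjoint_filter]
    rintro T - ⟨-, h, -⟩ ⟨-, h', -⟩
    rw [h] at h'
    exact zero_ne_one h'

theorem dpow_card_ker (L : Finset ℕ) (N : ℕ → ℕ → ZMod 2) : dpow (ker L N).card = delta ^ nul L N :=
  rfl

/-- Algebraic form of the second Reidemeister move. It holds for each smoothing of the remaining
crossings separately, by `dpow_bigon`. -/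
theorem bracket_insert_two {L : Finset ℕ} {a b : ℕ} (ha : a ∉ L) (hb : b ∉ L) (hab : a ≠ b)
    (M : ℕ → ℕ → ZMod 2) (σ : ℕ → Bool) (v : ℕ → ZMod 2) (hσ : σ b = !σ a) (hM : M b a = M a b)
    (h₁ : ∀ e ∈ L, M e a = v e) (h₂ : ∀ e ∈ L, M a e = v e)
    (h₃ : ∀ e ∈ L, M e b = v e) (h₄ : ∀ e ∈ L, M b e = v e) :
    bracket (insert a (insert b L)) M σ = bracket L M σ := by
  have hab' : a ∉ insert b L := by simp [hab, ha]
  rw [bracket, sum_wt_insert hab', sum_wt_insert hb, bracket]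
  refine Finset.sum_congr rfl fun S hS => ?_
  congr 1
  rw [Finset.mem_powerset] at hS
  have haS : a ∉ S := fun h => ha (hS h)
  have hbS : b ∉ S := fun h => hb (hS h)
  have hea : ∀ e ∈ L, e ≠ a := fun e he h => ha (h ▸ he)
  have heb : ∀ e ∈ L, e ≠ b := fun e he h => hb (h ▸ he)
  set m : ZMod 2 → ZMod 2 → ℕ := fun s α => sols L (withDiag M (ind S)) v 0 s 0 α 0 with hm
  have key : ∀ S', (∀ e ∈ L, ind S' e = ind S e) →
      nul (insert a (insert b L)) (withDiag M (ind S')) = Nat.log 2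
        (let i := ind S' a
        let j := ind S' b
        let p := M a b
        let f : ZMod 2 → ZMod 2 → ℕ := fun x y =>
          if i * x + p * y = p * x + j * y then m (x + y) (i * x + p * y) else 0
        f 0 0 + f 0 1 + f 1 0 + f 1 1) := by
    intro S' hS'
    have e1 : sols L (withDiag M (ind S')) v 0 = sols L (withDiag M (ind S)) v 0 :=
      sols_congr fun c hc d hd => by simp only [withDiag, hS' c hc]
    have := card_ker_insert_two ha hb hab (withDiag M (ind S')) v
      (fun e he => by simp [withDiag, hea e he, h₁ e he])
      (fun e he => by simp [withDiag, (hea e he).symm, h₂ e he])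
      (fun e he => by simp [withDiag, heb e he, h₃ e he])
      (fun e he => by simp [withDiag, (heb e he).symm, h₄ e he])
    rw [nul, this, e1]
    simp [withDiag, hab, hab.symm, hM, m]
  have main := dpow_bigon m (sols_pos _ _ _ _) (σ a) (M a b)
  rw [hm] at main
  simp only [← card_ker_eq_sols L (withDiag M (ind S)) v, dpow_card_ker] at main
  rw [← main, key S fun _ _ => rfl, key (insert a S) fun e he => ind_insert_of_ne S (hea e he),
    key (insert b S) fun e he => ind_insert_of_ne S (heb e he),
    key (insert a (insert b S)) fun e he => by
      rw [ind_insert_of_ne _ (hea e he), ind_insert_of_ne _ (heb e he)]]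
  simp only [ind_insert_self, ind_insert_of_ne _ hab, ind_insert_of_ne _ hab.symm,
    ind_of_notMem haS, ind_of_notMem hbS, hσ, dpow, m]
  ring

theorem delta_pow_nul_insert_three {L : Finset ℕ} {a b c : ℕ} (ha : a ∉ L) (hb : b ∉ L)
    (hc : c ∉ L) (hab : a ≠ b) (hac : a ≠ c) (hbc : b ≠ c) (M : ℕ → ℕ → ZMod 2)
    (N : ℕ → ℕ → ZMod 2) (v₁ v₂ : ℕ → ZMod 2) (S : Finset ℕ)
    (hN : ∀ e ∈ L, ∀ f ∈ L, withDiag M (ind S) e f = N e f)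
    (h₁ : ∀ e ∈ L, M e a = v₁ e ∧ M a e = v₁ e)
    (h₂ : ∀ e ∈ L, M e b = v₁ e + v₂ e ∧ M b e = v₁ e + v₂ e)
    (h₃ : ∀ e ∈ L, M e c = v₂ e ∧ M c e = v₂ e)
    (hp : M b a = M a b) (hq : M c a = M a c) (hr : M c b = M b c) :
    delta ^ nul (insert a (insert b (insert c L))) (withDiag M (ind S)) =
      dpow (triSols (sols L N v₁ v₂) (M a b) (M a c) (M b c) (ind S a) (ind S b) (ind S c)) := by
  have hea : ∀ e ∈ L, e ≠ a := fun e he h => ha (h ▸ he)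
  have heb : ∀ e ∈ L, e ≠ b := fun e he h => hb (h ▸ he)
  have hec : ∀ e ∈ L, e ≠ c := fun e he h => hc (h ▸ he)
  have := card_ker_insert_three ha hb hc hab hac hbc (withDiag M (ind S)) v₁ v₂
    (fun e he => by simp [withDiag, hea e he, h₁ e he])
    (fun e he => by simp [withDiag, (hea e he).symm, h₁ e he])
    (fun e he => by simp [withDiag, heb e he, h₂ e he])
    (fun e he => by simp [withDiag, (heb e he).symm, h₂ e he])
    (fun e he => by simp [withDiag, hec e he, h₃ e he])
    (fun e he => by simp [withDiag, (hec e he).symm, h₃ e he])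
  rw [nul, this, sols_congr hN, dpow, triSols]
  simp only [withDiag, hab, hab.symm, hac, hac.symm, hbc, hbc.symm, hp, hq, hr, if_true, if_false]

theorem state_sum_three {L : Finset ℕ} {a b c : ℕ} (ha : a ∉ L) (hb : b ∉ L)
    (hc : c ∉ L) (hab : a ≠ b) (hac : a ≠ c) (hbc : b ≠ c) (M : ℕ → ℕ → ZMod 2) (σ : ℕ → Bool)
    (N : ℕ → ℕ → ZMod 2) (v₁ v₂ : ℕ → ZMod 2) {S : Finset ℕ} (hS : S ⊆ L)
    (hN : ∀ e ∈ L, ∀ f ∈ L, withDiag M (ind S) e f = N e f)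
    (h₁ : ∀ e ∈ L, M e a = v₁ e ∧ M a e = v₁ e)
    (h₂ : ∀ e ∈ L, M e b = v₁ e + v₂ e ∧ M b e = v₁ e + v₂ e)
    (h₃ : ∀ e ∈ L, M e c = v₂ e ∧ M c e = v₂ e)
    (hp : M b a = M a b) (hq : M c a = M a c) (hr : M c b = M b c) :
    let F : Finset ℕ → ℤ[T;T⁻¹] := fun S =>
      delta ^ nul (insert a (insert b (insert c L))) (withDiag M (ind S))
    let G : Finset ℕ → ℤ[T;T⁻¹] := fun S =>
      wt₀ (σ a) false * F S + wt₀ (σ a) true * F (insert a S)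
    let H : Finset ℕ → ℤ[T;T⁻¹] := fun S =>
      wt₀ (σ b) false * G S + wt₀ (σ b) true * G (insert b S)
    wt₀ (σ c) false * H S + wt₀ (σ c) true * H (insert c S) =
      triSum (sols L N v₁ v₂) (σ a) (σ b) (σ c) (M a b) (M a c) (M b c) := by
  intro F G H
  have key : ∀ S', (∀ e ∈ L, ind S' e = ind S e) → F S' =
      dpow (triSols (sols L N v₁ v₂) (M a b) (M a c) (M b c) (ind S' a) (ind S' b) (ind S' c)) :=
    fun S' hS' => delta_pow_nul_insert_three ha hb hc hab hac hbc M N v₁ v₂ S'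
      (fun e he f hf => by rw [← hN e he f hf]; simp only [withDiag, hS' e he]) h₁ h₂ h₃ hp hq hr
  have step : ∀ (S' : Finset ℕ) (x : ℕ), x ∉ L → (∀ e ∈ L, ind S' e = ind S e) →
      ∀ e ∈ L, ind (insert x S') e = ind S e := by
    intro S' x hx h e he
    rw [ind_insert_of_ne _ (show e ≠ x from fun h => hx (h ▸ he)), h e he]
  have i0 : ∀ e ∈ L, ind S e = ind S e := fun _ _ => rfl
  have ic := step S c hc i0
  have ib := step S b hb i0
  have ibc := step _ b hb ic
  simp only [H, G]
  rw [key S i0, key _ (step _ a ha i0), key _ ib, key _ ic, key _ ibc, key _ (step _ a ha ic),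
    key _ (step _ a ha ib), key _ (step _ a ha ibc)]
  simp only [ind_insert_self, ind_insert_of_ne _ hab, ind_insert_of_ne _ hab.symm,
    ind_insert_of_ne _ hac, ind_insert_of_ne _ hac.symm,
    ind_insert_of_ne _ hbc, ind_insert_of_ne _ hbc.symm,
    ind_of_notMem fun h => ha (hS h), ind_of_notMem fun h => hb (hS h),
    ind_of_notMem fun h => hc (hS h)]
  rw [triSum]
  ring

/-- Algebraic form of the third Reidemeister move: only the three mutual entries flip. It holds for
each smoothing of the remaining crossings separately, by `dpow_triangle`. -/
theorem bracket_insert_three {L : Finset ℕ} {a b c : ℕ} (ha : a ∉ L) (hb : b ∉ L) (hc : c ∉ L)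
    (hab : a ≠ b) (hac : a ≠ c) (hbc : b ≠ c) (M M' : ℕ → ℕ → ZMod 2) (σ : ℕ → Bool)
    (v₁ v₂ : ℕ → ZMod 2) (hM : ∀ e ∈ L, ∀ f ∈ L, e ≠ f → M e f = M' e f)
    (h₁ : ∀ e ∈ L, M e a = v₁ e ∧ M a e = v₁ e) (h₁' : ∀ e ∈ L, M' e a = v₁ e ∧ M' a e = v₁ e)
    (h₂ : ∀ e ∈ L, M e b = v₁ e + v₂ e ∧ M b e = v₁ e + v₂ e)
    (h₂' : ∀ e ∈ L, M' e b = v₁ e + v₂ e ∧ M' b e = v₁ e + v₂ e)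
    (h₃ : ∀ e ∈ L, M e c = v₂ e ∧ M c e = v₂ e) (h₃' : ∀ e ∈ L, M' e c = v₂ e ∧ M' c e = v₂ e)
    (hp : M b a = M a b ∧ M' a b = M a b + 1 ∧ M' b a = M a b + 1)
    (hq : M c a = M a c ∧ M' a c = M a c + 1 ∧ M' c a = M a c + 1)
    (hr : M c b = M b c ∧ M' b c = M b c + 1 ∧ M' c b = M b c + 1)
    (hσ₁ : (σ a == σ b) = decide (M a c + M b c = 1))
    (hσ₂ : (σ b == σ c) = decide (M a b + M a c = 1)) :
    bracket (insert a (insert b (insert c L))) M σ =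
      bracket (insert a (insert b (insert c L))) M' σ := by
  have ha' : a ∉ insert b (insert c L) := by simp [hab, hac, ha]
  have hb' : b ∉ insert c L := by simp [hbc, hb]
  rw [bracket, bracket, sum_wt_insert ha', sum_wt_insert ha', sum_wt_insert hb', sum_wt_insert hb',
    sum_wt_insert hc, sum_wt_insert hc]
  refine Finset.sum_congr rfl fun S hS => ?_
  refine congrArg _ ?_
  rw [Finset.mem_powerset] at hS
  refine (state_sum_three ha hb hc hab hac hbc M σ (withDiag M (ind S)) v₁ v₂ hS
    (fun _ _ _ _ => rfl) h₁ h₂ h₃ hp.1 hq.1 hr.1).trans (Eq.trans ?_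
    (state_sum_three ha hb hc hab hac hbc M' σ (withDiag M (ind S)) v₁ v₂ hS
    (fun e he f hf => ?_) h₁' h₂' h₃' (hp.2.2.trans hp.2.1.symm) (hq.2.2.trans hq.2.1.symm)
    (hr.2.2.trans hr.2.1.symm)).symm)
  · rw [hp.2.1, hq.2.1, hr.2.1]
    exact dpow_triangle _ (sols_pos _ _ _ _) _ _ _ _ _ _ hσ₁ hσ₂
  · simp only [withDiag]
    split_ifs with h
    · rfl
    · exact (hM e he f hf h).symm

theorem bracket_map (e : ℕ ≃ ℕ) (L : Finset ℕ) (M : ℕ → ℕ → ZMod 2) (σ : ℕ → Bool) :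
    bracket (L.map e.toEmbedding) M σ = bracket L (fun c d => M (e c) (e d)) (σ ∘ e) := by
  symm
  refine Finset.sum_bij' (fun (S : Finset ℕ) _ => S.map e.toEmbedding) (fun (S : Finset ℕ) _ => S.map e.symm.toEmbedding)
    ?_ ?_ ?_ ?_ ?_
  · intro S hS
    simpa using hS
  · intro S hS
    rw [Finset.mem_powerset] at hS ⊢
    have := Finset.map_subset_map (f := e.symm.toEmbedding).2 hS
    simpa [Finset.map_map] using this
  · intro S hS
    simp [Finset.map_map]
  · intro S hS
    simp [Finset.map_map]
  · intro S hS
    congr 1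
    · rw [Finset.prod_map]
      exact Finset.prod_congr rfl fun c _ => by simp [wt]
    · suffices h : (ker L (withDiag (fun c d => M (e c) (e d)) (ind S))).card =
          (ker (L.map e.toEmbedding) (withDiag M (ind (S.map e.toEmbedding)))).card by
        rw [nul, nul, h]
      refine Finset.card_bij' (fun (T : Finset ℕ) _ => T.map e.toEmbedding) (fun (T : Finset ℕ) _ => T.map e.symm.toEmbedding)
        ?_ ?_ ?_ ?_
      · intro T hT
        rw [mem_ker] at hT ⊢
        refine ⟨by simpa using hT.1, ?_⟩
        intro c hc
        obtain ⟨d, hd, rfl⟩ := Finset.mem_map.1 hc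
        rw [Finset.sum_map, ← hT.2 d hd]
        exact Finset.sum_congr rfl fun x _ => by simp [withDiag, ind]
      · intro T hT
        rw [mem_ker] at hT ⊢
        refine ⟨?_, fun c hc => ?_⟩
        · have := Finset.map_subset_map (f := e.symm.toEmbedding).2 hT.1
          simpa [Finset.map_map] using this
        · have := hT.2 (e c) (by simpa using hc)
          rw [Finset.sum_map, ← this]
          exact Finset.sum_congr rfl fun x _ => by simp [withDiag, ind, Equiv.eq_symm_apply]
      · intro T hT
        simp [Finset.map_map]
      · intro T hT
        simp [Finset.map_map]

end TieKnot

namespace TieKnot.GaussCode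

/-! ### Invariance of the bracket polynomial -/

/-- The bracket polynomial of a Gauss code, divided by the value of a circle. -/
noncomputable def br (w : GaussCode) : ℤ[T;T⁻¹] := bracket (labels w) (beta w) (sgn w)

theorem inOrder_perm (b : Bool) (x y : Letter) : (inOrder b x y).Perm [x, y] := by
  cases b
  · exact List.Perm.swap _ _ _
  · exact List.Perm.refl _

@[simp] theorem tot_inOrder (b : Bool) (x y : Letter) (c : ℕ) :
    tot (inOrder b x y) c = (if x.label = c then 1 else 0) + if y.label = c then 1 else 0 := by
  rw [tot_perm (inOrder_perm b x y)]; simp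

theorem r2_perm (c d : ℕ) (s b : Bool) (u v : GaussCode) :
    (([⟨c, true, s⟩, ⟨d, true, !s⟩] : GaussCode) ++ u ++ inOrder b ⟨c, false, s⟩ ⟨d, false, !s⟩ ++ v).Perm
      (⟨c, true, s⟩ :: Letter.partner ⟨c, true, s⟩ :: ⟨d, true, !s⟩ ::
        Letter.partner ⟨d, true, !s⟩ :: (u ++ v)) := by
  refine (((inOrder_perm b _ _).append_left _).append_right _).trans ?_
  rw [← Multiset.coe_eq_coe]
  simp only [← Multiset.coe_add, ← Multiset.cons_coe, ← Multiset.singleton_add, Letter.partner,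
    Multiset.coe_nil, Bool.not_true]
  abel

theorem r3_perm (a b c : ℕ) (sa sb sc x y z : Bool) (u v w : GaussCode) :
    (topStrand x a b sa sb ++ u ++ midStrand y a c sa sc ++ v ++ botStrand z b c sb sc ++ w).Perm
      (⟨a, true, sa⟩ :: Letter.partner ⟨a, true, sa⟩ :: ⟨b, true, sb⟩ ::
        Letter.partner ⟨b, true, sb⟩ :: ⟨c, true, sc⟩ :: Letter.partner ⟨c, true, sc⟩ ::
        (u ++ v ++ w)) := by
  refine ((((((inOrder_perm x _ _).append_right _).append (inOrder_perm y _ _)).append_right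
    _).append (inOrder_perm z _ _)).append_right _).trans ?_
  rw [← Multiset.coe_eq_coe]
  simp only [← Multiset.coe_add, ← Multiset.cons_coe, ← Multiset.singleton_add, Letter.partner,
    Multiset.coe_nil, Bool.not_true]
  abel

theorem r3'_perm (a b c : ℕ) (sa sb sc x y z : Bool) (u v w : GaussCode) :
    (topStrand x a b sa sb ++ u ++ botStrand z b c sb sc ++ v ++ midStrand y a c sa sc ++ w).Perm
      (⟨a, true, sa⟩ :: Letter.partner ⟨a, true, sa⟩ :: ⟨b, true, sb⟩ ::
        Letter.partner ⟨b, true, sb⟩ :: ⟨c, true, sc⟩ :: Letter.partner ⟨c, true, sc⟩ ::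
        (u ++ v ++ w)) := by
  refine ((((((inOrder_perm x _ _).append_right _).append (inOrder_perm z _ _)).append_right
    _).append (inOrder_perm y _ _)).append_right _).trans ?_
  rw [← Multiset.coe_eq_coe]
  simp only [← Multiset.coe_add, ← Multiset.cons_coe, ← Multiset.singleton_add, Letter.partner,
    Multiset.coe_nil, Bool.not_true]
  abel

theorem br_rotate {u v : GaussCode} (h : WellFormed (u ++ v)) : br (v ++ u) = br (u ++ v) := by
  rw [br, labels_perm (List.perm_append_comm : (v ++ u).Perm (u ++ v))]
  exact bracket_congr (fun c _ d _ _ => beta_rotate h.tot_eq c d)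
    fun c _ => sgn_perm List.perm_append_comm c

theorem br_reverse {u : GaussCode} (h : WellFormed u) : br u.reverse = br u := by
  rw [br, labels_reverse]
  refine bracket_congr (fun c _ d _ hcd => ?_) fun c _ => sgn_perm (List.reverse_perm u) c
  rw [beta_reverse, beta_comm h.tot_eq hcd.symm]

theorem tot_relabel (e : Equiv.Perm ℕ) (u : GaussCode) (c : ℕ) :
    tot (u.map (Letter.relabel e)) (e c) = tot u c := by
  induction u with
  | nil => rfl
  | cons x u ih => simp [ih, Letter.relabel]

theorem beta_relabel (e : Equiv.Perm ℕ) (u : GaussCode) (c d : ℕ) :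
    beta (u.map (Letter.relabel e)) (e c) (e d) = beta u c d := by
  induction u with
  | nil => rfl
  | cons x u ih => simp [ih, Letter.relabel, tot_relabel]

theorem sgn_relabel (e : Equiv.Perm ℕ) (u : GaussCode) (c : ℕ) :
    sgn (u.map (Letter.relabel e)) (e c) = sgn u c := by
  induction u with
  | nil => rfl
  | cons x u ih =>
    simp [ih, Letter.relabel]

theorem labels_relabel (e : Equiv.Perm ℕ) (u : GaussCode) :
    labels (u.map (Letter.relabel e)) = (labels u).map e.toEmbedding := by
  ext c
  simp [mem_labels, Letter.relabel, Equiv.eq_symm_apply]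

theorem br_relabel (e : Equiv.Perm ℕ) (u : GaussCode) :
    br (u.map (Letter.relabel e)) = br u := by
  rw [br, labels_relabel, bracket_map]
  exact bracket_congr (fun c _ d _ _ => beta_relabel e u c d) fun c _ => sgn_relabel e u c

/-- The chord of a kink meets no other chord. -/
theorem br_r1 {c : ℕ} {o s : Bool} {u : GaussCode}
    (h : WellFormed (([⟨c, o, s⟩, ⟨c, !o, s⟩] : GaussCode) ++ u)) :
    br (([⟨c, o, s⟩, ⟨c, !o, s⟩] : GaussCode) ++ u) = -(T (if s then 3 else -3) * br u) := by
  have hc : c ∉ labels u := (WellFormed.tail (x := ⟨c, o, s⟩) h).2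
  have hne : ∀ e ∈ labels u, c ≠ e := fun e he h => hc (h ▸ he)
  have hl : labels (([⟨c, o, s⟩, ⟨c, !o, s⟩] : GaussCode) ++ u) = insert c (labels u) := by simp
  have hs : sgn (([⟨c, o, s⟩, ⟨c, !o, s⟩] : GaussCode) ++ u) c = s := by simp [sgn_eq_false hc]
  have hb : bracket (labels u) (beta ([⟨c, o, s⟩, ⟨c, !o, s⟩] ++ u))
      (sgn ([⟨c, o, s⟩, ⟨c, !o, s⟩] ++ u)) = br u :=
    bracket_congr (fun e he f hf _ => by simp [hne e he]) fun e he => by simp [hne e he]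
  rw [br, hl, bracket_insert_isolated hc, hs, hb]
  · intro e he
    simp [hne e he, beta_eq_zero_right hc]
  · intro e he
    simp [hne e he, beta_eq_zero_left hc, CharTwo.add_self_eq_zero]

/-- Both chords of the bigon meet exactly the chords with a single end in `u`, so their rows agree
on the other crossings. -/
theorem br_r2 {c d : ℕ} {s b : Bool} {u v : GaussCode}
    (h : WellFormed (([⟨c, true, s⟩, ⟨d, true, !s⟩] : GaussCode) ++ u ++
      inOrder b ⟨c, false, s⟩ ⟨d, false, !s⟩ ++ v)) :
    br (([⟨c, true, s⟩, ⟨d, true, !s⟩] : GaussCode) ++ u ++ inOrder b ⟨c, false, s⟩ ⟨d, false, !s⟩ ++ v) =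
      br (u ++ v) := by
  have hperm := r2_perm c d s b u v
  set w := ([⟨c, true, s⟩, ⟨d, true, !s⟩] : GaussCode) ++ u ++ inOrder b ⟨c, false, s⟩ ⟨d, false, !s⟩ ++ v
    with hw
  obtain ⟨h1, hc⟩ := (h.perm hperm).tail
  have hd := h1.tail.2
  have hcd : c ≠ d := by simp at hc; tauto
  replace hc : c ∉ labels (u ++ v) := by simp at hc ⊢; tauto
  replace hd : d ∉ labels (u ++ v) := hd
  have hce : ∀ e ∈ labels (u ++ v), c ≠ e := fun e he h => hc (h ▸ he)
  have hde : ∀ e ∈ labels (u ++ v), d ≠ e := fun e he h => hd (h ▸ he)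
  have hl : labels w = insert c (insert d (labels (u ++ v))) := by
    rw [labels_perm hperm]; simp [Letter.partner]
  have two : (1 : ZMod 2) + 1 = 0 := rfl
  have hsc : sgn w c = s := h.sgn_eq (x := ⟨c, true, s⟩) (by simp [w])
  have hsd : sgn w d = !s := h.sgn_eq (x := ⟨d, true, !s⟩) (by simp [w])
  have hcu : c ∉ labels u := by simp at hc; tauto
  have hcv : c ∉ labels v := by simp at hc; tauto
  have hdu : d ∉ labels u := by simp at hd; tauto
  have hdv : d ∉ labels v := by simp at hd; tauto
  have sym : ∀ {a b}, a ≠ b → beta w a b = beta w b a := beta_comm h.tot_eq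
  have k1 : ∀ e ∈ labels (u ++ v), beta w c e = tot u e := fun e he => by
    cases b <;> simp [w, inOrder, hce e he, hde e he, tot_eq_zero hcu,
      beta_eq_zero_left hcu, beta_eq_zero_left hcv, hcd.symm] <;> grind
  have k2 : ∀ e ∈ labels (u ++ v), beta w d e = tot u e := fun e he => by
    cases b <;> simp [w, inOrder, hce e he, hde e he, tot_eq_zero hdu,
      beta_eq_zero_left hdu, beta_eq_zero_left hdv, hcd] <;> grind
  rw [br, hl, bracket_insert_two (by simpa using hc) (by simpa using hd) hcd _ _ (tot u)
    (by rw [hsc, hsd]) (sym hcd.symm) (fun e he => (sym (hce e he).symm).trans (k1 e he)) k1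
    (fun e he => (sym (hde e he).symm).trans (k2 e he)) k2, br]
  refine bracket_congr (fun e he f hf _ => ?_) fun e he => ?_
  · cases b <;> simp [w, inOrder, hce e he, hde e he, hce f hf, hde f hf]
  · rw [sgn_perm hperm]; simp [Letter.partner, hce e he, hde e he]

/-- Common core of the two forms of the third move: reversing the order on each strand flips the
mutual interlacement of the three chords and leaves the rest of the matrix unchanged. -/
theorem br_triangle {a b c : ℕ} {sa sb sc : Bool} {t w w' : GaussCode} (v₁ v₂ : ℕ → ZMod 2)
    (hw : WellFormed w) (hw' : WellFormed w')
    (hp : w.Perm (⟨a, true, sa⟩ :: Letter.partner ⟨a, true, sa⟩ :: ⟨b, true, sb⟩ ::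
        Letter.partner ⟨b, true, sb⟩ :: ⟨c, true, sc⟩ :: Letter.partner ⟨c, true, sc⟩ :: t))
    (hp' : w.Perm w')
    (h₀ : ∀ e ∈ labels t, ∀ f ∈ labels t, beta w e f = beta w' e f)
    (h₁ : ∀ e ∈ labels t, beta w a e = v₁ e ∧ beta w' a e = v₁ e)
    (h₂ : ∀ e ∈ labels t, beta w b e = v₁ e + v₂ e ∧ beta w' b e = v₁ e + v₂ e)
    (h₃ : ∀ e ∈ labels t, beta w c e = v₂ e ∧ beta w' c e = v₂ e)
    (hab : beta w' a b = beta w a b + 1) (hac : beta w' a c = beta w a c + 1)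
    (hbc : beta w' b c = beta w b c + 1)
    (hσ₁ : (sa == sb) = decide (beta w a c + beta w b c = 1))
    (hσ₂ : (sb == sc) = decide (beta w a b + beta w a c = 1)) :
    br w = br w' := by
  obtain ⟨w1, ha⟩ := (hw.perm hp).tail
  obtain ⟨w2, hb⟩ := w1.tail
  obtain ⟨w3, hc⟩ := w2.tail
  have n1 : a ≠ b := by simp at ha; tauto
  have n2 : a ≠ c := by simp [Letter.partner] at ha; tauto
  have n3 : b ≠ c := by simp at hb; tauto
  have a1 : a ∉ labels t := by simp at ha; tauto
  have b1 : b ∉ labels t := by simp at hb; tauto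
  have c1 : c ∉ labels t := hc
  have ne : ∀ {x}, x ∉ labels t → ∀ e ∈ labels t, e ≠ x := fun hx e he h => hx (h ▸ he)
  have sym : ∀ {a b}, a ≠ b → beta w a b = beta w b a := beta_comm hw.tot_eq
  have sym' : ∀ {a b}, a ≠ b → beta w' a b = beta w' b a := beta_comm hw'.tot_eq
  have sa' : sgn w a = sa := hw.sgn_eq (x := ⟨a, true, sa⟩) (hp.mem_iff.2 (by simp))
  have sb' : sgn w b = sb := hw.sgn_eq (x := ⟨b, true, sb⟩) (hp.mem_iff.2 (by simp))
  have sc' : sgn w c = sc := hw.sgn_eq (x := ⟨c, true, sc⟩) (hp.mem_iff.2 (by simp))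
  have hl : labels w = insert a (insert b (insert c (labels t))) := by
    rw [labels_perm hp]; simp [Letter.partner]
  have hs : sgn w' = sgn w := funext fun x => (sgn_perm hp' x).symm
  rw [br, br, ← labels_perm hp', hl, hs]
  exact bracket_insert_three a1 b1 c1 n1 n2 n3 _ _ _ v₁ v₂ (fun e he f hf _ => h₀ e he f hf)
    (fun e he => ⟨(sym (ne a1 e he)).trans (h₁ e he).1, (h₁ e he).1⟩)
    (fun e he => ⟨(sym' (ne a1 e he)).trans (h₁ e he).2, (h₁ e he).2⟩)
    (fun e he => ⟨(sym (ne b1 e he)).trans (h₂ e he).1, (h₂ e he).1⟩)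
    (fun e he => ⟨(sym' (ne b1 e he)).trans (h₂ e he).2, (h₂ e he).2⟩)
    (fun e he => ⟨(sym (ne c1 e he)).trans (h₃ e he).1, (h₃ e he).1⟩)
    (fun e he => ⟨(sym' (ne c1 e he)).trans (h₃ e he).2, (h₃ e he).2⟩)
    ⟨sym n1.symm, hab, (sym' n1.symm).trans hab⟩ ⟨sym n2.symm, hac, (sym' n2.symm).trans hac⟩
    ⟨sym n3.symm, hbc, (sym' n3.symm).trans hbc⟩ (by rw [sa', sb', hσ₁]) (by rw [sb', sc', hσ₂])

/-- The letters of a Reidemeister 3 triangle and of the rest of the code are distinct. -/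
theorem r3_notMem {a b c : ℕ} {sa sb sc : Bool} {w u v t : GaussCode} (hw : WellFormed w)
    (hp : w.Perm (⟨a, true, sa⟩ :: Letter.partner ⟨a, true, sa⟩ :: ⟨b, true, sb⟩ ::
        Letter.partner ⟨b, true, sb⟩ :: ⟨c, true, sc⟩ :: Letter.partner ⟨c, true, sc⟩ ::
          (u ++ v ++ t))) :
    (a ≠ b ∧ a ≠ c ∧ b ≠ c) ∧ (a ∉ labels u ∧ a ∉ labels v ∧ a ∉ labels t) ∧
      (b ∉ labels u ∧ b ∉ labels v ∧ b ∉ labels t) ∧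
      (c ∉ labels u ∧ c ∉ labels v ∧ c ∉ labels t) := by
  obtain ⟨w1, ha⟩ := (hw.perm hp).tail
  obtain ⟨w2, hb⟩ := w1.tail
  have hc := w2.tail.2
  simp [Letter.partner] at ha hb hc
  tauto

/-- How the chords of a Reidemeister 3 triangle meet each other and the other chords. -/
theorem r3_beta {a b c : ℕ} {sa sb sc x y z : Bool} {u v w : GaussCode}
    (h : WellFormed (topStrand x a b sa sb ++ u ++ midStrand y a c sa sc ++ v ++
      botStrand z b c sb sc ++ w)) :
    let w' := topStrand x a b sa sb ++ u ++ midStrand y a c sa sc ++ v ++ botStrand z b c sb sc ++ w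
    (beta w' a b = (if x then 1 else 0) ∧ beta w' a c = (if !y then 1 else 0) ∧
      beta w' b c = if z then 1 else 0) ∧
    ∀ e ∈ labels (u ++ v ++ w),
      beta w' a e = tot u e ∧ beta w' b e = tot u e + tot v e ∧ beta w' c e = tot v e := by
  obtain ⟨⟨n1, n2, n3⟩, ⟨a1, a2, a3⟩, ⟨b1, b2, b3⟩, c1, c2, c3⟩ :=
    r3_notMem h (r3_perm a b c sa sb sc x y z u v w)
  have two : (1 : ZMod 2) + 1 = 0 := rfl
  refine ⟨?_, fun e he => ?_⟩
  · cases x <;> cases y <;> cases z <;> simp [topStrand, midStrand, botStrand, inOrder, n1, n2, n3,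
      n1.symm, n2.symm, n3.symm, beta_eq_zero_left a1, beta_eq_zero_left a2, beta_eq_zero_left a3,
      beta_eq_zero_left b1, beta_eq_zero_left b2, beta_eq_zero_left b3, tot_eq_zero a1,
      tot_eq_zero a2, tot_eq_zero a3, tot_eq_zero b1, tot_eq_zero b2, tot_eq_zero b3,
      tot_eq_zero c1, tot_eq_zero c2, tot_eq_zero c3, two]
  · have ne : ∀ {x}, x ∉ labels u → x ∉ labels v → x ∉ labels w → x ≠ e := by
      rintro x h1 h2 h3 rfl
      simp only [labels_append, Finset.mem_union] at he
      tauto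
    have nea := ne a1 a2 a3
    have neb := ne b1 b2 b3
    have nec := ne c1 c2 c3
    have htot := h.tot_eq e
    simp only [topStrand, midStrand, botStrand, tot_append, tot_inOrder, nea, neb,
      nec, if_false, zero_add, add_zero] at htot
    cases x <;> cases y <;> cases z <;> simp [topStrand, midStrand, botStrand, inOrder, n1, n2, n3,
      n1.symm, n2.symm, n3.symm, beta_eq_zero_left a1, beta_eq_zero_left a2, beta_eq_zero_left a3,
      beta_eq_zero_left b1, beta_eq_zero_left b2, beta_eq_zero_left b3, beta_eq_zero_left c1,
      beta_eq_zero_left c2, beta_eq_zero_left c3, tot_eq_zero a1,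
      tot_eq_zero a2, tot_eq_zero a3, tot_eq_zero b1, tot_eq_zero b2, tot_eq_zero b3,
      tot_eq_zero c1, tot_eq_zero c2, tot_eq_zero c3, two, nea, neb, nec] <;> grind

theorem br_r3 {a b c : ℕ} {sa sb sc x y z : Bool} {u v w : GaussCode}
    (h₁ : (sa == y) = (sb == z)) (h₂ : (sc == y) = (sb == x))
    (h : WellFormed (topStrand x a b sa sb ++ u ++ midStrand y a c sa sc ++ v ++
      botStrand z b c sb sc ++ w))
    (h' : WellFormed (topStrand (!x) a b sa sb ++ u ++ midStrand (!y) a c sa sc ++ v ++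
      botStrand (!z) b c sb sc ++ w)) :
    br (topStrand x a b sa sb ++ u ++ midStrand y a c sa sc ++ v ++
      botStrand z b c sb sc ++ w) =
    br (topStrand (!x) a b sa sb ++ u ++ midStrand (!y) a c sa sc ++ v ++
      botStrand (!z) b c sb sc ++ w) := by
  have hp := r3_perm a b c sa sb sc x y z u v w
  have hp' := r3_perm a b c sa sb sc (!x) (!y) (!z) u v w
  obtain ⟨⟨n1, n2, n3⟩, ⟨a1, a2, a3⟩, ⟨b1, b2, b3⟩, c1, c2, c3⟩ := r3_notMem h hp
  have two : (1 : ZMod 2) + 1 = 0 := rfl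
  have ne : ∀ {x}, x ∉ labels u → x ∉ labels v → x ∉ labels w →
      ∀ e ∈ labels (u ++ v ++ w), x ≠ e := by
    rintro x h1 h2 h3 e he rfl
    simp only [labels_append, Finset.mem_union] at he
    tauto
  have nea := ne a1 a2 a3
  have neb := ne b1 b2 b3
  have nec := ne c1 c2 c3
  obtain ⟨⟨p1, p2, p3⟩, r⟩ := r3_beta h
  obtain ⟨⟨q1, q2, q3⟩, r'⟩ := r3_beta h'
  refine br_triangle (tot u) (tot v) h h' hp (hp.trans hp'.symm) (fun e he f hf => ?_)
    (fun e he => ⟨(r e he).1, (r' e he).1⟩)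
    (fun e he => ⟨(r e he).2.1, (r' e he).2.1⟩)
    (fun e he => ⟨(r e he).2.2, (r' e he).2.2⟩) ?_ ?_ ?_ ?_ ?_
  · cases x <;> cases y <;> cases z <;> simp [topStrand, midStrand, botStrand, inOrder, nea e he,
      neb e he, nec e he, nea f hf, neb f hf, nec f hf]
  · rw [p1, q1]; cases x <;> rfl
  · rw [p2, q2]; cases y <;> rfl
  · rw [p3, q3]; cases z <;> rfl
  -- The triangle equations imply the sign conditions of `dpow_triangle`.
  · rw [p2, p3]; revert h₁ h₂; clear * -; revert sa sb sc x y z; decide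
  · rw [p1, p2]; revert h₁ h₂; clear * -; revert sa sb sc x y z; decide

/-- In this cyclic order the row of `b` is `tot u` and that of `c` is `tot v`, so `v₁` has to be
`tot u + tot v`. -/
theorem br_r3' {a b c : ℕ} {sa sb sc x y z : Bool} {u v w : GaussCode}
    (h₁ : (sa == y) = (sb == z)) (h₂ : (sc == y) = (sb == x))
    (h : WellFormed (topStrand x a b sa sb ++ u ++ botStrand z b c sb sc ++ v ++
      midStrand y a c sa sc ++ w))
    (h' : WellFormed (topStrand (!x) a b sa sb ++ u ++ botStrand (!z) b c sb sc ++ v ++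
      midStrand (!y) a c sa sc ++ w)) :
    br (topStrand x a b sa sb ++ u ++ botStrand z b c sb sc ++ v ++
      midStrand y a c sa sc ++ w) =
    br (topStrand (!x) a b sa sb ++ u ++ botStrand (!z) b c sb sc ++ v ++
      midStrand (!y) a c sa sc ++ w) := by
  have hp := r3'_perm a b c sa sb sc x y z u v w
  have hp' := r3'_perm a b c sa sb sc (!x) (!y) (!z) u v w
  obtain ⟨⟨n1, n2, n3⟩, ⟨a1, a2, a3⟩, ⟨b1, b2, b3⟩, c1, c2, c3⟩ := r3_notMem h hp
  have two : (1 : ZMod 2) + 1 = 0 := rfl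
  have ne : ∀ {x}, x ∉ labels u → x ∉ labels v → x ∉ labels w →
      ∀ e ∈ labels (u ++ v ++ w), x ≠ e := by
    rintro x h1 h2 h3 e he rfl
    simp only [labels_append, Finset.mem_union] at he
    tauto
  have nea := ne a1 a2 a3
  have neb := ne b1 b2 b3
  have nec := ne c1 c2 c3
  have val : ∀ x y z, let w' := topStrand x a b sa sb ++ u ++ botStrand z b c sb sc ++ v ++ midStrand y a c sa sc ++ w
      beta w' a b = (if !x then 1 else 0) ∧ beta w' a c = (if y then 1 else 0) ∧
        beta w' b c = if !z then 1 else 0 := by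
    intro x y z
    cases x <;> cases y <;> cases z <;> simp [topStrand, midStrand, botStrand, inOrder, n1, n2, n3,
      n1.symm, n2.symm, n3.symm, beta_eq_zero_left a1, beta_eq_zero_left a2, beta_eq_zero_left a3,
      beta_eq_zero_left b1, beta_eq_zero_left b2, beta_eq_zero_left b3, tot_eq_zero a1,
      tot_eq_zero a2, tot_eq_zero a3, tot_eq_zero b1, tot_eq_zero b2, tot_eq_zero b3,
      tot_eq_zero c1, tot_eq_zero c2, tot_eq_zero c3, two]
  have row : ∀ x y z, ∀ e ∈ labels (u ++ v ++ w),
      let w' := topStrand x a b sa sb ++ u ++ botStrand z b c sb sc ++ v ++ midStrand y a c sa sc ++ w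
      beta w' a e = tot u e + tot v e ∧ beta w' b e = tot u e ∧ beta w' c e = tot v e := by
    intro x y z e he
    have htot := h.tot_eq e
    simp only [topStrand, midStrand, botStrand, tot_append, tot_inOrder, nea e he, neb e he,
      nec e he, if_false, zero_add, add_zero] at htot
    cases x <;> cases y <;> cases z <;> simp [topStrand, midStrand, botStrand, inOrder, n1, n2, n3,
      n1.symm, n2.symm, n3.symm, beta_eq_zero_left a1, beta_eq_zero_left a2, beta_eq_zero_left a3,
      beta_eq_zero_left b1, beta_eq_zero_left b2, beta_eq_zero_left b3, beta_eq_zero_left c1,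
      beta_eq_zero_left c2, beta_eq_zero_left c3, tot_eq_zero a1,
      tot_eq_zero a2, tot_eq_zero a3, tot_eq_zero b1, tot_eq_zero b2, tot_eq_zero b3,
      tot_eq_zero c1, tot_eq_zero c2, tot_eq_zero c3, two, nea e he, neb e he, nec e he] <;> grind
  obtain ⟨p1, p2, p3⟩ := val x y z
  obtain ⟨q1, q2, q3⟩ := val (!x) (!y) (!z)
  refine br_triangle (fun e => tot u e + tot v e) (tot v) h h' hp (hp.trans hp'.symm) (fun e he f hf => ?_)
    (fun e he => ⟨(row x y z e he).1, (row (!x) (!y) (!z) e he).1⟩)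
    (fun e he => ⟨by rw [(row x y z e he).2.1]; grind, by rw [(row (!x) (!y) (!z) e he).2.1]; grind⟩)
    (fun e he => ⟨(row x y z e he).2.2, (row (!x) (!y) (!z) e he).2.2⟩) ?_ ?_ ?_ ?_ ?_
  · cases x <;> cases y <;> cases z <;> simp [topStrand, midStrand, botStrand, inOrder, nea e he,
      neb e he, nec e he, nea f hf, neb f hf, nec f hf]
  · rw [p1, q1]; cases x <;> rfl
  · rw [p2, q2]; cases y <;> rfl
  · rw [p3, q3]; cases z <;> rfl
  · rw [p2, p3]; revert h₁ h₂; clear * -; revert sa sb sc x y z; decide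
  · rw [p1, p2]; revert h₁ h₂; clear * -; revert sa sb sc x y z; decide

/-- The bracket polynomial is, up to units, invariant under the elementary changes. -/
theorem br_step {w w' : GaussCode} (hw : WellFormed w) (hw' : WellFormed w') (h : Step w w') :
    ∃ k : ℤ, br w = T k * br w' ∨ br w = -(T k * br w') := by
  have of_eq : br w = br w' → ∃ k : ℤ, br w = T k * br w' ∨ br w = -(T k * br w') := fun h =>
    ⟨0, Or.inl (by rw [h, T_zero, one_mul])⟩
  cases h with
  | rotate u v => exact of_eq (br_rotate hw).symm
  | relabel e u => exact of_eq (br_relabel e _).symm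
  | reverse u => exact of_eq (br_reverse hw).symm
  | r1 c o s u => exact ⟨_, Or.inr (br_r1 hw)⟩
  | r2 c d s b u v => exact of_eq (br_r2 hw)
  | r3 a b c sa sb sc x y z u v w h₁ h₂ => exact of_eq (br_r3 h₁ h₂ hw hw')
  | r3' a b c sa sb sc x y z u v w h₁ h₂ => exact of_eq (br_r3' h₁ h₂ hw hw')

theorem br_equivalent {w w' : GaussCode} (h : Equivalent w w') :
    ∃ k : ℤ, br w = T k * br w' ∨ br w = -(T k * br w') := by
  induction h with
  | rel w w' h => exact br_step h.1.1 h.2.1.1 h.2.2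
  | refl w => exact ⟨0, Or.inl (by rw [T_zero, one_mul])⟩
  | symm w w' _ ih =>
    obtain ⟨k, h | h⟩ := ih
    · exact ⟨-k, Or.inl (by rw [h, ← mul_assoc, ← T_add]; simp)⟩
    · exact ⟨-k, Or.inr (by rw [h, mul_neg, neg_neg, ← mul_assoc, ← T_add]; simp)⟩
  | trans u v w _ _ ih₁ ih₂ =>
    obtain ⟨k, h⟩ := ih₁
    obtain ⟨l, h'⟩ := ih₂
    refine ⟨k + l, ?_⟩
    rcases h with h | h <;> rcases h' with h' | h' <;> rw [h, h', T_add, mul_assoc] <;> simp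

end TieKnot.GaussCode

end

namespace TieKnot

/-! ### Linear algebra over the field with two elements -/

theorem sum_symmDiff_zmod_two (f : ℕ → ZMod 2) (T T' : Finset ℕ) :
    ∑ d ∈ symmDiff T T', f d = ∑ d ∈ T, f d + ∑ d ∈ T', f d := by
  rw [symmDiff_def, Finset.sup_eq_union, Finset.sum_union disjoint_sdiff_sdiff,
    ← Finset.sum_inter_add_sum_sdiff T T', ← Finset.sum_inter_add_sum_sdiff T' T,
    Finset.inter_comm T' T]
  grind

theorem symmDiff_mem_ker {L : Finset ℕ} {N : ℕ → ℕ → ZMod 2} {T T' : Finset ℕ} (h : T ∈ ker L N)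
    (h' : T' ∈ ker L N) : symmDiff T T' ∈ ker L N := by
  rw [mem_ker] at *
  refine ⟨?_, fun c hc => ?_⟩
  · intro x hx
    rcases Finset.mem_symmDiff.1 hx with hx | hx
    · exact h.1 hx.1
    · exact h'.1 hx.1
  · rw [sum_symmDiff_zmod_two, h.2 c hc, h'.2 c hc, add_zero]

theorem sum_add_ite (f : ℕ → ZMod 2) (T : Finset ℕ) (c : ℕ) (z : ZMod 2) :
    ∑ d ∈ T, (f d + if d = c then z else 0) = ∑ d ∈ T, f d + if c ∈ T then z else 0 := by
  rw [Finset.sum_add_distrib, Finset.sum_ite_eq']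

/-- Changing one diagonal entry increases the dimension of the kernel by at most one. -/
theorem card_ker_le {L : Finset ℕ} {N N' : ℕ → ℕ → ZMod 2} (a : ℕ)
    (h : ∀ c ∈ L, ∀ d ∈ L, N' c d = N c d + if d = a then (if c = a then 1 else 0) else 0) :
    (ker L N').card ≤ 2 * (ker L N).card := by
  have hs : ∀ T ⊆ L, ∀ c ∈ L, ∑ d ∈ T, N' c d =
      ∑ d ∈ T, N c d + if a ∈ T then (if c = a then 1 else 0) else 0 := by
    intro T hT c hc
    rw [← sum_add_ite]
    exact Finset.sum_congr rfl fun d hd => h c hc d (hT hd)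
  have h0 : ((ker L N').filter fun T => a ∉ T).card ≤ (ker L N).card := by
    refine Finset.card_le_card fun T hT => ?_
    rw [Finset.mem_filter, mem_ker] at hT
    rw [mem_ker]
    refine ⟨hT.1.1, fun c hc => ?_⟩
    rw [← hT.1.2 c hc, hs T hT.1.1 c hc, if_neg hT.2, add_zero]
  -- Translation by a fixed kernel vector containing `a` maps the vectors containing `a` injectively
  -- to those avoiding it.
  have h1 : ((ker L N').filter fun T => a ∈ T).card ≤
      ((ker L N').filter fun T => a ∉ T).card := by
    by_cases hne : ∃ T₀, T₀ ∈ (ker L N').filter fun T => a ∈ T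
    · obtain ⟨T₀, hT₀⟩ := hne
      rw [Finset.mem_filter] at hT₀
      refine Finset.card_le_card_of_injOn (fun T => symmDiff T T₀) (fun T hT => ?_)
        (fun T _ T' _ h => symmDiff_left_injective T₀ h)
      simp only [Finset.coe_filter, Set.mem_ofPred_eq] at hT ⊢
      exact ⟨symmDiff_mem_ker hT.1 hT₀.1, by simp [Finset.mem_symmDiff, hT.2, hT₀.2]⟩
    · push Not at hne
      rw [Finset.eq_empty_of_forall_notMem hne]
      simp
  have := Finset.card_filter_add_card_filter_not (s := ker L N') fun T => a ∈ T
  omega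

/-- Changing a diagonal entry at which the kernel does not vanish decreases its dimension. -/
theorem two_mul_card_ker_le {L : Finset ℕ} {N N' : ℕ → ℕ → ZMod 2} {a : ℕ}
    (h : ∀ c ∈ L, ∀ d ∈ L, N' c d = N c d + if d = a then (if c = a then 1 else 0) else 0)
    (hN : ∀ c ∈ L, ∀ d ∈ L, N c d = N d c) {T₀ : Finset ℕ} (hT₀ : T₀ ∈ ker L N) (haT₀ : a ∈ T₀) :
    2 * (ker L N').card ≤ (ker L N).card := by
  have hs : ∀ T ⊆ L, ∀ c ∈ L, ∑ d ∈ T, N' c d =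
      ∑ d ∈ T, N c d + if a ∈ T then (if c = a then 1 else 0) else 0 := by
    intro T hT c hc
    rw [← sum_add_ite]
    exact Finset.sum_congr rfl fun d hd => h c hc d (hT hd)
  -- Evaluate the bilinear form at `T₀` and `T`: it vanishes for `N` by symmetry and for `N'`
  -- because `T` is in its kernel, but if `a ∈ T` the two values differ by `1`.
  have hmem : ∀ T ∈ ker L N', a ∉ T := by
    intro T hT haT
    rw [mem_ker] at hT hT₀
    have e1 : ∑ c ∈ T₀, ∑ d ∈ T, N c d = 0 := by
      rw [Finset.sum_comm]
      refine Finset.sum_eq_zero fun d hd => ?_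
      rw [← hT₀.2 d (hT.1 hd)]
      exact Finset.sum_congr rfl fun c hc => hN c (hT₀.1 hc) d (hT.1 hd)
    have e2 : ∑ c ∈ T₀, ∑ d ∈ T, N' c d = 0 :=
      Finset.sum_eq_zero fun c hc => hT.2 c (hT₀.1 hc)
    rw [Finset.sum_congr rfl fun c hc => hs T hT.1 c (hT₀.1 hc)] at e2
    simp only [if_pos haT, Finset.sum_add_distrib, e1, Finset.sum_ite_eq', if_pos haT₀] at e2
    exact absurd e2 (by decide)
  have h0 : (ker L N').card ≤ ((ker L N).filter fun T => a ∉ T).card := by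
    refine Finset.card_le_card fun T hT => ?_
    have haT := hmem T hT
    rw [mem_ker] at hT
    rw [Finset.mem_filter, mem_ker]
    refine ⟨⟨hT.1, fun c hc => ?_⟩, haT⟩
    rw [← hT.2 c hc, hs T hT.1 c hc, if_neg haT, add_zero]
  have h1 : ((ker L N).filter fun T => a ∉ T).card ≤ ((ker L N).filter fun T => a ∈ T).card := by
    refine Finset.card_le_card_of_injOn (fun T => symmDiff T T₀) (fun T hT => ?_)
      (fun T _ T' _ h => symmDiff_left_injective T₀ h)
    simp only [Finset.coe_filter, Set.mem_ofPred_eq] at hT ⊢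
    exact ⟨symmDiff_mem_ker hT.1 hT₀, by simp [Finset.mem_symmDiff, hT.2, haT₀]⟩
  have := Finset.card_filter_add_card_filter_not (s := ker L N) fun T => a ∈ T
  omega

/-- The matrix `N + 1`. -/
def compl (N : ℕ → ℕ → ZMod 2) (c d : ℕ) : ZMod 2 := N c d + if d = c then 1 else 0

theorem sum_compl (N : ℕ → ℕ → ZMod 2) (T : Finset ℕ) (c : ℕ) :
    ∑ d ∈ T, compl N c d = ∑ d ∈ T, N c d + if c ∈ T then 1 else 0 :=
  sum_add_ite _ _ _ _

theorem compl_compl (N : ℕ → ℕ → ZMod 2) : compl (compl N) = N := by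
  funext c d
  simp only [compl]
  split_ifs <;> grind

/-- A vector in both kernels satisfies `N v = 0 = N v + v`, so it is zero. Hence addition, which is
symmetric difference of supports, is injective on pairs. -/
theorem card_ker_mul_card_ker_le (L : Finset ℕ) (N : ℕ → ℕ → ZMod 2) :
    (ker L N).card * (ker L (compl N)).card ≤ 2 ^ L.card := by
  rw [← Finset.card_product, ← Finset.card_powerset]
  refine Finset.card_le_card_of_injOn (fun p => symmDiff p.1 p.2) ?_ ?_
  · rintro ⟨T, T'⟩ h
    simp only [Finset.coe_product, Set.mem_prod, Finset.mem_coe, mem_ker] at h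
    simp only [Finset.coe_powerset, Set.mem_preimage, Set.mem_powerset_iff, Finset.coe_subset]
    intro x hx
    rcases Finset.mem_symmDiff.1 hx with hx | hx
    · exact h.1.1 hx.1
    · exact h.2.1 hx.1
  · rintro ⟨T, T'⟩ h ⟨U, U'⟩ h' he
    simp only [Finset.coe_product, Set.mem_prod, Finset.mem_coe] at h h' he
    have k1 := symmDiff_mem_ker h.1 h'.1
    have k2 := symmDiff_mem_ker h.2 h'.2
    have e : symmDiff T U = symmDiff T' U' := by
      rw [← symmDiff_right_inj (a := T'), ← symmDiff_assoc, ← symmDiff_assoc, symmDiff_self,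
        symmDiff_comm T' T, he, symmDiff_assoc, symmDiff_comm U' U, ← symmDiff_assoc,
        symmDiff_self]
    rw [← e, mem_ker] at k2
    rw [mem_ker] at k1
    have : symmDiff T U = ∅ := by
      refine Finset.eq_empty_of_forall_notMem fun c hc => ?_
      have := k2.2 c (k1.1 hc)
      rw [sum_compl, k1.2 c (k1.1 hc), if_pos hc] at this
      exact absurd this (by decide)
    rw [this] at e
    rw [← Finset.bot_eq_empty, symmDiff_eq_bot] at this
    rw [← Finset.bot_eq_empty, eq_comm, symmDiff_eq_bot] at e
    rw [this, e]

/-- The matrix is a projection. -/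
def Proj (L : Finset ℕ) (N : ℕ → ℕ → ZMod 2) : Prop :=
  ∀ c ∈ L, ∀ d ∈ L, ∑ e ∈ L, N c e * N e d = N c d

theorem Proj.congr {L : Finset ℕ} {N N' : ℕ → ℕ → ZMod 2} (h : Proj L N)
    (hN : ∀ c ∈ L, ∀ d ∈ L, N' c d = N c d) : Proj L N' := by
  intro c hc d hd
  rw [hN c hc d hd, ← h c hc d hd]
  exact Finset.sum_congr rfl fun e he => by rw [hN c hc e he, hN e he d hd]

theorem Proj.compl {L : Finset ℕ} {N : ℕ → ℕ → ZMod 2} (h : Proj L N) : Proj L (compl N) := by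
  intro c hc d hd
  have := h c hc d hd
  simp only [TieKnot.compl, add_mul, mul_add, Finset.sum_add_distrib, this, mul_ite, mul_one,
    mul_zero, ite_mul, zero_mul, one_mul, Finset.sum_ite_eq, Finset.sum_ite_eq', hc, hd, if_true]
  grind

/-- The image of a vector. -/
def image (L : Finset ℕ) (N : ℕ → ℕ → ZMod 2) (T : Finset ℕ) : Finset ℕ :=
  L.filter fun c => ∑ d ∈ T, N c d = 1

theorem sum_image (L : Finset ℕ) (N : ℕ → ℕ → ZMod 2) (T : Finset ℕ) (f : ℕ → ZMod 2) :
    ∑ d ∈ TieKnot.image L N T, f d = ∑ e ∈ T, ∑ d ∈ L, f d * N d e := by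
  rw [Finset.sum_comm, TieKnot.image, Finset.sum_filter]
  refine Finset.sum_congr rfl fun d _ => ?_
  rw [← Finset.mul_sum]
  rcases zmod_two_cases (∑ e ∈ T, N d e) with h | h <;> simp [h]

/-- This is `(N + 1) N = 0`. -/
theorem Proj.image_mem_ker {L : Finset ℕ} {N : ℕ → ℕ → ZMod 2} (h : Proj L N) {T : Finset ℕ}
    (hT : T ⊆ L) : TieKnot.image L N T ∈ ker L (TieKnot.compl N) := by
  rw [mem_ker]
  refine ⟨Finset.filter_subset _ _, fun c hc => ?_⟩
  rw [sum_image]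
  refine Finset.sum_eq_zero fun e he => ?_
  simp only [TieKnot.compl, add_mul, Finset.sum_add_distrib, h c hc e (hT he), ite_mul, zero_mul,
    one_mul, Finset.sum_ite_eq', hc, if_true, CharTwo.add_self_eq_zero]

/-- Every vector is the sum of its images under `N + 1` and `N`, which lie in the kernels of `N` and
`N + 1`. -/
theorem Proj.card_ker_mul_card_ker {L : Finset ℕ} {N : ℕ → ℕ → ZMod 2} (h : Proj L N) :
    (ker L N).card * (ker L (TieKnot.compl N)).card = 2 ^ L.card := by
  refine le_antisymm (card_ker_mul_card_ker_le L N) ?_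
  rw [← Finset.card_product, ← Finset.card_powerset]
  refine Finset.card_le_card_of_injOn
    (fun T => (TieKnot.image L (TieKnot.compl N) T, TieKnot.image L N T)) ?_ ?_
  · intro T hT
    simp only [Finset.coe_powerset, Set.mem_preimage, Set.mem_powerset_iff, Finset.coe_subset] at hT
    simp only [Finset.coe_product, Set.mem_prod, Finset.mem_coe]
    have := h.compl.image_mem_ker hT
    rw [compl_compl] at this
    exact ⟨this, h.image_mem_ker hT⟩
  · intro T hT U hU he
    simp only [Finset.coe_powerset, Set.mem_preimage, Set.mem_powerset_iff, Finset.coe_subset]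
      at hT hU
    simp only [Prod.mk.injEq] at he
    have key : ∀ c ∈ L, (c ∈ T ↔ c ∈ U) := by
      intro c hc
      have e1 := Finset.ext_iff.1 he.1 c
      have e2 := Finset.ext_iff.1 he.2 c
      simp only [TieKnot.image, Finset.mem_filter, hc, true_and, sum_compl] at e1 e2
      rcases zmod_two_cases (∑ d ∈ T, N c d) with h1 | h1 <;>
        rcases zmod_two_cases (∑ d ∈ U, N c d) with h2 | h2 <;>
        by_cases h3 : c ∈ T <;> by_cases h4 : c ∈ U <;> simp_all
    ext c
    exact ⟨fun h => (key c (hT h)).1 h, fun h => (key c (hU h)).2 h⟩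

/-- Both factors divide a power of two, so the logarithms in `nul` are exact here. In the inequality
`nul_add_nul_le` rounding down does no harm. -/
theorem Proj.nul_add_nul {L : Finset ℕ} {N : ℕ → ℕ → ZMod 2} (h : Proj L N) :
    nul L N + nul L (TieKnot.compl N) = L.card := by
  have key := h.card_ker_mul_card_ker
  obtain ⟨i, -, hi⟩ := (Nat.dvd_prime_pow Nat.prime_two).1 (Dvd.intro _ key)
  obtain ⟨j, -, hj⟩ := (Nat.dvd_prime_pow Nat.prime_two).1 (Dvd.intro_left _ key)
  rw [nul, nul, hi, hj, Nat.log_pow (by norm_num), Nat.log_pow (by norm_num)]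
  rw [hi, hj, ← pow_add] at key
  exact Nat.pow_right_injective (le_refl 2) key

theorem nul_add_nul_le (L : Finset ℕ) (N : ℕ → ℕ → ZMod 2) :
    nul L N + nul L (compl N) ≤ L.card := by
  have h1 := Nat.pow_log_le_self 2 (card_ker_pos L N).ne'
  have h2 := Nat.pow_log_le_self 2 (card_ker_pos L (compl N)).ne'
  have := (Nat.mul_le_mul h1 h2).trans (card_ker_mul_card_ker_le L N)
  rw [← pow_add] at this
  exact (Nat.pow_le_pow_iff_right (by norm_num)).1 this

/-- If a row of a projection has an off-diagonal entry, the kernel does not vanish there. -/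
theorem Proj.exists_mem_ker {L : Finset ℕ} {N : ℕ → ℕ → ZMod 2} (h : Proj L N) {c d : ℕ}
    (hc : c ∈ L) (hd : d ∈ L) (hcd : c ≠ d) (hN : N c d = 1) : ∃ T ∈ ker L N, c ∈ T := by
  -- The witness is column `d` of `N + 1`; its entry at `c` is that of `N`, since `c ≠ d`.
  have := h.compl.image_mem_ker (T := {d}) (by simpa using hd)
  rw [compl_compl] at this
  refine ⟨_, this, ?_⟩
  simp [TieKnot.image, TieKnot.compl, hc, hN, hcd.symm]

end TieKnot

section

open LaurentPolynomial

namespace TieKnot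

/-! ### The extreme degrees of the bracket polynomial -/

/-- The coefficient at `k` is `z`, and there are no terms of higher degree. -/
def Top (f : ℤ[T;T⁻¹]) (k z : ℤ) : Prop := f.coeff k = z ∧ ∀ j > k, f.coeff j = 0

theorem Top.of_lt {f : ℤ[T;T⁻¹]} {k l z : ℤ} (h : Top f k z) (hl : k < l) : Top f l 0 :=
  ⟨h.2 l hl, fun j hj => h.2 j (hl.trans hj)⟩

theorem Top.neg {f : ℤ[T;T⁻¹]} {k z : ℤ} (h : Top f k z) : Top (-f) k (-z) := by
  refine ⟨?_, fun j hj => ?_⟩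
  · rw [AddMonoidAlgebra.coeff_neg, Finsupp.neg_apply, h.1]
  · rw [AddMonoidAlgebra.coeff_neg, Finsupp.neg_apply, h.2 j hj, neg_zero]

theorem Top.add {f g : ℤ[T;T⁻¹]} {k y z : ℤ} (hf : Top f k y) (hg : Top g k z) :
    Top (f + g) k (y + z) := by
  refine ⟨?_, fun j hj => ?_⟩
  · rw [AddMonoidAlgebra.coeff_add, Finsupp.add_apply, hf.1, hg.1]
  · rw [AddMonoidAlgebra.coeff_add, Finsupp.add_apply, hf.2 j hj, hg.2 j hj, add_zero]

theorem Top.sum {s : Finset (Finset ℕ)} {f : Finset ℕ → ℤ[T;T⁻¹]} {k : ℤ} {z : Finset ℕ → ℤ}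
    (h : ∀ S ∈ s, Top (f S) k (z S)) : Top (∑ S ∈ s, f S) k (∑ S ∈ s, z S) := by
  induction s using Finset.induction_on with
  | empty => exact ⟨rfl, fun _ _ => rfl⟩
  | insert S s hS ih =>
    rw [Finset.sum_insert hS, Finset.sum_insert hS]
    exact (h S (Finset.mem_insert_self _ _)).add
      (ih fun S' hS' => h S' (Finset.mem_insert_of_mem hS'))

theorem coeff_T_mul (m : ℤ) (f : ℤ[T;T⁻¹]) (j : ℤ) : (T m * f).coeff j = f.coeff (j - m) := by
  rw [T, AddMonoidAlgebra.coeff_single_mul_apply, one_mul]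
  congr 1
  ring

theorem Top.T_mul {f : ℤ[T;T⁻¹]} {k z : ℤ} (h : Top f k z) (m : ℤ) : Top (T m * f) (m + k) z := by
  refine ⟨?_, fun j hj => ?_⟩
  · rw [coeff_T_mul, ← h.1]; congr 1; ring
  · rw [coeff_T_mul]; exact h.2 _ (by omega)

theorem top_one : Top 1 0 1 := by
  rw [← T_zero]
  exact ⟨by rw [T_apply, if_pos rfl], fun j hj => by rw [T_apply, if_neg (by omega)]⟩

theorem top_delta_pow (n : ℕ) : Top (delta ^ n) (2 * n) ((-1) ^ n) := by
  induction n with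
  | zero => simpa using top_one
  | succ n ih =>
    have h1 := (ih.T_mul 2).neg
    have h2 := ((ih.T_mul (-2)).neg).of_lt (l := 2 + 2 * n) (by omega)
    have := h1.add h2
    have e : delta ^ (n + 1) = -(T 2 * delta ^ n) + -(T (-2) * delta ^ n) := by
      rw [pow_succ]; nth_rw 2 [delta]; ring
    rw [e]
    convert this using 1
    · push_cast; ring
    · ring

/-- The state all of whose smoothings have the variable as their weight. -/
def stateA (L : Finset ℕ) (σ : ℕ → Bool) : Finset ℕ := L.filter fun c => σ c = false

/-- Each crossing at which `S` differs from `stateA` has the weight `T (-1)` instead of `T 1`. -/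
theorem prod_wt {L : Finset ℕ} (σ : ℕ → Bool) {S : Finset ℕ} (hS : S ⊆ L) :
    ∏ c ∈ L, wt σ S c = T ((L.card : ℤ) - 2 * (symmDiff (stateA L σ) S).card) := by
  have hsub : symmDiff (stateA L σ) S ⊆ L := by
    intro x hx
    rcases Finset.mem_symmDiff.1 hx with hx | hx
    · exact Finset.filter_subset _ _ hx.1
    · exact hS hx.1
  have : ∀ c ∈ L, wt σ S c = T (if c ∈ symmDiff (stateA L σ) S then -1 else 1) := by
    intro c hc
    simp only [wt, Finset.mem_symmDiff, stateA, Finset.mem_filter, hc, true_and]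
    by_cases h : c ∈ S <;> cases hσ : σ c <;> simp [h]
  rw [Finset.prod_congr rfl this]
  have hT : ∀ (s : Finset ℕ) (g : ℕ → ℤ), ∏ c ∈ s, (T (g c) : ℤ[T;T⁻¹]) = T (∑ c ∈ s, g c) := by
    intro s g
    induction s using Finset.induction_on with
    | empty => simp
    | insert a s ha ih => rw [Finset.prod_insert ha, Finset.sum_insert ha, ih, T_add]
  rw [hT]
  congr 1
  have e : ∀ c, (if c ∈ symmDiff (stateA L σ) S then -1 else 1 : ℤ) =
      1 - 2 * (if c ∈ symmDiff (stateA L σ) S then 1 else 0) := fun c => by split_ifs <;> rfl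
  simp only [e, Finset.sum_sub_distrib, ← Finset.mul_sum, Finset.sum_boole]
  rw [Finset.filter_mem_eq_inter, Finset.inter_eq_right.2 hsub]
  simp

theorem symmDiff_insert {S D : Finset ℕ} {a : ℕ} (ha : a ∉ D) :
    symmDiff S (insert a D) = symmDiff (symmDiff S D) {a} := by
  ext x
  simp only [Finset.mem_symmDiff, Finset.mem_insert, Finset.mem_singleton]
  by_cases h : x = a
  · subst h; tauto
  · tauto

theorem withDiag_symmDiff (M : ℕ → ℕ → ZMod 2) (S : Finset ℕ) (a c d : ℕ) :
    withDiag M (ind (symmDiff S {a})) c d =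
      withDiag M (ind S) c d + if d = a then (if c = a then 1 else 0) else 0 := by
  simp only [withDiag, ind, Finset.mem_symmDiff, Finset.mem_singleton]
  by_cases h : c = d
  · subst h
    by_cases h' : c = a
    · subst h'; by_cases h2 : c ∈ S <;> simp [h2]; decide
    · simp [h']
  · by_cases h' : d = a
    · subst h'; simp [h]
    · simp [h, h']

theorem nul_symmDiff_singleton (L : Finset ℕ) (M : ℕ → ℕ → ZMod 2) (S : Finset ℕ) (a : ℕ) :
    nul L (withDiag M (ind (symmDiff S {a}))) ≤ nul L (withDiag M (ind S)) + 1 := by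
  rw [nul, nul, ← Nat.log_mul_base (by norm_num) (card_ker_pos _ _).ne', mul_comm]
  exact Nat.log_mono_right (card_ker_le a fun c _ d _ => withDiag_symmDiff M S a c d)

theorem nul_symmDiff_le (L : Finset ℕ) (M : ℕ → ℕ → ZMod 2) (S D : Finset ℕ) :
    nul L (withDiag M (ind (symmDiff S D))) ≤ nul L (withDiag M (ind S)) + D.card := by
  induction D using Finset.induction_on with
  | empty => simp [← Finset.bot_eq_empty]
  | insert a D ha ih =>
    rw [symmDiff_insert ha, Finset.card_insert_of_notMem ha]
    have := nul_symmDiff_singleton L M (symmDiff S D) a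
    omega

/-- Adequacy: as the kernel of the state `S` does not vanish at the first changed crossing, the
first change lowers the nullity by one, and each further change raises it by at most one. -/
theorem nul_symmDiff_add_two_le {L : Finset ℕ} {M : ℕ → ℕ → ZMod 2} {S : Finset ℕ}
    (hM : ∀ c ∈ L, ∀ d ∈ L, c ≠ d → M c d = M d c)
    (hS : ∀ a ∈ L, ∃ T ∈ ker L (withDiag M (ind S)), a ∈ T) {D : Finset ℕ} (hD : D.Nonempty)
    (hDL : D ⊆ L) :
    nul L (withDiag M (ind (symmDiff S D))) + 2 ≤ nul L (withDiag M (ind S)) + D.card := by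
  induction hD using Finset.Nonempty.cons_induction with
  | singleton a =>
    obtain ⟨T, hT, haT⟩ := hS a (hDL (by simp))
    have := two_mul_card_ker_le (fun c _ d _ => withDiag_symmDiff M S a c d) (fun c hc d hd => by
      simp only [withDiag]
      by_cases h : c = d
      · subst h; rfl
      · rw [if_neg h, if_neg (Ne.symm h), hM c hc d hd h]) hT haT
    have := Nat.log_mono_right (b := 2) this
    rw [mul_comm, Nat.log_mul_base (by norm_num) (card_ker_pos _ _).ne'] at this
    simp only [nul, Finset.card_singleton]
    omega
  | cons a D ha _ ih =>
    rw [Finset.cons_eq_insert] at hDL ⊢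
    rw [symmDiff_insert ha, Finset.card_insert_of_notMem ha]
    have := nul_symmDiff_singleton L M (symmDiff S D) a
    have := ih fun x hx => hDL (Finset.mem_insert_of_mem hx)
    omega

theorem stateA_subset (L : Finset ℕ) (σ : ℕ → Bool) : stateA L σ ⊆ L := Finset.filter_subset _ _

/-- No term of the bracket polynomial has a degree above that of its state `stateA`. -/
theorem coeff_bracket_eq_zero (L : Finset ℕ) (M : ℕ → ℕ → ZMod 2) (σ : ℕ → Bool) {k : ℤ}
    (hk : (L.card : ℤ) + 2 * nul L (withDiag M (ind (stateA L σ))) < k) :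
    (bracket L M σ).coeff k = 0 := by
  have : Top (bracket L M σ) k (∑ S ∈ L.powerset, 0) := by
    refine Top.sum fun S hS => ?_
    rw [Finset.mem_powerset] at hS
    rw [prod_wt σ hS]
    -- With `D` the set of changes, the top degree of the term is `|L| - 2 |D|` plus twice its
    -- nullity, and the nullity has grown by at most `|D|`.
    refine ((top_delta_pow _).T_mul _).of_lt ?_
    have := nul_symmDiff_le L M (stateA L σ) (symmDiff (stateA L σ) S)
    rw [symmDiff_symmDiff_cancel_left] at this
    omega
  simpa using this.1

/-- The term of highest degree in the adequate case. -/
theorem coeff_bracket_ne_zero {L : Finset ℕ} {M : ℕ → ℕ → ZMod 2} {σ : ℕ → Bool}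
    (hM : ∀ c ∈ L, ∀ d ∈ L, c ≠ d → M c d = M d c)
    (hS : ∀ a ∈ L, ∃ T ∈ ker L (withDiag M (ind (stateA L σ))), a ∈ T) :
    (bracket L M σ).coeff (L.card + 2 * nul L (withDiag M (ind (stateA L σ)))) ≠ 0 := by
  set n := nul L (withDiag M (ind (stateA L σ))) with hn
  have : Top (bracket L M σ) (L.card + 2 * n)
      (∑ S ∈ L.powerset, if S = stateA L σ then (-1) ^ n else 0) := by
    refine Top.sum fun S hS' => ?_
    rw [Finset.mem_powerset] at hS'
    rw [prod_wt σ hS']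
    split_ifs with h
    · subst h
      rw [symmDiff_self]
      simpa using (top_delta_pow n).T_mul (L.card : ℤ)
    · refine ((top_delta_pow _).T_mul _).of_lt ?_
      have := nul_symmDiff_add_two_le (D := symmDiff (stateA L σ) S) hM hS ?_ ?_
      · rw [symmDiff_symmDiff_cancel_left] at this
        omega
      · rw [Finset.nonempty_iff_ne_empty, ← Finset.bot_eq_empty, ne_eq, symmDiff_eq_bot]
        exact fun h' => h h'.symm
      · intro x hx
        rcases Finset.mem_symmDiff.1 hx with hx | hx
        · exact stateA_subset _ _ hx.1
        · exact hS' hx.1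
  rw [this.1, Finset.sum_ite_eq', if_pos (Finset.mem_powerset.2 (stateA_subset L σ))]
  exact pow_ne_zero _ (by norm_num)

/-- Changing all signs exchanges the two weights. Lowest degrees are thereby reduced to highest
degrees. -/
theorem invert_bracket (L : Finset ℕ) (M : ℕ → ℕ → ZMod 2) (σ : ℕ → Bool) :
    invert (bracket L M σ) = bracket L M fun c => !σ c := by
  have h1 : (invert delta : ℤ[T;T⁻¹]) = delta := by
    simp only [delta, map_neg, map_add, invert_T, neg_neg]; ring
  have h2 : ∀ S c, invert (wt σ S c) = wt (fun c => !σ c) S c := by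
    intro S c
    rw [wt, wt, apply_ite invert, invert_T, invert_T, neg_neg]
    by_cases h : c ∈ S <;> rcases Bool.eq_false_or_eq_true (σ c) with hσ | hσ <;> simp [h, hσ]
  simp only [bracket, map_sum, map_mul, map_prod, map_pow, h1, h2]

/-- The two extreme states are complementary, so their diagonals differ by `1` everywhere. -/
theorem withDiag_stateA_not (L : Finset ℕ) (M : ℕ → ℕ → ZMod 2) (σ : ℕ → Bool) :
    ∀ c ∈ L, ∀ d ∈ L, withDiag M (ind (stateA L fun c => !σ c)) c d =
      compl (withDiag M (ind (stateA L σ))) c d := by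
  intro c hc d hd
  simp only [withDiag, compl, ind, stateA, Finset.mem_filter, hc, true_and]
  by_cases h : c = d
  · subst h; cases hσ : σ c <;> simp; decide
  · simp [h, Ne.symm h]

theorem nul_stateA_not (L : Finset ℕ) (M : ℕ → ℕ → ZMod 2) (σ : ℕ → Bool) :
    nul L (withDiag M (ind (stateA L fun c => !σ c))) =
      nul L (compl (withDiag M (ind (stateA L σ)))) := by
  rw [nul, nul, ker_congr (withDiag_stateA_not L M σ)]

namespace GaussCode

/-- The matrix of the state `stateA` of a code. -/
def matA (w : GaussCode) : ℕ → ℕ → ZMod 2 := withDiag (beta w) (ind (stateA (labels w) (sgn w)))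

/-- An adequate diagram whose two extreme states have as many circles as possible has the least
number of crossings. -/
theorem numCrossings_le_of_equivalent {w w' : GaussCode} (hw : WellFormed w) (hw' : WellFormed w')
    (h : Equivalent w w') (hp : Proj (labels w) (matA w))
    (hi : ∀ c ∈ labels w, ∃ d ∈ labels w, c ≠ d ∧ beta w c d = 1) :
    numCrossings w ≤ numCrossings w' := by
  obtain ⟨k, hk⟩ := br_equivalent h
  have hM : ∀ c ∈ labels w, ∀ d ∈ labels w, c ≠ d → beta w c d = beta w d c :=
    fun c _ d _ hcd => beta_comm hw.tot_eq hcd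
  have coeff_ne : ∀ j, (br w).coeff j ≠ 0 → (br w').coeff (j - k) ≠ 0 := by
    intro j hj hj'
    rcases hk with hk | hk
    · rw [hk, coeff_T_mul] at hj; exact hj hj'
    · rw [hk, AddMonoidAlgebra.coeff_neg, Finsupp.neg_apply, coeff_T_mul, hj', neg_zero] at hj
      exact hj rfl
  have a1 : ∀ c ∈ labels w, ∃ T ∈ ker (labels w) (matA w), c ∈ T := by
    intro c hc
    obtain ⟨d, hd, hcd, hb⟩ := hi c hc
    exact hp.exists_mem_ker hc hd hcd (by simpa [matA, withDiag, hcd] using hb)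
  have a2 : ∀ c ∈ labels w, ∃ T ∈ ker (labels w) (compl (matA w)), c ∈ T := by
    intro c hc
    obtain ⟨d, hd, hcd, hb⟩ := hi c hc
    exact hp.compl.exists_mem_ker hc hd hcd
      (by simpa [matA, withDiag, hcd, TieKnot.compl, hcd.symm] using hb)
  have b1 := coeff_ne _ (coeff_bracket_ne_zero hM a1)
  have b2 := coeff_bracket_ne_zero (σ := fun c => !sgn w c) hM (by
    rw [ker_congr (withDiag_stateA_not _ _ _)]; exact a2)
  rw [← invert_bracket, invert_apply] at b2
  replace b2 := coeff_ne _ b2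
  have c1 := not_lt.1 fun h => b1 (coeff_bracket_eq_zero (labels w') (beta w') (sgn w') h)
  have c2 : (br w').coeff (-((k + ((labels w).card + 2 * nul (labels w)
      (withDiag (beta w) (ind (stateA (labels w) fun c => !sgn w c))) : ℤ)))) ≠ 0 := by
    convert b2 using 2; ring
  rw [← invert_apply, br, invert_bracket] at c2
  replace c2 := not_lt.1 fun h => c2 (coeff_bracket_eq_zero _ _ _ h)
  rw [nul_stateA_not, nul_stateA_not] at c2
  -- Adding the bounds `c1` for the highest and `c2` for the lowest degree cancels the shift `k`.
  -- The sum of the two nullities equals the number of crossings for `w` and is at most that number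
  -- for `w'`, so what remains is `4 n ≤ 4 n'`.
  have d1 := hp.nul_add_nul
  have d2 := nul_add_nul_le (labels w') (matA w')
  rw [← hw.card_labels, ← hw'.card_labels]
  simp only [matA] at d1 d2
  omega

end GaussCode

end TieKnot

end

namespace TieKnot

theorem sum_withDiag (M : ℕ → ℕ → ZMod 2) (t : ℕ → ZMod 2) (T : Finset ℕ) (c : ℕ) :
    ∑ d ∈ T, withDiag M t c d = t c * ind T c + ∑ d ∈ T, if c = d then 0 else M c d := by
  have : ∀ d, withDiag M t c d = (if c = d then t c else 0) + if c = d then 0 else M c d :=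
    fun d => by simp only [withDiag]; split_ifs <;> simp
  simp only [this, Finset.sum_add_distrib, Finset.sum_ite_eq, ind]
  split_ifs <;> simp

theorem zmod_two_add_one {a b : ZMod 2} (h : a ≠ b) : a + 1 = b := by
  revert a b; decide

namespace GaussCode

/-! ### The faces of a diagram -/

/-- A truth value as an element of the field with two elements. -/
def bz (b : Bool) : ZMod 2 := if b then 1 else 0

/-- Whether the other strand crosses from right to left. -/
def tau (x : Letter) : Bool := x.isOver == x.positive

theorem tau_partner (x : Letter) : tau x.partner = !tau x := by
  cases x with
  | mk l o p => cases o <;> cases p <;> rfl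

/-- The turning directions alternate along the code up to the function `ε` of the crossing. The
first position has parity `k`. -/
def Par (ε : ℕ → ZMod 2) : ZMod 2 → GaussCode → Prop
  | _, [] => True
  | k, x :: w => bz (tau x) + k = ε x.label ∧ Par ε (k + 1) w

theorem par_append {ε : ℕ → ZMod 2} {k : ZMod 2} {u v : GaussCode} :
    Par ε k (u ++ v) ↔ Par ε k u ∧ Par ε (k + u.length) v := by
  induction u generalizing k with
  | nil => simp [Par]
  | cons x u ih =>
    simp only [List.cons_append, Par, ih, and_assoc, List.length_cons, Nat.cast_add, Nat.cast_one]
    rw [show k + 1 + (u.length : ZMod 2) = k + (u.length + 1) by ring]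

theorem Par.get {ε : ℕ → ZMod 2} {k : ZMod 2} {w : GaussCode} (h : Par ε k w)
    (i : Fin w.length) : bz (tau (w.get i)) + (k + (i : ℕ)) = ε (w.get i).label := by
  induction w generalizing k with
  | nil => exact i.elim0
  | cons x w ih =>
    refine Fin.cases ?_ (fun i => ?_) i
    · simpa using h.1
    · have := ih h.2 i
      simp only [Fin.val_succ, Nat.cast_add, Nat.cast_one]
      change bz (tau (w.get i)) + _ = ε (w.get i).label
      rw [← this]; ring

/-- The number of passages before position `i` through a crossing in `T`, modulo two. -/
def pre (T : Finset ℕ) (w : GaussCode) (i : ℕ) : ZMod 2 := ∑ d ∈ T, tot (w.take i) d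

theorem pre_zero (T : Finset ℕ) (w : GaussCode) : pre T w 0 = 0 := by simp [pre]

theorem pre_length (T : Finset ℕ) {w : GaussCode} (hw : WellFormed w) : pre T w w.length = 0 := by
  simp [pre, hw.tot_eq]

theorem pre_succ (T : Finset ℕ) {w : GaussCode} (i : Fin w.length) :
    pre T w (i + 1) = pre T w i + ind T (w.get i).label := by
  simp only [pre]
  rw [List.take_succ_eq_append_getElem i.2]
  simp only [tot_append, tot_cons, tot_nil, add_zero, Finset.sum_add_distrib, Finset.sum_ite_eq,
    ind, List.get_eq_getElem]

theorem WellFormed.eq_partner {w : GaussCode} (hw : WellFormed w) {i j : Fin w.length}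
    (hij : i ≠ j) (hl : (w.get i).label = (w.get j).label) : w.get j = (w.get i).partner := by
  have h1 : (w.get i).isOver ≠ (w.get j).isOver := by
    intro ho
    have := (List.nodup_iff_injective_get.1 hw.1)
    have := @this (i.cast (by simp)) (j.cast (by simp)) (by simp at hl ho ⊢; exact ⟨hl, ho⟩)
    simp only [Fin.ext_iff, Fin.val_cast] at this
    exact hij (Fin.ext this)
  have h2 : (w.get i).positive = (w.get j).positive := by
    rw [← hw.sgn_eq (w.get_mem i), ← hw.sgn_eq (w.get_mem j), hl]
  revert hl h1 h2
  generalize w.get i = x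
  generalize w.get j = y
  cases x; cases y
  rintro rfl h rfl
  simp only [Letter.partner, Letter.mk.injEq, true_and, and_true]
  revert h
  simp only
  rename_i o p o'
  cases o <;> cases o' <;> simp

theorem exists_split {w : GaussCode} {i j : Fin w.length} (hij : i < j) : ∃ u v t,
    w = u ++ w.get i :: (v ++ w.get j :: t) ∧ u = w.take i ∧
      u ++ w.get i :: v = w.take j := by
  have hij' : (i : ℕ) < j := hij
  refine ⟨w.take i, (w.take j).drop (i + 1), w.drop (j + 1), ?_, rfl, ?_⟩
  · have h1 : w = w.take j ++ w.get j :: w.drop (j + 1) := by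
      rw [List.get_eq_getElem, ← List.drop_eq_getElem_cons, List.take_append_drop]
    have h2 : w.take j = w.take i ++ w.get i :: (w.take j).drop (i + 1) := by
      have e : (w.take j).take i = w.take i := by rw [List.take_take, min_eq_left hij'.le]
      have l : (i : ℕ) < (w.take j).length := by simp; omega
      conv_lhs => rw [← List.take_append_drop i (w.take j), e, List.drop_eq_getElem_cons l]
      simp
    conv_lhs => rw [h1, h2]
    simp
  · have e : (w.take j).take i = w.take i := by rw [List.take_take, min_eq_left hij'.le]
    have l : (i : ℕ) < (w.take j).length := by simp; omega
    conv_rhs => rw [← List.take_append_drop i (w.take j), e, List.drop_eq_getElem_cons l]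
    simp

/-- The sum of the two prefix counts is the count on the arc between the two passages of a crossing.
A different crossing contributes exactly when it is interlaced with this one. So a row of the
interlacement matrix is the increment along an arc. -/
theorem pre_add_pre (T : Finset ℕ) {w : GaussCode} (hw : WellFormed w) {i j : Fin w.length}
    (hij : i ≠ j) (hl : (w.get i).label = (w.get j).label) :
    pre T w i + pre T w j = ind T (w.get i).label +
      ∑ d ∈ T, if (w.get i).label = d then 0 else beta w (w.get i).label d := by
  wlog h : i < j generalizing i j
  · rw [add_comm, this hij.symm hl.symm (lt_of_le_of_ne (not_lt.1 h) hij.symm), hl]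
  obtain ⟨u, v, t, hsplit, hu, hv⟩ := exists_split h
  have hp := hw.eq_partner hij hl
  have hperm : w.Perm (w.get i :: (w.get i).partner :: (u ++ v ++ t)) := by
    conv_lhs => rw [hsplit]
    rw [hp, ← Multiset.coe_eq_coe]
    simp only [← Multiset.coe_add, ← Multiset.cons_coe, ← Multiset.singleton_add]
    abel
  have hc := (hw.perm hperm).tail.2
  have hc1 : (w.get i).label ∉ labels u := by simp at hc ⊢; tauto
  have hc2 : (w.get i).label ∉ labels v := by simp at hc ⊢; tauto
  have hc3 : (w.get i).label ∉ labels t := by simp at hc ⊢; tauto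
  simp only [pre, ← hu, ← hv]
  set c := (w.get i).label with hcdef
  have e1 : ind T c = ∑ d ∈ T, if c = d then (1 : ZMod 2) else 0 := by
    rw [Finset.sum_ite_eq]; rfl
  rw [← Finset.sum_add_distrib, e1, ← Finset.sum_add_distrib]
  refine Finset.sum_congr rfl fun d _ => ?_
  by_cases hcd : c = d
  · simp only [tot_append, tot_cons, ← hcdef, ← hcd, tot_eq_zero hc1, tot_eq_zero hc2, if_true,
      add_zero, zero_add]
  · have : beta w c d = tot v d := by
      conv_lhs => rw [hsplit]
      have hcd' : ¬ (w.get j).label = d := by rw [← hl]; exact hcd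
      have hcd'' : (w.get j).label = c := hl.symm
      simp only [beta_append, beta_cons, tot_append, tot_cons, ← hcdef, hcd'', if_true, if_neg hcd,
        tot_eq_zero hc1, tot_eq_zero hc2, beta_eq_zero_left hc1, beta_eq_zero_left hc2,
        beta_eq_zero_left hc3]
      grind
    simp only [tot_append, tot_cons, ← hcdef, if_neg hcd, this]
    grind

theorem next_prev (w : GaussCode) (i : Fin w.length) : next w (prev w i) = i :=
  (finRotate w.length).apply_symm_apply i

theorem prev_next (w : GaussCode) (i : Fin w.length) : prev w (next w i) = i :=
  (finRotate w.length).symm_apply_apply i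

theorem next_val (w : GaussCode) (i : Fin w.length) :
    (next w i : ℕ) = i + 1 ∨ ((i : ℕ) + 1 = w.length ∧ (next w i : ℕ) = 0) := by
  have key : ∀ n (i : Fin n), (finRotate n i : ℕ) = i + 1 ∨ ((i : ℕ) + 1 = n ∧
      (finRotate n i : ℕ) = 0) := by
    intro n i
    rcases n with _ | n
    · exact i.elim0
    · by_cases h : i = Fin.last n
      · subst h; right; simp
      · left; exact coe_finRotate_of_ne_last h
  exact key _ i

theorem pre_next (T : Finset ℕ) {w : GaussCode} (hw : WellFormed w) (i : Fin w.length) :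
    pre T w (next w i) = pre T w (i + 1) := by
  rcases next_val w i with h | ⟨h1, h2⟩
  · rw [h]
  · rw [h1, h2, pre_zero, pre_length T hw]

theorem parity_next {w : GaussCode} (hw : WellFormed w) (i : Fin w.length) :
    (((next w i : ℕ) : ℕ) : ZMod 2) = (i : ℕ) + 1 := by
  rcases next_val w i with h | ⟨h1, h2⟩
  · rw [h]; push_cast; ring
  · rw [h2]
    have : (((i : ℕ) + 1 : ℕ) : ZMod 2) = 0 := by
      rw [h1, hw.length_eq]; push_cast
      rw [show (2 : ZMod 2) = 0 from rfl, zero_mul]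
    push_cast at this
    rw [this]; simp

theorem parity_prev {w : GaussCode} (hw : WellFormed w) (i : Fin w.length) :
    (((prev w i : ℕ) : ℕ) : ZMod 2) = (i : ℕ) + 1 := by
  have := parity_next hw (prev w i)
  rw [next_prev] at this
  rw [this, add_assoc, show (1 : ZMod 2) + 1 = 0 from rfl, add_zero]

/-- A function on the edges that is constant on the circles of the state whose circles are the
faces of one colour. -/
def IsState (w : GaussCode) (κ : ZMod 2) (H : Fin w.length → ZMod 2) : Prop :=
  ∀ h j : Fin w.length, h ≠ j → (w.get h).label = (w.get j).label → ((h : ℕ) : ZMod 2) = κ →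
    if tau (w.get h) then H (prev w h) = H j ∧ H h = H (prev w j)
    else H (prev w h) = H (prev w j) ∧ H h = H j

/-- The matrix of the state whose circles are the faces of the colour `κ`. -/
def faceMat (w : GaussCode) (ε : ℕ → ZMod 2) (κ : ZMod 2) : ℕ → ℕ → ZMod 2 :=
  withDiag (beta w) fun c => ε c + κ + 1

/-- The two passages of a crossing turn in opposite directions and share the value of `ε`, so their
positions have opposite parities. -/
theorem parity_partner {w : GaussCode} (hw : WellFormed w) {ε : ℕ → ZMod 2} (hε : Par ε 0 w)
    {i j : Fin w.length} (hij : i ≠ j) (hl : (w.get i).label = (w.get j).label) :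
    ((j : ℕ) : ZMod 2) = (i : ℕ) + 1 := by
  have h1 := hε.get i
  have h2 := hε.get j
  rw [← hl, ← h1, hw.eq_partner hij hl, tau_partner] at h2
  revert h2
  generalize ((j : ℕ) : ZMod 2) = b
  generalize ((i : ℕ) : ZMod 2) = a
  generalize tau (w.get i) = t
  revert a b t
  decide

/-- Let the value on the edges switch at each passage through a crossing of `T`. The values fit
together at a crossing exactly when its row equation holds; the diagonal entry records the kind of
smoothing. -/
theorem isState_of_mem_ker {w : GaussCode} (hw : WellFormed w) {ε : ℕ → ZMod 2} (hε : Par ε 0 w)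
    {κ : ZMod 2} {T : Finset ℕ} (hT : T ∈ ker (labels w) (faceMat w ε κ)) (a : ZMod 2) :
    IsState w κ fun i => a + pre T w (i + 1) := by
  intro h j hhj hl hκ
  have hc : (w.get h).label ∈ labels w := mem_labels.2 ⟨_, w.get_mem h, rfl⟩
  have h1 := (mem_ker.1 hT).2 _ hc
  rw [faceMat, sum_withDiag] at h1
  have h2 := pre_add_pre T hw hhj hl
  have h3 := hε.get h
  have h4 := pre_succ T h
  have h5 := pre_succ T j
  rw [← hl] at h5
  have h6 := pre_next T hw (prev w h)
  have h7 := pre_next T hw (prev w j)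
  rw [next_prev] at h6 h7
  simp only [← h6, ← h7, h4, h5]
  rw [hκ] at h3
  rw [← h3] at h1
  cases ht : tau (w.get h) <;> simp only [ht, bz, Bool.false_eq_true, if_true, if_false] at h1 ⊢ <;>
    constructor <;> grind

theorem exists_mem_ker_of_isState {w : GaussCode} (hw : WellFormed w) {ε : ℕ → ZMod 2}
    (hε : Par ε 0 w) {κ : ZMod 2} {H : Fin w.length → ZMod 2} (hH : IsState w κ H) :
    ∃ T ∈ ker (labels w) (faceMat w ε κ), ∃ a, ∀ i : Fin w.length, H i = a + pre T w (i + 1) := by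
  rcases Nat.eq_zero_or_pos w.length with h0 | hpos
  · rw [List.length_eq_zero_iff] at h0
    subst h0
    exact ⟨∅, by simp [mem_ker], 0, fun i => i.elim0⟩
  -- A state function switches at both passages of a crossing or at neither, so the set `T` of
  -- crossings at which it switches is well defined.
  have hlab : ∀ i j, (w.get i).label = (w.get j).label → H i + H (prev w i) =
      H j + H (prev w j) := by
    intro i j hl
    by_cases hij : i = j
    · rw [hij]
    have hpar := parity_partner hw hε hij hl
    by_cases hκ : ((i : ℕ) : ZMod 2) = κ
    · have := hH i j hij hl hκ
      split_ifs at this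
      · rw [this.1, this.2, add_comm]
      · rw [this.1, this.2]
    · have hκ' : ((j : ℕ) : ZMod 2) = κ := by
        rw [hpar, zmod_two_add_one hκ]
      have := hH j i (Ne.symm hij) hl.symm hκ'
      split_ifs at this
      · rw [this.1, this.2, add_comm]
      · rw [this.1, this.2]
  let T : Finset ℕ := (labels w).filter fun c =>
    ∃ i : Fin w.length, (w.get i).label = c ∧ H i + H (prev w i) = 1
  have hind : ∀ i, ind T (w.get i).label = H i + H (prev w i) := by
    intro i
    have hc : (w.get i).label ∈ labels w := mem_labels.2 ⟨_, w.get_mem i, rfl⟩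
    simp only [ind, T, Finset.mem_filter, hc, true_and]
    rcases zmod_two_cases (H i + H (prev w i)) with h | h
    · rw [if_neg, h]
      rintro ⟨j, hj, hj'⟩
      rw [hlab j i hj, h] at hj'
      exact zero_ne_one hj'
    · rw [if_pos ⟨i, rfl, h⟩, h]
  let last : Fin w.length := prev w ⟨0, hpos⟩
  have hval : ∀ n (hn : n < w.length), H ⟨n, hn⟩ = H last + pre T w (n + 1) := by
    intro n
    induction n with
    | zero =>
      intro hn
      have := pre_succ T (⟨0, hn⟩ : Fin w.length)
      simp only at this
      rw [this, hind, pre_zero]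
      simp only [last]
      grind
    | succ n ih =>
      intro hn
      have := pre_succ T (⟨n + 1, hn⟩ : Fin w.length)
      simp only at this
      rw [this, hind]
      have hprev : prev w ⟨n + 1, hn⟩ = ⟨n, by omega⟩ := by
        have : next w ⟨n, by omega⟩ = ⟨n + 1, hn⟩ := by
          rcases next_val w ⟨n, by omega⟩ with h | ⟨h, -⟩
          · exact Fin.ext h
          · simp only at h; omega
        rw [← this, prev_next]
      rw [hprev, ih]
      grind
  refine ⟨T, ?_, H last, fun i => hval i i.2⟩
  rw [mem_ker]
  refine ⟨Finset.filter_subset _ _, fun c hc => ?_⟩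
  obtain ⟨x, hx, hxc⟩ := mem_labels.1 hc
  -- Exactly one of the two passages has a position of parity `κ`; `IsState` speaks about this one.
  have hgen : ∃ h j : Fin w.length, h ≠ j ∧ (w.get h).label = c ∧ (w.get j).label = c ∧
      ((h : ℕ) : ZMod 2) = κ := by
    obtain ⟨i, hi⟩ := List.get_of_mem hx
    obtain ⟨j, hj⟩ := List.get_of_mem (hw.2 x hx)
    have hij : i ≠ j := by
      rintro rfl
      rw [hi] at hj
      have := congrArg Letter.isOver hj
      simp [Letter.partner] at this
    have hi' : (w.get i).label = c := by rw [hi, hxc]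
    have hj' : (w.get j).label = c := by rw [hj]; exact hxc
    have hpar := parity_partner hw hε hij (hi'.trans hj'.symm)
    by_cases hκ : ((i : ℕ) : ZMod 2) = κ
    · exact ⟨i, j, hij, hi', hj', hκ⟩
    · refine ⟨j, i, hij.symm, hj', hi', ?_⟩
      rw [hpar, zmod_two_add_one hκ]
  obtain ⟨h, j, hhj, hh, hj, hκ⟩ := hgen
  have hl := hh.trans hj.symm
  rw [faceMat, sum_withDiag]
  have h2 := pre_add_pre T hw hhj hl
  have h3 := hε.get h
  have h4 := pre_succ T h
  have h5 := pre_succ T j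
  have h6 := pre_next T hw (prev w h)
  have h7 := pre_next T hw (prev w j)
  rw [next_prev] at h6 h7
  have h8 := hH h j hhj hl hκ
  have v1 := hval h h.2
  have v2 := hval j j.2
  have v3 := hval (prev w h) (prev w h).2
  have v4 := hval (prev w j) (prev w j).2
  simp only [Fin.eta] at v1 v2 v3 v4
  rw [← h6] at v3
  rw [← h7] at v4
  rw [h4] at v1
  rw [h5] at v2
  rw [v1, v2, v3, v4] at h8
  rw [hκ] at h3
  rw [hh] at h2 h3 h8
  rw [hj] at h8
  rw [← h3]
  cases ht : tau (w.get h) <;> simp only [ht, bz, Bool.false_eq_true, if_true, if_false] at h8 ⊢ <;>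
    grind

end GaussCode

end TieKnot

/-! ### Counting faces by the two kernels -/

namespace TieKnot.GaussCode

/-- The face to the left of the dart `(i, b)` gets the colour `i + bz b`. Left turns preserve the
colour, and they join edges as the state of that colour does. -/
theorem IsState.leftTurn {w : GaussCode} (hw : WellFormed w) {ε : ℕ → ZMod 2} (hε : Par ε 0 w)
    {H : ZMod 2 → Fin w.length → ZMod 2} (hH : ∀ κ, IsState w κ (H κ)) {d e : Dart w}
    (hde : LeftTurn w d e) : H ((d.1 : ℕ) + bz d.2) d.1 = H ((e.1 : ℕ) + bz e.2) e.1 := by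
  obtain ⟨i, b⟩ := d
  obtain ⟨j, hj, hl, rfl⟩ := hde
  have two : (1 : ZMod 2) + 1 = 0 := rfl
  have hp := parity_partner hw hε hj.symm hl.symm
  have hs := hH _ (head w (i, b)) j hj.symm hl.symm rfl
  change _ = H (((if (tau (w.get (head w (i, b))) == b) then (j, true) else (prev w j, false) :
    Dart w).1 : ℕ) + bz (if (tau (w.get (head w (i, b))) == b) then (j, true) else (prev w j, false) :
    Dart w).2) (if (tau (w.get (head w (i, b))) == b) then (j, true) else (prev w j, false) :
    Dart w).1
  have e1 : ((prev w j : ℕ) : ZMod 2) = (head w (i, b) : ℕ) := by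
    rw [parity_prev hw, hp, add_assoc, two, add_zero]
  have e2 : ((j : ℕ) : ZMod 2) + 1 = (head w (i, b) : ℕ) := by rw [hp, add_assoc, two, add_zero]
  have e3 : ((i : ℕ) : ZMod 2) + bz b = (head w (i, b) : ℕ) := by
    cases b
    · simp [head, bz]
    · simp [head, bz, parity_next hw]
  rw [e3]
  cases b
  · have e4 : head w (i, false) = i := rfl
    rw [e4] at hs e1 e2 ⊢
    cases ht : tau (w.get i) <;> simp only [ht, Bool.false_eq_true, if_true, if_false] at hs <;>
      simp [bz, e1, e2, hs]
  · have e4 : prev w (head w (i, true)) = i := prev_next w i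
    rw [e4] at hs
    cases ht : tau (w.get (head w (i, true))) <;>
      simp only [ht, Bool.false_eq_true, if_true, if_false] at hs <;> simp [bz, e1, e2, hs]

/-- Of the two darts of the edge `i`, the function picks the one whose face has the colour `κ`. -/
theorem isState_of_leftTurn {w : GaussCode} (hw : WellFormed w) {ε : ℕ → ZMod 2} (hε : Par ε 0 w)
    {f : Dart w → ZMod 2} (hf : ∀ d e, LeftTurn w d e → f d = f e) (κ : ZMod 2) :
    IsState w κ fun i => f (i, decide (κ + (i : ℕ) = 1)) := by
  intro h j hhj hl hκ
  have two : (1 : ZMod 2) + 1 = 0 := rfl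
  have hp := parity_partner hw hε hhj hl
  have a1 : κ + ((h : ℕ) : ZMod 2) = 0 := by rw [hκ, CharTwo.add_self_eq_zero]
  have a2 : κ + ((j : ℕ) : ZMod 2) = 1 := by rw [hp, ← add_assoc, a1, zero_add]
  have a3 : κ + ((prev w h : ℕ) : ZMod 2) = 1 := by rw [parity_prev hw, ← add_assoc, a1, zero_add]
  have a4 : κ + ((prev w j : ℕ) : ZMod 2) = 0 := by rw [parity_prev hw, ← add_assoc, a2, two]
  simp only [a1, a2, a3, a4, zero_ne_one, decide_true, decide_false]
  have e1 : head w (prev w h, true) = h := next_prev w h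
  have l1 := hf (prev w h, true) _ ⟨j, by rw [e1]; exact hhj.symm, by rw [e1]; exact hl.symm, rfl⟩
  have l2 := hf (h, false) _ ⟨j, hhj.symm, hl.symm, rfl⟩
  rw [e1] at l1
  rw [show head w (h, false) = h from rfl] at l2
  change _ = f (if (tau (w.get h) == true) = true then (j, true) else (prev w j, false)) at l1
  change _ = f (if (tau (w.get h) == false) = true then (j, true) else (prev w j, false)) at l2
  cases ht : tau (w.get h) <;> rw [ht] at l1 l2
  · exact ⟨l1, l2⟩
  · exact ⟨l1, l2⟩

/-- A kernel vector containing the crossing gives a function on the faces that switches there, so it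
separates the two opposite corners, both of which have the colour of the parity of `i`. -/
theorem exists_face_ne {w : GaussCode} (hw : WellFormed w) {ε : ℕ → ZMod 2} (hε : Par ε 0 w)
    {i : Fin w.length} {T : Finset ℕ}
    (hT : T ∈ ker (labels w) (faceMat w ε (i : ℕ))) (hi : (w.get i).label ∈ T) :
    ¬ NugatoryAt w i := by
  intro hn
  -- The test function is zero on the faces of the other colour.
  have h0 : ∀ κ, IsState w κ fun j => if κ = (i : ℕ) then 0 + pre T w (j + 1) else 0 := by
    intro κ
    by_cases h : κ = (i : ℕ)
    · subst h
      simpa using isState_of_mem_ker hw hε hT 0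
    · simp only [h, if_false]
      exact fun _ _ _ _ _ => by simp
  have := congrArg (Quot.lift _ fun d e hde => IsState.leftTurn hw hε h0 hde) hn
  simp only [faceLeft, bz, parity_prev hw, if_true, add_assoc, Bool.false_eq_true, if_false,
    add_zero, show (1 : ZMod 2) + 1 = 0 from rfl, zero_add] at this
  rw [← pre_next T hw (prev w i), next_prev, pre_succ, ind, if_pos hi] at this
  exact absurd this (by generalize pre T w i = a; revert a; decide)

theorem faceMat_zero (w : GaussCode) (ε : ℕ → ZMod 2) :
    faceMat w ε 0 = compl (faceMat w ε 1) := by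
  funext c d
  simp only [faceMat, withDiag, compl]
  by_cases h : c = d
  · subst h; simp; grind
  · simp [h, Ne.symm h]

instance (w : GaussCode) : Finite (Face w) := Quot.finite _

/-- Count functions from the faces to the field with two elements. Such a function amounts to one
state function for each colour, i.e. to an additive constant and a kernel vector for each colour. -/
theorem card_face {w : GaussCode} (hw : WellFormed w) (h0 : w ≠ []) {ε : ℕ → ZMod 2}
    (hε : Par ε 0 w) : 2 ^ Nat.card (Face w) =
      4 * ((ker (labels w) (faceMat w ε 1)).card * (ker (labels w) (faceMat w ε 0)).card) := by
  let A := (ZMod 2 × {T // T ∈ ker (labels w) (faceMat w ε 0)}) ×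
    (ZMod 2 × {T // T ∈ ker (labels w) (faceMat w ε 1)})
  let H : A → ZMod 2 → Fin w.length → ZMod 2 := fun p κ i =>
    if κ = 0 then p.1.1 + pre p.1.2 w (i + 1) else p.2.1 + pre p.2.2 w (i + 1)
  have hH : ∀ p κ, IsState w κ (H p κ) := by
    intro p κ
    rcases zmod_two_cases κ with rfl | rfl
    · exact isState_of_mem_ker hw hε p.1.2.2 p.1.1
    · exact isState_of_mem_ker hw hε p.2.2.2 p.2.1
  let Φ : A → Face w → ZMod 2 := fun p =>
    Quot.lift (fun d : Dart w => H p ((d.1 : ℕ) + bz d.2) d.1) fun d e hde =>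
      IsState.leftTurn hw hε (hH p) hde
  have hpos : 0 < w.length := List.length_pos_iff.2 h0
  have inj1 : ∀ {a a' κ} {T T' : Finset ℕ}, T ∈ ker (labels w) (faceMat w ε κ) →
      T' ∈ ker (labels w) (faceMat w ε κ) →
      (∀ i : Fin w.length, a + pre T w (i + 1) = a' + pre T' w (i + 1)) → a = a' ∧ T = T' := by
    intro a a' κ T T' hT hT' h
    have ha : a = a' := by
      have := h (prev w ⟨0, hpos⟩)
      rw [← pre_next T hw, ← pre_next T' hw, next_prev] at this
      simpa [pre_zero] using this
    subst ha
    have h' : ∀ i : Fin w.length, pre T w (i + 1) = pre T' w (i + 1) := fun i =>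
      add_left_cancel (h i)
    have h'' : ∀ i : Fin w.length, pre T w i = pre T' w i := fun i => by
      have := h' (prev w i)
      rwa [← pre_next T hw, ← pre_next T' hw, next_prev] at this
    have h3 : ∀ c ∈ labels w, ind T c = ind T' c := by
      intro c hc
      obtain ⟨x, hx, rfl⟩ := mem_labels.1 hc
      obtain ⟨i, rfl⟩ := List.get_of_mem hx
      have := h' i
      rw [pre_succ, pre_succ, h'' i] at this
      exact add_left_cancel this
    have h4 : ∀ c, c ∈ labels w → (c ∈ T ↔ c ∈ T') := by
      intro c hc
      have := h3 c hc
      simp only [ind] at this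
      by_cases h1 : c ∈ T <;> by_cases h2 : c ∈ T' <;> simp [h1, h2] at this ⊢
    refine ⟨rfl, ?_⟩
    ext c
    exact ⟨fun hc => (h4 c ((mem_ker.1 hT).1 hc)).1 hc, fun hc => (h4 c ((mem_ker.1 hT').1 hc)).2 hc⟩
  have hval : ∀ p κ i, H p κ i = Φ p (faceLeft w (i, decide (κ + (i : ℕ) = 1))) := by
    intro p κ i
    have : ((i : ℕ) : ZMod 2) + bz (decide (κ + (i : ℕ) = 1)) = κ := by
      generalize ((i : ℕ) : ZMod 2) = a
      revert a κ
      decide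
    change _ = H p _ i
    rw [this]
  have hbij : Function.Bijective Φ := by
    constructor
    · intro p q hpq
      have hHpq : ∀ κ i, H p κ i = H q κ i := fun κ i => by rw [hval, hval, hpq]
      have k0 := inj1 p.1.2.2 q.1.2.2 (hHpq 0)
      have k1 := inj1 p.2.2.2 q.2.2.2 (hHpq 1)
      exact Prod.ext (Prod.ext k0.1 (Subtype.ext k0.2)) (Prod.ext k1.1 (Subtype.ext k1.2))
    · intro g
      have hg := isState_of_leftTurn hw hε (f := fun d => g (faceLeft w d))
        fun d e hde => congrArg g (Quot.sound hde)
      obtain ⟨T₀, hT₀, a₀, h₀⟩ := exists_mem_ker_of_isState hw hε (hg 0)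
      obtain ⟨T₁, hT₁, a₁, h₁⟩ := exists_mem_ker_of_isState hw hε (hg 1)
      refine ⟨((a₀, ⟨T₀, hT₀⟩), (a₁, ⟨T₁, hT₁⟩)), ?_⟩
      funext x
      obtain ⟨⟨i, b⟩, rfl⟩ := Quot.exists_rep x
      have hb : ∀ κ : ZMod 2, ((i : ℕ) : ZMod 2) + bz b = κ → decide (κ + (i : ℕ) = 1) = b := by
        rintro κ rfl
        generalize ((i : ℕ) : ZMod 2) = a
        revert a b
        decide
      change H _ _ i = _
      rcases zmod_two_cases (((i : ℕ) : ZMod 2) + bz b) with h | h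
      · have := h₀ i
        rw [hb 0 h] at this
        simp only at h ⊢
        rw [h]
        exact this.symm
      · have := h₁ i
        rw [hb 1 h] at this
        simp only at h ⊢
        rw [h]
        exact this.symm
  have hcard := Nat.card_eq_of_bijective Φ hbij
  rw [Nat.card_fun] at hcard
  have hA : Nat.card A = (2 * (ker (labels w) (faceMat w ε 0)).card) *
      (2 * (ker (labels w) (faceMat w ε 1)).card) := by
    simp only [A, Nat.card_prod, Nat.card_zmod, Nat.card_eq_finsetCard]
  rw [Nat.card_zmod, hA] at hcard
  rw [← hcard]
  ring

/-- The combinatorial form of planarity. -/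
def Good (w : GaussCode) : Prop :=
  WellFormed w ∧ ∃ ε, Par ε 0 w ∧ Proj (labels w) (withDiag (beta w) ε)

theorem faceMat_one (w : GaussCode) (ε : ℕ → ZMod 2) : faceMat w ε 1 = withDiag (beta w) ε := by
  have : (fun c => ε c + 1 + 1) = ε := funext fun c => by
    rw [add_assoc, show (1 : ZMod 2) + 1 = 0 from rfl, add_zero]
  rw [faceMat, this]

/-- For a projection the two kernel sizes multiply to `2 ^ n`, so `card_face` gives Euler's count `n
+ 2`. -/
theorem Good.isKnotDiagram {w : GaussCode} (h : Good w) : IsKnotDiagram w := by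
  obtain ⟨hw, ε, hε, hp⟩ := h
  refine ⟨hw, ?_⟩
  by_cases h0 : w = []
  · exact Or.inl h0
  right
  have := card_face hw h0 hε
  rw [faceMat_zero, faceMat_one, hp.card_ker_mul_card_ker, hw.card_labels] at this
  refine Nat.pow_right_injective (le_refl 2) (this.trans ?_)
  simp only [pow_add]; ring

/-- A diagram in which every crossing is interlaced with another one is reduced. -/
theorem isReduced_of_interlaced {w : GaussCode} (hw : WellFormed w) {ε : ℕ → ZMod 2}
    (hε : Par ε 0 w) (hp : Proj (labels w) (withDiag (beta w) ε))
    (hi : ∀ c ∈ labels w, ∃ d ∈ labels w, c ≠ d ∧ beta w c d = 1) : IsReduced w := by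
  intro i
  have hc : (w.get i).label ∈ labels w := mem_labels.2 ⟨_, w.get_mem i, rfl⟩
  obtain ⟨d, hd, hcd, hb⟩ := hi _ hc
  suffices h : ∃ T ∈ ker (labels w) (faceMat w ε (i : ℕ)), (w.get i).label ∈ T by
    obtain ⟨T, hT, hT'⟩ := h
    exact exists_face_ne hw hε hT hT'
  generalize (w.get i).label = c at hc hcd hb
  rcases zmod_two_cases ((i : ℕ) : ZMod 2) with h | h
  · rw [h, faceMat_zero, faceMat_one]
    exact hp.compl.exists_mem_ker hc hd hcd (by
      rw [TieKnot.compl, withDiag, if_neg hcd, if_neg hcd.symm, hb, add_zero])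
  · rw [h, faceMat_one]
    exact hp.exists_mem_ker hc hd hcd (by rw [withDiag, if_neg hcd, hb])

/-- A diagram whose signs agree with the turning directions is alternating. -/
theorem isAlternating_of_par {w : GaussCode} (hw : WellFormed w) {ε : ℕ → ZMod 2}
    (hε : Par ε 0 w) (κ : ZMod 2) (hs : ∀ x ∈ w, bz x.positive = ε x.label + κ) :
    IsAlternating w := by
  intro i
  have h1 := hε.get i
  have h2 := hε.get (next w i)
  rw [parity_next hw] at h2
  have h3 := hs _ (w.get_mem i)
  have h4 := hs _ (w.get_mem (next w i))
  rw [← h1] at h3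
  rw [← h2] at h4
  revert h3 h4
  generalize w.get i = x
  generalize w.get (next w i) = y
  simp only [tau]
  generalize x.positive = p
  generalize y.positive = q
  generalize x.isOver = o
  generalize y.isOver = o'
  generalize ((i : ℕ) : ZMod 2) = a
  clear * -
  revert a κ o o' p q
  decide

end TieKnot.GaussCode

namespace TieKnot

/-- Adding the projection to a vector that is an eigenvector on both sides. -/
theorem Proj.add_rank_one {L : Finset ℕ} {N : ℕ → ℕ → ZMod 2} (hp : Proj L N)
    {i : ℕ → ZMod 2} {l : ZMod 2} (h1 : ∑ e ∈ L, i e * i e = 1)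
    (hz : ∀ c ∈ L, ∑ e ∈ L, N c e * i e = l * i c)
    (hz' : ∀ c ∈ L, ∑ e ∈ L, i e * N e c = l * i c) :
    Proj L fun c d => N c d + i c * i d := by
  intro c hc d hd
  -- After summation the two mixed terms are both `l * i c * i d` and cancel; the last term
  -- reproduces `i c * i d`.
  have : ∀ e, (N c e + i c * i e) * (N e d + i e * i d) =
      N c e * N e d + (N c e * i e) * i d + i c * (i e * N e d) + i c * (i e * i e) * i d :=
    fun e => by ring
  simp only [this, Finset.sum_add_distrib, ← Finset.sum_mul, ← Finset.mul_sum, h1, hz c hc,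
    hz' d hd, hp c hc d hd]
  generalize N c d = n
  grind

namespace GaussCode

/-! ### Planarity under the elementary changes -/

theorem Par.shift {ε ε' : ℕ → ZMod 2} {k : ZMod 2} {w : GaussCode} (h : Par ε k w) (δ : ZMod 2)
    (hε : ∀ c ∈ labels w, ε' c = ε c + δ) : Par ε' (k + δ) w := by
  induction w generalizing k with
  | nil => trivial
  | cons x w ih =>
    refine ⟨?_, ?_⟩
    · rw [hε _ (by simp), ← h.1]; ring
    · rw [show k + δ + 1 = k + 1 + δ by ring]
      exact ih h.2 fun c hc => hε c (by simp [hc])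

theorem Par.congr {ε ε' : ℕ → ZMod 2} {k : ZMod 2} {w : GaussCode} (h : Par ε k w)
    (hε : ∀ c ∈ labels w, ε' c = ε c) : Par ε' k w := by
  simpa using h.shift 0 (ε' := ε') fun c hc => by rw [hε c hc, add_zero]

theorem par_inOrder {ε : ℕ → ZMod 2} {k : ZMod 2} {b : Bool} {x y : Letter} :
    Par ε k (inOrder b x y) ↔ bz (tau x) + (k + 1 + bz b) = ε x.label ∧
      bz (tau y) + (k + bz b) = ε y.label := by
  cases b
  · simp [inOrder, Par, bz, and_comm]
  · simp only [inOrder, if_true, Par, bz, and_true]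
    rw [show k + 1 + 1 = k by rw [add_assoc, show (1 : ZMod 2) + 1 = 0 from rfl, add_zero]]

theorem length_inOrder (b : Bool) (x y : Letter) : (inOrder b x y).length = 2 := by
  cases b <;> rfl

/-- Shifting the base point by an odd number of positions exchanges the two colours: `ε` changes by
`1` and the projection `N` becomes `N + 1`. -/
theorem Good.rotate {u v : GaussCode} (h : Good (u ++ v)) : Good (v ++ u) := by
  obtain ⟨hw, ε, hε, hp⟩ := h
  have hl : labels (v ++ u) = labels (u ++ v) := labels_perm List.perm_append_comm
  have hlen : ((u.length : ZMod 2)) = v.length := by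
    have : ((2 * numCrossings (u ++ v) : ℕ) : ZMod 2) = 0 := by
      rw [Nat.cast_mul, show ((2 : ℕ) : ZMod 2) = 0 from rfl, zero_mul]
    rw [← hw.length_eq, List.length_append, Nat.cast_add] at this
    exact CharTwo.add_eq_zero.1 this
  obtain ⟨hu, hv⟩ := par_append.1 hε
  refine ⟨hw.perm List.perm_append_comm, fun c => ε c + u.length, ?_, ?_⟩
  · rw [par_append]
    constructor
    · convert hv.shift (u.length : ZMod 2) fun c _ => rfl using 1
      rw [add_assoc, CharTwo.add_self_eq_zero, add_zero]
    · rw [← hlen]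
      exact hu.shift (u.length : ZMod 2) fun c _ => rfl
  · rw [hl]
    rcases zmod_two_cases (u.length : ZMod 2) with h0 | h0
    · refine hp.congr fun c _ d _ => ?_
      simp only [withDiag, h0, add_zero, beta_rotate hw.tot_eq]
    · refine hp.compl.congr fun c _ d _ => ?_
      simp only [TieKnot.compl, withDiag, h0, beta_rotate hw.tot_eq]
      by_cases hcd : c = d
      · simp [hcd]
      · simp [hcd, Ne.symm hcd]

theorem Good.r1 {c : ℕ} {o s : Bool} {u : GaussCode}
    (h : Good (([⟨c, o, s⟩, ⟨c, !o, s⟩] : GaussCode) ++ u)) : Good u := by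
  obtain ⟨hw, ε, hε, hp⟩ := h
  obtain ⟨hu, hc⟩ : WellFormed u ∧ c ∉ labels u := WellFormed.tail (x := ⟨c, o, s⟩) hw
  have hne : ∀ e ∈ labels u, c ≠ e := fun e he h => hc (h ▸ he)
  have hl : labels (([⟨c, o, s⟩, ⟨c, !o, s⟩] : GaussCode) ++ u) = insert c (labels u) := by simp
  refine ⟨hu, ε, ?_, ?_⟩
  · have := (par_append.1 hε).2
    simpa [show (2 : ZMod 2) = 0 from rfl] using this
  · intro e he f hf
    have := hp e (by simp [he]) f (by simp [hf])
    rw [hl, Finset.sum_insert hc] at this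
    have k1 : withDiag (beta (([⟨c, o, s⟩, ⟨c, !o, s⟩] : GaussCode) ++ u)) ε e c = 0 := by
      simp [withDiag, hne e he, (hne e he).symm, beta_eq_zero_right hc]
    have k2 : ∀ a ∈ labels u, ∀ b, withDiag (beta (([⟨c, o, s⟩, ⟨c, !o, s⟩] : GaussCode) ++ u)) ε a b
        = withDiag (beta u) ε a b := fun a ha b => by
      simp [withDiag, hne a ha]
    rw [k1, zero_mul, zero_add, k2 e he f] at this
    rw [← this]
    exact Finset.sum_congr rfl fun a ha => by rw [k2 e he, k2 a ha]

/-- The two chords have equal rows and columns outside the bigon, so their contributions to the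
square of the matrix cancel. -/
theorem Good.r2 {c d : ℕ} {s b : Bool} {u v : GaussCode}
    (h : Good (([⟨c, true, s⟩, ⟨d, true, !s⟩] : GaussCode) ++ u ++
      inOrder b ⟨c, false, s⟩ ⟨d, false, !s⟩ ++ v)) : Good (u ++ v) := by
  obtain ⟨h, ε, hε, hp⟩ := h
  have hperm := r2_perm c d s b u v
  set w := ([⟨c, true, s⟩, ⟨d, true, !s⟩] : GaussCode) ++ u ++ inOrder b ⟨c, false, s⟩ ⟨d, false, !s⟩ ++ v
    with hw
  obtain ⟨h1, hc⟩ := (h.perm hperm).tail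
  have hd := h1.tail.2
  have huv := h1.tail.1
  have hcd : c ≠ d := by simp at hc; tauto
  replace hc : c ∉ labels (u ++ v) := by simp at hc ⊢; tauto
  replace hd : d ∉ labels (u ++ v) := hd
  have hce : ∀ e ∈ labels (u ++ v), c ≠ e := fun e he h => hc (h ▸ he)
  have hde : ∀ e ∈ labels (u ++ v), d ≠ e := fun e he h => hd (h ▸ he)
  have hl : labels w = insert c (insert d (labels (u ++ v))) := by
    rw [labels_perm hperm]; simp [Letter.partner]
  have hcu : c ∉ labels u := by simp at hc; tauto
  have hcv : c ∉ labels v := by simp at hc; tauto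
  have hdu : d ∉ labels u := by simp at hd; tauto
  have hdv : d ∉ labels v := by simp at hd; tauto
  have sym : ∀ {a b}, a ≠ b → beta w a b = beta w b a := beta_comm h.tot_eq
  have k1 : ∀ e ∈ labels (u ++ v), beta w c e = tot u e := fun e he => by
    cases b <;> simp [w, inOrder, hce e he, hde e he, tot_eq_zero hcu,
      beta_eq_zero_left hcu, beta_eq_zero_left hcv, hcd.symm] <;> grind
  have k2 : ∀ e ∈ labels (u ++ v), beta w d e = tot u e := fun e he => by
    cases b <;> simp [w, inOrder, hce e he, hde e he, tot_eq_zero hdu,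
      beta_eq_zero_left hdu, beta_eq_zero_left hdv, hcd] <;> grind
  have k3 : ∀ e ∈ labels (u ++ v), ∀ f ∈ labels (u ++ v), withDiag (beta w) ε e f =
      withDiag (beta (u ++ v)) ε e f := fun e he f hf => by
    cases b <;> simp [withDiag, w, inOrder, hce e he, hde e he, hce f hf, hde f hf]
  refine ⟨huv, ε, ?_, ?_⟩
  · rw [hw] at hε
    simp only [par_append, List.length_append, length_inOrder] at hε ⊢
    refine ⟨?_, ?_⟩
    · simpa [show (2 : ZMod 2) = 0 from rfl] using hε.1.1.2
    · simpa [show (1 : ZMod 2) + 1 = 0 from rfl, show (2 : ZMod 2) = 0 from rfl] using hε.2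
  · intro e he f hf
    have := hp e (by rw [hl]; simp [-labels_append, he]) f (by rw [hl]; simp [-labels_append, hf])
    rw [hl, Finset.sum_insert (by simpa [-labels_append, hcd] using hc), Finset.sum_insert hd]
      at this
    have e1 : withDiag (beta w) ε e c = withDiag (beta w) ε e d := by
      rw [withDiag, withDiag, if_neg (hce e he).symm, if_neg (hde e he).symm,
        sym (hce e he).symm, sym (hde e he).symm, k1 e he, k2 e he]
    have e2 : withDiag (beta w) ε c f = withDiag (beta w) ε d f := by
      rw [withDiag, withDiag, if_neg (hce f hf), if_neg (hde f hf), k1 f hf, k2 f hf]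
    rw [e1, e2, ← add_assoc, CharTwo.add_self_eq_zero, zero_add, k3 e he f hf] at this
    rw [← this]
    exact Finset.sum_congr rfl fun a ha => by rw [k3 e he a ha, k3 a ha f hf]

theorem beta_inOrder (b : Bool) (x y : Letter) (e f : ℕ) :
    beta (inOrder b x y) e f = (if x.label = e then if y.label = f then bz b else 0 else 0) +
      if y.label = e then if x.label = f then 1 + bz b else 0 else 0 := by
  cases b <;> by_cases h1 : x.label = e <;> by_cases h2 : y.label = e <;> simp [inOrder, bz, h1, h2]
    <;> grind

/-- With `i` the indicator of the three crossings, the move adds `i iᵀ` to the matrix. The norm of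
`i` is `3 = 1`, and `i` is an eigenvector, so `Proj.add_rank_one` applies. -/
theorem Good.r3 {a b c : ℕ} {sa sb sc x y z : Bool} {u v t : GaussCode}
    (h₁ : (sa == y) = (sb == z)) (h₂ : (sc == y) = (sb == x))
    (h : Good (topStrand x a b sa sb ++ u ++ midStrand y a c sa sc ++ v ++
      botStrand z b c sb sc ++ t)) :
    Good (topStrand (!x) a b sa sb ++ u ++ midStrand (!y) a c sa sc ++ v ++
      botStrand (!z) b c sb sc ++ t) := by
  obtain ⟨hw, ε, hε, hp⟩ := h
  have hperm := r3_perm a b c sa sb sc x y z u v t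
  have hperm' := hperm.trans (r3_perm a b c sa sb sc (!x) (!y) (!z) u v t).symm
  obtain ⟨⟨n1, n2, n3⟩, ⟨a1, a2, a3⟩, ⟨b1, b2, b3⟩, c1, c2, c3⟩ := r3_notMem hw hperm
  have hw' := hw.perm hperm'
  obtain ⟨⟨p1, p2, p3⟩, r⟩ := r3_beta hw
  obtain ⟨⟨q1, q2, q3⟩, r'⟩ := r3_beta hw'
  have hl : labels (topStrand x a b sa sb ++ u ++ midStrand y a c sa sc ++ v ++
      botStrand z b c sb sc ++ t) = insert a (insert b (insert c (labels (u ++ v ++ t)))) := by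
    rw [labels_perm hperm]; simp [Letter.partner]
  have hl' := labels_perm hperm'
  have two : (1 : ZMod 2) + 1 = 0 := rfl
  have ne : ∀ {x}, x ∉ labels u → x ∉ labels v → x ∉ labels t →
      ∀ e ∈ labels (u ++ v ++ t), x ≠ e := by
    rintro x h1 h2 h3 e he rfl
    simp only [labels_append, Finset.mem_union] at he
    tauto
  have nea := ne a1 a2 a3
  have neb := ne b1 b2 b3
  have nec := ne c1 c2 c3
  have sym : ∀ {a' b' : ℕ}, a' ≠ b' → _ = _ := fun {a' b'} => beta_comm (c := a') (d := b') hw.tot_eq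
  have sym' : ∀ {a' b' : ℕ}, a' ≠ b' → _ = _ := fun {a' b'} => beta_comm (c := a') (d := b') hw'.tot_eq
  have rest : ∀ e ∈ labels (u ++ v ++ t), ∀ f ∈ labels (u ++ v ++ t),
      beta (topStrand (!x) a b sa sb ++ u ++ midStrand (!y) a c sa sc ++ v ++
        botStrand (!z) b c sb sc ++ t) e f = beta (topStrand x a b sa sb ++ u ++
        midStrand y a c sa sc ++ v ++ botStrand z b c sb sc ++ t) e f := fun e he f hf => by
    simp [topStrand, midStrand, botStrand, beta_inOrder, nea e he, neb e he, nec e he, nea f hf,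
      neb f hf, nec f hf]
  have har : a ∉ insert b (insert c (labels (u ++ v ++ t))) := by simp; tauto
  have hbr : b ∉ insert c (labels (u ++ v ++ t)) := by simp; tauto
  have hcr : c ∉ labels (u ++ v ++ t) := by simp; tauto
  generalize hR : labels (u ++ v ++ t) = R at *
  let i : ℕ → ZMod 2 := fun e => if e = a ∨ e = b ∨ e = c then 1 else 0
  have ia : i a = 1 := by simp [i]
  have ib : i b = 1 := by simp [i]
  have ic : i c = 1 := by simp [i]
  have ie : ∀ e ∈ R, i e = 0 := fun e he => by
    simp [i, (nea e he).symm, (neb e he).symm, (nec e he).symm]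
  have hpar := hε
  simp only [topStrand, midStrand, botStrand, par_append, par_inOrder, List.length_append,
    length_inOrder, tau, Nat.cast_add, Nat.cast_ofNat] at hpar
  -- The three row sums inside the triangle agree, by the triangle equations and the parities; their
  -- common value is the eigenvalue. The row sums outside vanish because the three rows add up to
  -- zero there.
  have hk : ∃ l, ε a + (if x then 1 else 0) + (if !y then 1 else 0) = l ∧
      ε b + (if x then 1 else 0) + (if z then 1 else 0) = l ∧
      ε c + (if !y then 1 else 0) + (if z then 1 else 0) = l := by
    obtain ⟨⟨⟨⟨⟨⟨e1, e2⟩, -⟩, e3, e4⟩, -⟩, e5, e6⟩, -⟩ := hpar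
    rw [← e1, ← e2, ← e4]
    rw [← e1] at e3
    rw [← e2] at e5
    rw [← e4] at e6
    generalize (u.length : ZMod 2) = lu at *
    generalize (v.length : ZMod 2) = lv at *
    clear * - h₁ h₂ e3 e5 e6
    revert lu lv sa sb sc x y z
    decide
  obtain ⟨l, l1, l2, l3⟩ := hk
  have hz : ∀ e ∈ insert a (insert b (insert c R)),
      withDiag (beta (topStrand x a b sa sb ++ u ++ midStrand y a c sa sc ++ v ++
        botStrand z b c sb sc ++ t)) ε e a + (withDiag (beta (topStrand x a b sa sb ++ u ++
        midStrand y a c sa sc ++ v ++ botStrand z b c sb sc ++ t)) ε e b +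
        withDiag (beta (topStrand x a b sa sb ++ u ++ midStrand y a c sa sc ++ v ++
        botStrand z b c sb sc ++ t)) ε e c) = l * i e := by
    intro e he
    simp only [Finset.mem_insert] at he
    rcases he with rfl | rfl | rfl | he
    · simp only [withDiag, if_true, if_neg n1, if_neg n2, p1, p2, ia, mul_one, ← l1]; ring
    · simp only [withDiag, if_true, if_neg n1.symm, if_neg n3, sym n1.symm, p1, p3, ib, mul_one,
        ← l2]; ring
    · simp only [withDiag, if_true, if_neg n2.symm, if_neg n3.symm, sym n2.symm, sym n3.symm, p2,
        p3, ic, mul_one, ← l3]; ring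
    · simp only [withDiag, if_neg (nea e he).symm, if_neg (neb e he).symm, if_neg (nec e he).symm,
        sym (nea e he).symm, sym (neb e he).symm, sym (nec e he).symm, (r e he).1, (r e he).2.1,
        (r e he).2.2, ie e he, mul_zero]
      grind
  have hNsym : ∀ e f, withDiag (beta (topStrand x a b sa sb ++ u ++ midStrand y a c sa sc ++ v ++
        botStrand z b c sb sc ++ t)) ε e f = withDiag (beta (topStrand x a b sa sb ++ u ++
        midStrand y a c sa sc ++ v ++ botStrand z b c sb sc ++ t)) ε f e := by
    intro e f
    by_cases hef : e = f
    · rw [hef]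
    · rw [withDiag, withDiag, if_neg hef, if_neg (Ne.symm hef), sym hef]
  have hsum : ∀ g : ℕ → ZMod 2, ∑ e ∈ insert a (insert b (insert c R)), g e * i e =
      g a + (g b + g c) := by
    intro g
    rw [Finset.sum_insert har, Finset.sum_insert hbr, Finset.sum_insert hcr, ia, ib, ic,
      Finset.sum_eq_zero fun e he => by rw [ie e he, mul_zero]]
    ring
  rw [hl] at hp hl'
  have key := hp.add_rank_one (i := i) (l := l) (by rw [hsum, ia, ib, ic]; rfl)
    (fun e he => by rw [hsum, hz e he])
    (fun e he => by
      rw [← hz e he, ← hsum]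
      exact Finset.sum_congr rfl fun f _ => by rw [mul_comm, hNsym])
  refine ⟨hw', fun e => ε e + i e, ?_, ?_⟩
  · have il : ∀ w : GaussCode, a ∉ labels w → b ∉ labels w → c ∉ labels w → ∀ k, Par ε k w →
        Par (fun e => ε e + i e) k w := by
      intro w ha hb hc k hk
      refine hk.congr fun e he => ?_
      have : i e = 0 := by
        simp only [i]
        rw [if_neg]
        rintro (rfl | rfl | rfl) <;> contradiction
      rw [this, add_zero]
    obtain ⟨⟨⟨⟨⟨⟨e1, e2⟩, e7⟩, e3, e4⟩, e8⟩, e5, e6⟩, e9⟩ := hpar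
    have hnot : ∀ x, bz (!x) = bz x + 1 := by decide
    simp only [topStrand, midStrand, botStrand, par_append, par_inOrder, List.length_append,
      length_inOrder, tau, Nat.cast_add, Nat.cast_ofNat, ia, ib, ic, hnot, ← e1, ← e2, ← e4]
    refine ⟨⟨⟨⟨⟨⟨?_, ?_⟩, il u a1 b1 c1 _ e7⟩, ?_, ?_⟩, il v a2 b2 c2 _ e8⟩, ?_, ?_⟩,
      il t a3 b3 c3 _ e9⟩
    · ring
    · ring
    · rw [e1, ← e3]; ring
    · ring
    · rw [e2, ← e5]; ring
    · rw [e4, ← e6]; ring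
  · rw [← hl']
    refine key.congr fun e he f hf => ?_
    have hd : ∀ w : Bool, (if !w then (1 : ZMod 2) else 0) = (if w then 1 else 0) + 1 := by decide
    by_cases hef : e = f
    · subst hef
      have : i e = i e * i e := by
        generalize i e = k
        revert k
        decide
      simp only [withDiag, if_true, ← this]
    rw [withDiag, withDiag, if_neg hef, if_neg hef]
    simp only [Finset.mem_insert] at he hf
    rcases he with rfl | rfl | rfl | he <;> rcases hf with rfl | rfl | rfl | hf
    · exact absurd rfl hef
    · rw [q1, p1, ia, ib, hd, one_mul]
    · rw [q2, p2, ia, ic, hd, one_mul]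
    · rw [(r f hf).1, (r' f hf).1, ie f hf, mul_zero, add_zero]
    · rw [sym hef, sym' hef, q1, p1, ia, ib, hd, one_mul]
    · exact absurd rfl hef
    · rw [q3, p3, ib, ic, hd, one_mul]
    · rw [(r f hf).2.1, (r' f hf).2.1, ie f hf, mul_zero, add_zero]
    · rw [sym hef, sym' hef, q2, p2, ia, ic, hd, one_mul]
    · rw [sym hef, sym' hef, q3, p3, ib, ic, hd, one_mul]
    · exact absurd rfl hef
    · rw [(r f hf).2.2, (r' f hf).2.2, ie f hf, mul_zero, add_zero]
    · rw [sym hef, sym' hef, (r e he).1, (r' e he).1, ie e he, zero_mul, add_zero]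
    · rw [sym hef, sym' hef, (r e he).2.1, (r' e he).2.1, ie e he, zero_mul, add_zero]
    · rw [sym hef, sym' hef, (r e he).2.2, (r' e he).2.2, ie e he, zero_mul, add_zero]
    · rw [rest e he f hf, ie e he, zero_mul, add_zero]

/-! ### Composable moves between good diagrams -/

/-- The second diagram is good if the first one is, and they represent the same knot. -/
def Leads (w w' : GaussCode) : Prop := Good w → Good w' ∧ Equivalent w w'

theorem Leads.trans {w w' w'' : GaussCode} (h : Leads w w') (h' : Leads w' w'') : Leads w w'' :=
  fun hw => ⟨(h' (h hw).1).1, (h hw).2.trans _ _ _ (h' (h hw).1).2⟩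

theorem leads_of_step {w w' : GaussCode} (h : Good w → Good w') (hs : Step w w') : Leads w w' :=
  fun hw => ⟨h hw, .rel _ _ ⟨hw.isKnotDiagram, (h hw).isKnotDiagram, hs⟩⟩

theorem leads_rotate (u v : GaussCode) : Leads (u ++ v) (v ++ u) :=
  leads_of_step Good.rotate (.rotate u v)

/-- The base point may be changed before and after. -/
theorem leads_append_left {u v v' : GaussCode} (h : Leads (v ++ u) (v' ++ u)) :
    Leads (u ++ v) (u ++ v') :=
  ((leads_rotate u v).trans h).trans (leads_rotate v' u)

theorem leads_r1 (x : Letter) (u v : GaussCode) : Leads (u ++ ([x, x.partner] ++ v)) (u ++ v) := by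
  refine leads_append_left ?_
  rw [List.append_assoc]
  exact leads_of_step Good.r1 (.r1 _ _ _ _)

/-- Removal of a bigon; the strand that passes over is met first. -/
theorem leads_r2 (c d : ℕ) (s b : Bool) (u v w : GaussCode) :
    Leads (u ++ ([⟨c, true, s⟩, ⟨d, true, !s⟩] ++ (v ++ (inOrder b ⟨c, false, s⟩ ⟨d, false, !s⟩ ++ w))))
      (u ++ (v ++ w)) := by
  refine leads_append_left ?_
  have := leads_of_step Good.r2 (Step.r2 c d s b v (w ++ u))
  simpa only [List.append_assoc] using this

/-- Removal of a bigon; the strand that passes under is met first. -/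
theorem leads_r2' (c d : ℕ) (s b : Bool) (u v w : GaussCode) :
    Leads (u ++ (inOrder b ⟨c, false, s⟩ ⟨d, false, !s⟩ ++ (v ++ ([⟨c, true, s⟩, ⟨d, true, !s⟩] ++ w))))
      (u ++ (v ++ w)) := by
  have h1 := leads_rotate (u ++ (inOrder b ⟨c, false, s⟩ ⟨d, false, !s⟩ ++ v))
    ([⟨c, true, s⟩, ⟨d, true, !s⟩] ++ w)
  have h2 := leads_of_step Good.r2 (Step.r2 c d s b (w ++ u) v)
  have h3 := leads_rotate w (u ++ v)
  simp only [List.append_assoc] at h1 h2 h3 ⊢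
  exact (h1.trans h2).trans h3

theorem leads_r3 (a b c : ℕ) (sa sb sc x y z : Bool) (u v w t : GaussCode)
    (h₁ : (sa == y) = (sb == z)) (h₂ : (sc == y) = (sb == x)) :
    Leads (u ++ (botStrand z b c sb sc ++ (v ++ (topStrand x a b sa sb ++ (w ++
        (midStrand y a c sa sc ++ t))))))
      (u ++ (botStrand (!z) b c sb sc ++ (v ++ (topStrand (!x) a b sa sb ++ (w ++
        (midStrand (!y) a c sa sc ++ t)))))) := by
  have h1 := leads_rotate (u ++ (botStrand z b c sb sc ++ v)) (topStrand x a b sa sb ++ (w ++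
        (midStrand y a c sa sc ++ t)))
  have h2 := leads_of_step (Good.r3 h₁ h₂) (.r3 a b c sa sb sc x y z w (t ++ u) v h₁ h₂)
  have h3 := leads_rotate (topStrand (!x) a b sa sb ++ (w ++
        (midStrand (!y) a c sa sc ++ t))) (u ++ (botStrand (!z) b c sb sc ++ v))
  simp only [List.append_assoc] at h1 h2 h3 ⊢
  exact (h1.trans h2).trans h3

end GaussCode

/-! ### Building the matrix of a diagram crossing by crossing -/

/-- A symmetric matrix together with a vector: the square of the vector, its eigenvalue, and the
square of the matrix. -/
structure Spectrum (n : ℕ) (N : ℕ → ℕ → ZMod 2) (v : ℕ → ZMod 2) (a l g : ZMod 2) : Prop where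
  symm : ∀ c < n, ∀ d < n, N c d = N d c
  dot : ∑ c ∈ Finset.range n, v c * v c = a
  eigen : ∀ c < n, ∑ d ∈ Finset.range n, N c d * v d = l * v c
  square : ∀ c < n, ∀ d < n, ∑ e ∈ Finset.range n, N c e * N e d = N c d + g * (v c * v d)

/-- Enlarging the matrix by a multiple of the vector. -/
theorem Spectrum.succ {n : ℕ} {N N' : ℕ → ℕ → ZMod 2} {v v' : ℕ → ZMod 2} {a l g a' l' g' : ZMod 2}
    (h : Spectrum n N v a l g) (p q δ : ZMod 2) (hN : ∀ c < n, ∀ d < n, N' c d = N c d)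
    (hN₁ : ∀ c < n, N' c n = p * v c) (hN₂ : ∀ c < n, N' n c = p * v c) (hN₃ : N' n n = δ)
    (hv : ∀ c < n, v' c = v c) (hq : v' n = q) (h1 : a' = a + q) (h2 : l' = l + p * q)
    (h3 : p * a + δ * q = l' * q) (h4 : g' = g + p) (h5 : p * (l + δ + 1) = g' * q)
    (h6 : p * a = g' * q) : Spectrum (n + 1) N' v' a' l' g' := by
  have sq : ∀ x : ZMod 2, x * x = x := by decide
  have s1 : ∑ c ∈ Finset.range n, v' c * v' c = a := by
    rw [← h.dot]
    exact Finset.sum_congr rfl fun c hc => by rw [hv c (Finset.mem_range.1 hc)]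
  have s2 : ∀ c < n, ∑ d ∈ Finset.range n, N' c d * v' d = l * v c := fun c hc => by
    rw [← h.eigen c hc]
    exact Finset.sum_congr rfl fun d hd => by
      rw [hv d (Finset.mem_range.1 hd), hN c hc d (Finset.mem_range.1 hd)]
  have s3 : ∑ d ∈ Finset.range n, N' n d * v' d = p * a := by
    rw [← h.dot, Finset.mul_sum]
    exact Finset.sum_congr rfl fun d hd => by
      rw [hv d (Finset.mem_range.1 hd), hN₂ d (Finset.mem_range.1 hd), mul_assoc]
  have s4 : ∀ c < n, ∀ d < n, ∑ e ∈ Finset.range n, N' c e * N' e d = N c d + g * (v c * v d) :=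
    fun c hc d hd => by
      rw [← h.square c hc d hd]
      exact Finset.sum_congr rfl fun e he => by
        rw [hN c hc e (Finset.mem_range.1 he), hN e (Finset.mem_range.1 he) d hd]
  have s5 : ∀ c < n, ∑ e ∈ Finset.range n, N' c e * N' e n = p * (l * v c) := fun c hc => by
    rw [← h.eigen c hc, Finset.mul_sum]
    exact Finset.sum_congr rfl fun e he => by
      rw [hN c hc e (Finset.mem_range.1 he), hN₁ e (Finset.mem_range.1 he)]; ring
  have s6 : ∀ c < n, ∑ e ∈ Finset.range n, N' n e * N' e c = p * (l * v c) := fun c hc => by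
    rw [← s5 c hc]
    refine Finset.sum_congr rfl fun e he => ?_
    have he := Finset.mem_range.1 he
    rw [hN c hc e he, hN e he c hc, hN₁ e he, hN₂ e he, h.symm c hc e he, mul_comm]
  have s7 : ∑ e ∈ Finset.range n, N' n e * N' e n = p * a := by
    rw [← h.dot, Finset.mul_sum]
    refine Finset.sum_congr rfl fun e he => ?_
    have he := Finset.mem_range.1 he
    rw [hN₁ e he, hN₂ e he]
    linear_combination (v e * v e) * sq p
  refine ⟨?_, ?_, ?_, ?_⟩
  · intro c hc d hd
    rcases Nat.lt_succ_iff_lt_or_eq.1 hc with hc | rfl <;>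
      rcases Nat.lt_succ_iff_lt_or_eq.1 hd with hd | rfl
    · rw [hN c hc d hd, hN d hd c hc, h.symm c hc d hd]
    · rw [hN₁ c hc, hN₂ c hc]
    · rw [hN₁ d hd, hN₂ d hd]
    · rfl
  · rw [Finset.sum_range_succ, s1, hq, h1, sq]
  · intro c hc
    rw [Finset.sum_range_succ, hq]
    rcases Nat.lt_succ_iff_lt_or_eq.1 hc with hc | rfl
    · rw [s2 c hc, hN₁ c hc, hv c hc, h2]; ring
    · rw [s3, hN₃, hq, h3]
  · intro c hc d hd
    rw [Finset.sum_range_succ]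
    rcases Nat.lt_succ_iff_lt_or_eq.1 hc with hc | rfl <;>
      rcases Nat.lt_succ_iff_lt_or_eq.1 hd with hd | rfl
    · rw [s4 c hc d hd, hN₁ c hc, hN₂ d hd, hN c hc d hd, hv c hc, hv d hd, h4]
      linear_combination (v c * v d) * sq p
    · rw [s5 c hc, hN₁ c hc, hN₃, hv c hc, hq]
      generalize v c = x at *
      clear * - h5
      revert p l δ g' q x
      decide
    · rw [s6 d hd, hN₂ d hd, hN₃, hv d hd, hq]
      generalize v d = x at *
      clear * - h5
      revert p l δ g' q x
      decide
    · rw [s7, hN₃, hq, sq δ, sq q, h6]; ring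

namespace GaussCode

theorem Spectrum.proj {w : GaussCode} {n : ℕ} (hl : labels w = Finset.range n) {ε v : ℕ → ZMod 2}
    {a l : ZMod 2} (h : Spectrum n (withDiag (beta w) ε) v a l 0) :
    Proj (labels w) (withDiag (beta w) ε) := by
  rw [hl]
  intro c hc d hd
  rw [h.square c (Finset.mem_range.1 hc) d (Finset.mem_range.1 hd), zero_mul, add_zero]

/-- The diagram closed up from the region `r` after `n` crossings: `A` is the active strand, `X` the
straight strand together with the left side of the neck loop, and `Y` the right side. -/
structure Inv (n : ℕ) (r : Region) (ε : ℕ → ZMod 2) (A X Y : GaussCode) : Prop where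
  wellFormed : WellFormed (A ++ (X ++ Y))
  labels_eq : labels (A ++ (X ++ Y)) = Finset.range n
  length_left : A.length = n
  length_right : X.length + Y.length = n
  parity : (X.length : ZMod 2) = if r = .L then 1 else 0
  par_active : Par ε 0 A
  par_left : Par ε (n + if r = .C then 1 else 0) X
  par_right : Par ε Y.length Y
  spectrum : Spectrum n (withDiag (beta (A ++ (X ++ Y))) ε) (tot X) (if r = .L then 1 else 0)
    (n + if r = .R then 0 else 1) (if r = .C then 1 else 0)

theorem inv_nil (ε : ℕ → ZMod 2) : Inv 0 .R ε [] [] [] where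
  wellFormed := wellFormed_nil
  labels_eq := rfl
  length_left := rfl
  length_right := rfl
  parity := by simp
  par_active := trivial
  par_left := trivial
  par_right := trivial
  spectrum := ⟨by simp, by simp, by simp, by simp⟩

/-- Outside the center the defect of the square in `spectrum` is zero and the parities of `X` are
not shifted. In the center both fail, and the active strand cannot be closed up there. -/
theorem Inv.par_proj {n : ℕ} {r : Region} {ε : ℕ → ZMod 2} {A X Y : GaussCode}
    (h : Inv n r ε A X Y) (hr : r ≠ .C) : Par ε 0 (A ++ (X ++ Y)) ∧
      Proj (labels (A ++ (X ++ Y))) (withDiag (beta (A ++ (X ++ Y))) ε) := by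
  have hl : (X.length : ZMod 2) + Y.length = n := by
    rw [← Nat.cast_add, h.length_right]
  refine ⟨?_, ?_⟩
  · simp only [par_append, h.length_left]
    have h1 := h.par_left
    rw [if_neg hr, add_zero] at h1
    refine ⟨h.par_active, by rwa [zero_add], ?_⟩
    rw [zero_add, ← hl, show (X.length : ZMod 2) + Y.length + X.length = Y.length by grind]
    exact h.par_right
  · have := h.spectrum
    rw [if_neg hr] at this
    exact Spectrum.proj h.labels_eq this

theorem Inv.good {n : ℕ} {r : Region} {ε : ℕ → ZMod 2} {A X Y : GaussCode} (h : Inv n r ε A X Y)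
    (hr : r ≠ .C) : Good (A ++ (X ++ Y)) :=
  ⟨h.wellFormed, ε, h.par_proj hr⟩

theorem par_snoc {ε : ℕ → ZMod 2} {k : ZMod 2} {w : GaussCode} {x : Letter} :
    Par ε k (w ++ [x]) ↔ Par ε k w ∧ bz (tau x) + (k + w.length) = ε x.label := by
  simp [par_append, Par]

theorem Inv.notMem {n : ℕ} {r : Region} {ε : ℕ → ZMod 2} {A X Y : GaussCode} (h : Inv n r ε A X Y) :
    (∀ c, n ≤ c → c ∉ labels A) ∧ (∀ c, n ≤ c → c ∉ labels X) ∧ ∀ c, n ≤ c → c ∉ labels Y := by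
  have : ∀ c, n ≤ c → c ∉ labels (A ++ (X ++ Y)) := fun c hc => by
    rw [h.labels_eq]; simpa using hc
  simp only [labels_append, Finset.mem_union, not_or] at this
  exact ⟨fun c hc => (this c hc).1, fun c hc => (this c hc).2.1, fun c hc => (this c hc).2.2⟩

/-- Adding a crossing on the straight strand. -/
theorem Inv.straight {n : ℕ} {r r' : Region} {ε ε' : ℕ → ZMod 2} {A X Y : GaussCode} {e : Letter}
    (h : Inv n r ε A X Y) (hr : r ≠ .C) (hr' : r' ≠ .C) (hrr : r ≠ r') (he : e.label = n)
    (ht : tau e = (r' == .R)) (hε : ∀ c < n, ε' c = ε c) (hn : ε' n = bz (tau e) + n) :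
    Inv (n + 1) r' ε' (A ++ [e]) (e.partner :: X) Y := by
  obtain ⟨hA, hX, hY⟩ := h.notMem
  have hpe : e.partner.label = n := he
  have congr : ∀ {k w}, (∀ c, n ≤ c → c ∉ labels w) → Par ε k w → Par ε' k w :=
    fun hw hp => hp.congr fun c hc => hε c (by by_contra hc'; exact hw c (by omega) hc)
  have hperm : (e :: e.partner :: (A ++ (X ++ Y))).Perm (A ++ [e] ++ (e.partner :: X ++ Y)) := by
    rw [← Multiset.coe_eq_coe]
    simp only [← Multiset.coe_add, ← Multiset.cons_coe, ← Multiset.singleton_add, Multiset.coe_nil]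
    abel
  have hw' := (h.wellFormed.cons (x := e) (by rw [he, h.labels_eq]; simp)).perm hperm
  have hr1 : r = .L ∧ r' = .R ∨ r = .R ∧ r' = .L := by cases r <;> cases r' <;> simp_all
  have two : (1 : ZMod 2) + 1 = 0 := rfl
  have ne : ∀ c < n, n ≠ c := fun c hc => by omega
  constructor
  · exact hw'
  · rw [← labels_perm hperm]
    simp only [labels_cons, hpe, he, h.labels_eq, Finset.insert_idem, Finset.range_add_one]
  · simp [h.length_left]
  · simp only [List.length_cons]; have := h.length_right; omega
  · have := h.parity
    rw [List.length_cons, Nat.cast_add, this, Nat.cast_one]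
    rcases hr1 with ⟨rfl, rfl⟩ | ⟨rfl, rfl⟩ <;> decide
  · rw [par_snoc]
    refine ⟨congr hA h.par_active, ?_⟩
    rw [he, hn, h.length_left, zero_add]
  · have h1 := congr hX h.par_left
    rw [if_neg hr] at h1
    refine ⟨?_, ?_⟩
    · rw [hpe, hn, tau_partner, if_neg hr']
      push_cast
      generalize (n : ZMod 2) = k
      generalize tau e = b
      clear * -
      revert b k
      decide
    · rw [if_neg hr']
      convert h1 using 1
      push_cast
      grind
  · exact congr hY h.par_right
  -- The two passages of the new crossing are adjacent, so it is isolated (`p = 0`), and it lies on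
  -- `X` (`q = 1`).
  · refine h.spectrum.succ 0 1 (bz (tau e) + n) ?_ ?_ ?_ ?_ ?_ ?_ ?_ ?_ ?_ ?_ ?_ ?_
    · intro c hc d hd
      by_cases hcd : c = d
      · simp [withDiag, hcd, hε d hd]
      · simp [withDiag, hcd, he, hpe, ne c hc, ne d hd]
    · intro c hc
      simp [withDiag, he, hpe, ne c hc, (ne c hc).symm, beta_eq_zero_right (hA n le_rfl),
        beta_eq_zero_right (hX n le_rfl), beta_eq_zero_right (hY n le_rfl), tot_eq_zero (hX n le_rfl),
        tot_eq_zero (hY n le_rfl)]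
      grind
    · intro c hc
      simp [withDiag, he, hpe, ne c hc, (ne c hc).symm, beta_eq_zero_left (hA n le_rfl),
        beta_eq_zero_left (hX n le_rfl), beta_eq_zero_left (hY n le_rfl), tot_eq_zero (hX n le_rfl),
        tot_eq_zero (hA n le_rfl)]
      grind
    · simp [withDiag, hn]
    · intro c hc; simp [hpe, ne c hc]
    · simp [hpe, tot_eq_zero (hX n le_rfl)]
    all_goals
      try rw [ht]
      push_cast
      generalize (n : ZMod 2) = k
      rcases hr1 with ⟨rfl, rfl⟩ | ⟨rfl, rfl⟩ <;> revert k <;> decide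

/-- Adding a crossing on the left or right side of the neck loop. -/
theorem Inv.loop {n : ℕ} {r r' : Region} {ε ε' : ℕ → ZMod 2} {A X Y : GaussCode} {e : Letter}
    (h : Inv n r ε A X Y) (he : e.label = n) (hrr : r = .C ↔ r' ≠ .C)
    (ht : tau e = (r' == .C)) (hε : ∀ c < n, ε' c = ε c) (hn : ε' n = bz (tau e) + n) :
    (r = .L ∨ r' = .L → Inv (n + 1) r' ε' (A ++ [e]) (X ++ [e.partner]) Y) ∧
    (r = .R ∨ r' = .R → Inv (n + 1) r' ε' (A ++ [e]) X (e.partner :: Y)) := by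
  obtain ⟨hA, hX, hY⟩ := h.notMem
  have hpe : e.partner.label = n := he
  have congr : ∀ {k w}, (∀ c, n ≤ c → c ∉ labels w) → Par ε k w → Par ε' k w :=
    fun hw hp => hp.congr fun c hc => hε c (by by_contra hc'; exact hw c (by omega) hc)
  have hperm : (e :: e.partner :: (A ++ (X ++ Y))).Perm (A ++ [e] ++ (X ++ [e.partner] ++ Y)) := by
    rw [← Multiset.coe_eq_coe]
    simp only [← Multiset.coe_add, ← Multiset.cons_coe, ← Multiset.singleton_add, Multiset.coe_nil]
    abel
  have hw' := (h.wellFormed.cons (x := e) (by rw [he, h.labels_eq]; simp)).perm hperm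
  have two : (1 : ZMod 2) + 1 = 0 := rfl
  have ne : ∀ c < n, n ≠ c := fun c hc => by omega
  have hl : labels (A ++ [e] ++ (X ++ [e.partner] ++ Y)) = Finset.range (n + 1) := by
    rw [← labels_perm hperm]
    simp only [labels_cons, hpe, he, h.labels_eq, Finset.insert_idem, Finset.range_add_one]
  have hpar : (X.length : ZMod 2) + Y.length = n := by rw [← Nat.cast_add, h.length_right]
  have hparX := h.parity
  have hX1 := congr hX h.par_left
  have hY1 := congr hY h.par_right
  have hA1 : Par ε' 0 (A ++ [e]) := by
    rw [par_snoc]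
    refine ⟨congr hA h.par_active, ?_⟩
    rw [he, hn, h.length_left, zero_add]
  have n1 : ∀ c < n, ∀ d < n, withDiag (beta (A ++ [e] ++ (X ++ [e.partner] ++ Y))) ε' c d =
      withDiag (beta (A ++ (X ++ Y))) ε c d := by
    intro c hc d hd
    by_cases hcd : c = d
    · simp [withDiag, hcd, hε d hd]
    · simp [withDiag, hcd, he, hpe, ne c hc, ne d hd]
  have n2 : ∀ c < n, withDiag (beta (A ++ [e] ++ (X ++ [e.partner] ++ Y))) ε' c n = tot X c := by
    intro c hc
    simp [withDiag, he, hpe, ne c hc, (ne c hc).symm, beta_eq_zero_right (hA n le_rfl),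
        beta_eq_zero_right (hX n le_rfl), beta_eq_zero_right (hY n le_rfl), tot_eq_zero (hX n le_rfl),
        tot_eq_zero (hY n le_rfl)]
    grind
  have n3 : ∀ c < n, withDiag (beta (A ++ [e] ++ (X ++ [e.partner] ++ Y))) ε' n c = tot X c := by
    intro c hc
    rw [← n2 c hc, withDiag, withDiag, if_neg (ne c hc), if_neg (ne c hc).symm,
      beta_comm hw'.tot_eq (ne c hc)]
  have n4 : withDiag (beta (A ++ [e] ++ (X ++ [e.partner] ++ Y))) ε' n n = bz (tau e) + n := by
    simp [withDiag, hn]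
  constructor
  · intro hL
    have hr1 : r = .L ∧ r' = .C ∨ r = .C ∧ r' = .L := by
      clear * - hL hrr
      cases r <;> cases r' <;> simp_all
    constructor
    · exact hw'
    · exact hl
    · simp [h.length_left]
    · simp only [List.length_append, List.length_singleton]; have := h.length_right; omega
    · rw [List.length_append, Nat.cast_add, hparX, List.length_singleton]
      rcases hr1 with ⟨rfl, rfl⟩ | ⟨rfl, rfl⟩ <;> decide
    · exact hA1
    · rw [par_snoc]
      refine ⟨?_, ?_⟩
      · convert hX1 using 1
        push_cast
        generalize (n : ZMod 2) = k
        rcases hr1 with ⟨rfl, rfl⟩ | ⟨rfl, rfl⟩ <;> revert k <;> decide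
      · rw [hpe, hn, tau_partner, hparX]
        push_cast
        generalize (n : ZMod 2) = k
        generalize tau e = b
        clear * - hr1
        rcases hr1 with ⟨rfl, rfl⟩ | ⟨rfl, rfl⟩ <;> revert b k <;> decide
    · exact hY1
    -- Precisely `X` lies between the two passages, so the new row is the vector of `X` (`p = 1`);
    -- on the left side the crossing joins `X` (`q = 1`).
    · refine h.spectrum.succ 1 1 (bz (tau e) + n) n1 ?_ ?_ n4 ?_ ?_ ?_ ?_ ?_ ?_ ?_ ?_
      · simpa using n2
      · simpa using n3
      · intro c hc; simp [hpe, ne c hc]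
      · simp [hpe, tot_eq_zero (hX n le_rfl)]
      all_goals
        try rw [ht]
        push_cast
        generalize (n : ZMod 2) = k
        rcases hr1 with ⟨rfl, rfl⟩ | ⟨rfl, rfl⟩ <;> revert k <;> decide
  · intro hR
    have hr1 : r = .R ∧ r' = .C ∨ r = .C ∧ r' = .R := by
      clear * - hR hrr
      cases r <;> cases r' <;> simp_all
    have hlist : A ++ [e] ++ (X ++ e.partner :: Y) = A ++ [e] ++ (X ++ [e.partner] ++ Y) := by simp
    constructor
    · rwa [hlist]
    · rwa [hlist]
    · simp [h.length_left]
    · simp only [List.length_cons]; have := h.length_right; omega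
    · rw [hparX]
      rcases hr1 with ⟨rfl, rfl⟩ | ⟨rfl, rfl⟩ <;> decide
    · exact hA1
    · convert hX1 using 1
      push_cast
      generalize (n : ZMod 2) = k
      rcases hr1 with ⟨rfl, rfl⟩ | ⟨rfl, rfl⟩ <;> revert k <;> decide
    · have hY0 : (Y.length : ZMod 2) = n := by
        rw [← hpar, hparX]
        rcases hr1 with ⟨rfl, rfl⟩ | ⟨rfl, rfl⟩ <;> simp
      refine ⟨?_, ?_⟩
      · rw [hpe, hn, tau_partner, List.length_cons, Nat.cast_add, hY0]
        push_cast
        generalize (n : ZMod 2) = k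
        generalize tau e = b
        clear * -
        revert b k
        decide
      · convert hY1 using 1
        rw [List.length_cons]
        push_cast
        clear * -
        grind
    · rw [hlist]
      -- The code is the same as for the left side, but now the crossing belongs to `Y`, so `q = 0`.
      refine h.spectrum.succ 1 0 (bz (tau e) + n) n1 ?_ ?_ n4 ?_ ?_ ?_ ?_ ?_ ?_ ?_ ?_
      · simpa using n2
      · simpa using n3
      · intro c hc; rfl
      · simp [tot_eq_zero (hX n le_rfl)]
      all_goals
        try rw [ht]
        push_cast
        generalize (n : ZMod 2) = k
        rcases hr1 with ⟨rfl, rfl⟩ | ⟨rfl, rfl⟩ <;> revert k <;> decide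

end GaussCode

/-! ### The diagrams of lists of moves -/

/-- The region in which a list of moves ends. -/
def endRegion (r : Region) (ms : List Move) : Region := ((ms.getLast?).map Move.region).getD r

@[simp] theorem endRegion_nil (r : Region) : endRegion r [] = r := rfl

@[simp] theorem endRegion_concat (r : Region) (ms : List Move) (m : Move) :
    endRegion r (ms ++ [m]) = m.region := by
  simp [endRegion]

theorem crossingsFrom_append (n : ℕ) (r : Region) (ms : List Move) (m : Move) :
    crossingsFrom n r (ms ++ [m]) =
      crossingsFrom n r ms ++ [⟨n + ms.length, endRegion r ms, m.region, m.dir⟩] := by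
  induction ms generalizing n r with
  | nil => rfl
  | cons a ms ih =>
    have : endRegion a.region ms = endRegion r (a :: ms) := by
      cases ms <;> simp [endRegion, List.getLast?_cons]
    rw [List.cons_append, crossingsFrom, ih, crossingsFrom, List.cons_append, List.length_cons,
      show n + 1 + ms.length = n + (ms.length + 1) by omega, this]

/-- The last crossing of a nonempty list of moves. -/
def lastCrossing (ms : List Move) (m : Move) : Crossing :=
  ⟨ms.length, endRegion .R ms, m.region, m.dir⟩

theorem crossings_append (ms : List Move) (m : Move) :
    crossings (ms ++ [m]) = crossings ms ++ [lastCrossing ms m] := by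
  rw [crossings, crossingsFrom_append, zero_add]; rfl

theorem Crossing.passive_eq (c : Crossing) : c.passive = c.active.partner := by
  obtain ⟨n, s, d, _ | _⟩ := c <;> rfl

theorem Crossing.tau_active (c : Crossing) : GaussCode.tau c.active = c.turn := by
  obtain ⟨n, s, d, x⟩ := c
  simp only [GaussCode.tau, active, positive]
  generalize (Crossing.mk n s d x).turn = t
  cases x <;> cases t <;> rfl

/-- The active strand. -/
def activeCode (ms : List Move) : GaussCode := (crossings ms).map Crossing.active

/-- The straight strand and the left side of the neck loop. -/
def leftCode (ms : List Move) : GaussCode :=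
  (onPart .straight (crossings ms)).reverse ++ onPart .left (crossings ms)

/-- The right side of the neck loop. -/
def rightCode (ms : List Move) : GaussCode := (onPart .right (crossings ms)).reverse

theorem openDiagram_eq (ms : List Move) :
    openDiagram ms = activeCode ms ++ (leftCode ms ++ rightCode ms) := rfl

theorem activeCode_append (ms : List Move) (m : Move) :
    activeCode (ms ++ [m]) = activeCode ms ++ [(lastCrossing ms m).active] := by
  simp [activeCode, crossings_append]

theorem codes_straight {ms : List Move} {m : Move} (h : (lastCrossing ms m).part = .straight) :
    leftCode (ms ++ [m]) = (lastCrossing ms m).active.partner :: leftCode ms ∧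
      rightCode (ms ++ [m]) = rightCode ms := by
  simp [leftCode, rightCode, crossings_append, onPart, h, Crossing.passive_eq]

theorem codes_left {ms : List Move} {m : Move} (h : (lastCrossing ms m).part = .left) :
    leftCode (ms ++ [m]) = leftCode ms ++ [(lastCrossing ms m).active.partner] ∧
      rightCode (ms ++ [m]) = rightCode ms := by
  simp [leftCode, rightCode, crossings_append, onPart, h, Crossing.passive_eq]

theorem codes_right {ms : List Move} {m : Move} (h : (lastCrossing ms m).part = .right) :
    leftCode (ms ++ [m]) = leftCode ms ∧
      rightCode (ms ++ [m]) = (lastCrossing ms m).active.partner :: rightCode ms := by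
  simp [leftCode, rightCode, crossings_append, onPart, h, Crossing.passive_eq]

/-- Consecutive regions differ, starting from the right. -/
def RegionChain (ms : List Move) : Prop :=
  (Region.R :: ms.map Move.region).IsChain (· ≠ ·)

theorem regionChain_append {ms : List Move} {m : Move} :
    RegionChain (ms ++ [m]) ↔ RegionChain ms ∧ endRegion .R ms ≠ m.region := by
  rw [RegionChain, List.map_append, ← List.cons_append, List.isChain_append]
  have : (Region.R :: ms.map Move.region).getLast? = some (endRegion .R ms) := by
    rw [List.getLast?_cons, endRegion, List.getLast?_map]
  simp [this, RegionChain]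

open GaussCode

/-- The value of `ε` at a new crossing is dictated by its passage on the active strand. Directions
play no role, only the regions do. -/
theorem exists_inv {ms : List Move} (h : RegionChain ms) : ∃ ε,
    Inv ms.length (endRegion .R ms) ε (activeCode ms) (leftCode ms) (rightCode ms) := by
  induction ms using List.reverseRecOn with
  | nil => exact ⟨0, inv_nil 0⟩
  | append_singleton ms m ih =>
    obtain ⟨h, hr⟩ := regionChain_append.1 h
    obtain ⟨ε, ih⟩ := ih h
    refine ⟨Function.update ε ms.length (bz (tau (lastCrossing ms m).active) + ms.length), ?_⟩
    rw [endRegion_concat, activeCode_append, List.length_append, List.length_singleton]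
    have h1 : ∀ c < ms.length, Function.update ε ms.length
        (bz (tau (lastCrossing ms m).active) + ms.length) c = ε c :=
      fun c hc => Function.update_of_ne hc.ne _ _
    have h2 := Function.update_self ms.length (bz (tau (lastCrossing ms m).active) + ms.length) ε
    have h3 := (lastCrossing ms m).tau_active
    have key : (lastCrossing ms m).part = (if endRegion .R ms ≠ .C ∧ m.region ≠ .C then .straight
      else if endRegion .R ms = .L ∨ m.region = .L then .left else .right) := rfl
    by_cases hs : endRegion .R ms ≠ .C ∧ m.region ≠ .C
    · rw [if_pos hs] at key
      rw [(codes_straight key).1, (codes_straight key).2]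
      refine ih.straight hs.1 hs.2 hr rfl ?_ h1 h2
      rw [h3, Crossing.turn, key]; rfl
    · rw [if_neg hs] at key
      have hl := fun ht => ih.loop (e := (lastCrossing ms m).active) (r' := m.region) rfl (by
        generalize endRegion .R ms = a at *
        generalize m.region = b at *
        clear * - hr hs
        revert hr hs
        cases a <;> cases b <;> simp) ht h1 h2
      by_cases hL : endRegion .R ms = .L ∨ m.region = .L
      · rw [if_pos hL] at key
        rw [(codes_left key).1, (codes_left key).2]
        refine (hl ?_).1 hL
        rw [h3, Crossing.turn, key]; rfl
      · rw [if_neg hL] at key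
        rw [(codes_right key).1, (codes_right key).2]
        refine (hl ?_).2 ?_
        · rw [h3, Crossing.turn, key]; rfl
        · generalize endRegion .R ms = a at *
          generalize m.region = b at *
          clear * - hr hs hL
          revert hr hs hL
          cases a <;> cases b <;> simp

theorem good_openDiagram {ms : List Move} (h : RegionChain ms) (hr : endRegion .R ms ≠ .C) :
    Good (openDiagram ms) := by
  obtain ⟨ε, hε⟩ := exists_inv h
  exact hε.good hr

/-- The last crossing on the straight strand is the lowest one, next to the end of the active
strand, hence a kink. -/
theorem leads_straight {ms : List Move} {m : Move} (h : endRegion .R ms ≠ .C)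
    (h' : m.region ≠ .C) : Leads (openDiagram (ms ++ [m])) (openDiagram ms) := by
  have key : (lastCrossing ms m).part = .straight := if_pos ⟨h, h'⟩
  rw [openDiagram_eq, openDiagram_eq, (codes_straight key).1, (codes_straight key).2,
    activeCode_append]
  simpa using leads_r1 (lastCrossing ms m).active (activeCode ms) (leftCode ms ++ rightCode ms)

/-! ### Planarity of tuck diagrams -/

namespace GaussCode

/-- Adding the two crossings of a tuck. -/
theorem Good.tuck {A E Z : GaussCode} {x y : Letter} {ε : ℕ → ZMod 2} {δ : ZMod 2}
    (hw : WellFormed (A ++ (E ++ Z))) (hε : Par ε 0 (A ++ (E ++ Z)))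
    (hp : Proj (labels (A ++ (E ++ Z))) (withDiag (beta (A ++ (E ++ Z))) ε))
    (hx : x.label ∉ labels (A ++ (E ++ Z))) (hy : y.label ∉ labels (A ++ (E ++ Z)))
    (hxy : x.label ≠ y.label) (hE : (E.length : ZMod 2) = 1)
    (hu : ∑ c ∈ labels (A ++ (E ++ Z)), tot E c * tot E c = 1)
    (hN : ∀ c ∈ labels (A ++ (E ++ Z)), ∑ e ∈ labels (A ++ (E ++ Z)),
      withDiag (beta (A ++ (E ++ Z))) ε c e * tot E e = δ * tot E c)
    (hδx : bz (tau x.partner) + A.length = δ) (hδy : bz (tau y.partner) + (A.length + 1) = δ) :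
    Good (A ++ ([x.partner, y.partner] ++ (E ++ ([x, y] ++ Z)))) := by
  have two : (1 : ZMod 2) + 1 = 0 := rfl
  set w := A ++ (E ++ Z) with hwdef
  have hperm : (x :: x.partner :: y :: y.partner :: w).Perm
      (A ++ ([x.partner, y.partner] ++ (E ++ ([x, y] ++ Z)))) := by
    rw [hwdef, ← Multiset.coe_eq_coe]
    simp only [← Multiset.coe_add, ← Multiset.cons_coe, ← Multiset.singleton_add, Multiset.coe_nil]
    abel
  have hw' := ((hw.cons hy).cons (x := x) (by simpa [hxy, Letter.partner] using hx)).perm hperm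
  have hl : labels (A ++ ([x.partner, y.partner] ++ (E ++ ([x, y] ++ Z)))) =
      insert x.label (insert y.label (labels w)) := by
    rw [← labels_perm hperm]; simp [Letter.partner]
  have hpx : x.partner.label = x.label := rfl
  have hpy : y.partner.label = y.label := rfl
  have hxs := hx
  have hys := hy
  simp only [hwdef, labels_append, Finset.mem_union, not_or] at hxs hys
  have nex : ∀ c ∈ labels w, x.label ≠ c := fun c hc h => hx (h ▸ hc)
  have ney : ∀ c ∈ labels w, y.label ≠ c := fun c hc h => hy (h ▸ hc)
  refine ⟨hw', fun c => if c = x.label ∨ c = y.label then δ else ε c, ?_, ?_⟩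
  · simp only [hwdef, par_append] at hε
    simp only [par_append, Par, hpx, hpy, if_true, or_true, true_or, and_true]
    have tr : ∀ {k u}, x.label ∉ labels u → y.label ∉ labels u → Par ε k u →
        Par (fun c => if c = x.label ∨ c = y.label then δ else ε c) k u := by
      intro k u hx hy hp
      refine hp.congr fun c hc => if_neg ?_
      rintro (rfl | rfl) <;> contradiction
    refine ⟨tr hxs.1 hys.1 hε.1, ⟨?_, ?_⟩, ?_, ⟨?_, ?_⟩, ?_⟩
    · rw [← hδx]; ring
    · rw [← hδy]; ring
    · convert tr hxs.2.1 hys.2.1 hε.2.1 using 1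
      simp only [List.length_cons, List.length_nil]
      push_cast
      grind
    · rw [← hδx, tau_partner, hE]
      simp only [List.length_cons, List.length_nil]
      push_cast
      generalize (A.length : ZMod 2) = a
      generalize tau x = t
      clear * -
      revert a t
      decide
    · rw [← hδy, tau_partner, hE]
      simp only [List.length_cons, List.length_nil]
      push_cast
      generalize (A.length : ZMod 2) = a
      generalize tau y = t
      clear * -
      revert a t
      decide
    · convert tr hxs.2.2 hys.2.2 hε.2.2 using 1
      simp only [List.length_cons, List.length_nil]
      push_cast
      grind
  · rw [hl]
    set N' := withDiag (beta (A ++ ([x.partner, y.partner] ++ (E ++ ([x, y] ++ Z)))))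
      (fun c => if c = x.label ∨ c = y.label then δ else ε c) with hN'
    have b1 : ∀ c ∈ labels w, ∀ d ∈ labels w, N' c d = withDiag (beta w) ε c d := by
      intro c hc d hd
      by_cases hcd : c = d
      · simp [hN', withDiag, hcd, (nex d hd).symm, (ney d hd).symm]
      · simp [hN', withDiag, hcd, hwdef, hpx, hpy, nex c hc, ney c hc, nex d hd, ney d hd]
    have b2 : ∀ c ∈ labels w, N' x.label c = tot E c := by
      intro c hc
      simp [hN', withDiag, hpx, hpy, nex c hc, ney c hc, hxy, hxy.symm, beta_eq_zero_left hxs.1,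
        beta_eq_zero_left hxs.2.1, beta_eq_zero_left hxs.2.2, tot_eq_zero hxs.1,
        tot_eq_zero hxs.2.1, tot_eq_zero hxs.2.2]
      grind
    have b3 : ∀ c ∈ labels w, N' y.label c = tot E c := by
      intro c hc
      simp [hN', withDiag, hpx, hpy, nex c hc, ney c hc, hxy, hxy.symm, beta_eq_zero_left hys.1,
        beta_eq_zero_left hys.2.1, beta_eq_zero_left hys.2.2, tot_eq_zero hys.1,
        tot_eq_zero hys.2.1, tot_eq_zero hys.2.2]
      grind
    have b4 : N' x.label y.label = 1 := by
      simp [hN', withDiag, hpx, hpy, hxy, hxy.symm, beta_eq_zero_left hxs.1,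
        beta_eq_zero_left hxs.2.1, beta_eq_zero_left hxs.2.2, tot_eq_zero hxs.1,
        tot_eq_zero hxs.2.1, tot_eq_zero hxs.2.2, tot_eq_zero hys.1,
        tot_eq_zero hys.2.1, tot_eq_zero hys.2.2, two]
    have sym : ∀ c d, N' c d = N' d c := by
      intro c d
      by_cases hcd : c = d
      · rw [hcd]
      · rw [hN', withDiag, withDiag, if_neg hcd, if_neg (Ne.symm hcd), beta_comm hw'.tot_eq hcd]
    have b5 : N' x.label x.label = δ := by simp [hN', withDiag]
    have b6 : N' y.label y.label = δ := by simp [hN', withDiag]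
    have b7 : ∀ c ∈ labels w, N' c x.label = tot E c := fun c hc => by rw [sym, b2 c hc]
    have b8 : ∀ c ∈ labels w, N' c y.label = tot E c := fun c hc => by rw [sym, b3 c hc]
    have b9 : N' y.label x.label = 1 := by rw [sym, b4]
    have s1 : ∀ c ∈ labels w, ∑ e ∈ labels w, N' c e * tot E e = δ * tot E c := fun c hc => by
      rw [← hN c hc]
      exact Finset.sum_congr rfl fun e he => by rw [b1 c hc e he]
    have s2 : ∀ c ∈ labels w, ∑ e ∈ labels w, tot E e * N' e c = δ * tot E c := fun c hc => by
      rw [← s1 c hc]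
      exact Finset.sum_congr rfl fun e he => by rw [sym, mul_comm]
    have sq : ∀ a : ZMod 2, a * a = a := by decide
    have h0 : x.label ∉ insert y.label (labels w) := by simpa [hxy] using hx
    intro c hc d hd
    rw [Finset.sum_insert h0, Finset.sum_insert hy]
    have t1 : ∀ c ∈ labels w, ∀ d ∈ labels w, ∑ e ∈ labels w, N' c e * N' e d = N' c d := by
      intro c hc d hd
      rw [b1 c hc d hd, ← hp c hc d hd]
      exact Finset.sum_congr rfl fun e he => by rw [b1 c hc e he, b1 e he d hd]
    have t2 : ∀ z, (∀ e ∈ labels w, N' e z = tot E e) → ∀ c ∈ labels w,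
        ∑ e ∈ labels w, N' c e * N' e z = δ * tot E c := fun z hz c hc => by
      rw [← s1 c hc]; exact Finset.sum_congr rfl fun e he => by rw [hz e he]
    have t3 : ∀ z, (∀ e ∈ labels w, N' z e = tot E e) → ∀ c ∈ labels w,
        ∑ e ∈ labels w, N' z e * N' e c = δ * tot E c := fun z hz c hc => by
      rw [← s2 c hc]; exact Finset.sum_congr rfl fun e he => by rw [hz e he]
    have t4 : ∀ z z', (∀ e ∈ labels w, N' z e = tot E e) → (∀ e ∈ labels w, N' e z' = tot E e) →
        ∑ e ∈ labels w, N' z e * N' e z' = 1 := fun z z' hz hz' => by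
      rw [← hu]; exact Finset.sum_congr rfl fun e he => by rw [hz e he, hz' e he]
    simp only [Finset.mem_insert] at hc hd
    -- The two new rows equal `u = tot E` on the old crossings, with mutual entry `1` and diagonal
    -- `δ`. Old entries gain `u c * u d` twice; the remaining entries are right because `u` has norm
    -- `1` and eigenvalue `δ`.
    rcases hc with rfl | rfl | hc <;> rcases hd with rfl | rfl | hd
    · rw [t4 _ _ b2 b7, b5, b4, b9]; linear_combination sq δ + two
    · rw [t4 _ _ b2 b8, b5, b4, b6]; grind
    · rw [t3 _ b2 d hd, b5, b4, b2 d hd, b3 d hd]; grind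
    · rw [t4 _ _ b3 b7, b6, b5, b9]; grind
    · rw [t4 _ _ b3 b8, b6, b4, b9]; linear_combination sq δ + two
    · rw [t3 _ b3 d hd, b6, b9, b2 d hd, b3 d hd]; grind
    · rw [t2 _ b7 c hc, b5, b9, b7 c hc, b8 c hc]; grind
    · rw [t2 _ b8 c hc, b6, b4, b7 c hc, b8 c hc]; grind
    · rw [t1 c hc d hd, b7 c hc, b8 c hc, b2 d hd, b3 d hd]; grind

end GaussCode

/-- The word of a tuck diagram; `b` tells whether the tuck is on the right. -/
theorem Good.tuck_of_good {A X Y : GaussCode} {l o t x y : Letter} {b : Bool}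
    (h : Good (A ++ ([l, o, t] ++ (l.partner :: (X ++ (inOrder b o.partner t.partner ++ Y))))))
    (hx : x.label ∉ labels (A ++ ([l, o, t] ++ (l.partner :: (X ++ (inOrder b o.partner t.partner ++ Y))))))
    (hy : y.label ∉ labels (A ++ ([l, o, t] ++ (l.partner :: (X ++ (inOrder b o.partner t.partner ++ Y))))))
    (hxy : x.label ≠ y.label) (hl : tau l = !b) (ho : tau o = true) (ht : tau t = false)
    (hx' : tau x = b) (hy' : tau y = !b) :
    Good (A ++ ([x.partner, y.partner] ++ ([l, o, t] ++ ([x, y] ++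
      (l.partner :: (X ++ (inOrder b o.partner t.partner ++ Y))))))) := by
  have two : (1 : ZMod 2) + 1 = 0 := rfl
  obtain ⟨hw, ε, hε, hp⟩ := h
  have hperm : (A ++ ([l, o, t] ++ (l.partner :: (X ++ (inOrder b o.partner t.partner ++ Y))))).Perm
      (l :: l.partner :: o :: o.partner :: t :: t.partner :: (A ++ (X ++ Y))) := by
    refine (((((inOrder_perm b _ _).append_right _).append_left _).cons _).append_left
      [l, o, t]).append_left A |>.trans ?_
    rw [← Multiset.coe_eq_coe]
    simp only [← Multiset.coe_add, ← Multiset.cons_coe, ← Multiset.singleton_add, Multiset.coe_nil]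
    abel
  obtain ⟨w1, hl1⟩ := (hw.perm hperm).tail
  obtain ⟨w2, ho1⟩ := w1.tail
  have ht1 := w2.tail.2
  have hp1 : l.partner.label = l.label := rfl
  have hp2 : o.partner.label = o.label := rfl
  have hp3 : t.partner.label = t.label := rfl
  simp only [labels_cons, labels_append, Finset.mem_insert, Finset.mem_union, hp2, hp3, not_or]
    at hl1 ho1 ht1
  obtain ⟨hlo, -, hlt, -, lA, lX, lY⟩ := hl1
  obtain ⟨hot, -, oA, oX, oY⟩ := ho1
  obtain ⟨tA, tX, tY⟩ := ht1
  have hpar := hε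
  simp only [par_append, Par, List.cons_append, List.nil_append] at hpar
  obtain ⟨-, e1, e2, e3, -⟩ := hpar
  have hsum : ∀ f : ℕ → ZMod 2, ∑ c ∈ labels (A ++ ([l, o, t] ++ (l.partner :: (X ++
      (inOrder b o.partner t.partner ++ Y))))), f c * tot [l, o, t] c =
      f l.label + (f o.label + f t.label) := by
    intro f
    have m1 : l.label ∈ labels (A ++ ([l, o, t] ++ (l.partner :: (X ++
      (inOrder b o.partner t.partner ++ Y))))) := by simp
    have m2 : o.label ∈ labels (A ++ ([l, o, t] ++ (l.partner :: (X ++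
      (inOrder b o.partner t.partner ++ Y))))) := by simp
    have m3 : t.label ∈ labels (A ++ ([l, o, t] ++ (l.partner :: (X ++
      (inOrder b o.partner t.partner ++ Y))))) := by simp
    simp only [tot_cons, tot_nil, add_zero, mul_add, mul_ite, mul_one, mul_zero,
      Finset.sum_add_distrib, Finset.sum_ite_eq, m1, m2, m3, if_true]
  -- The arc meets the three crossings `l`, `o`, `t`, and `δ` is the value of `ε` at `l`. By `hsum`
  -- the eigenvector condition compares sums of three columns.
  refine Good.tuck (ε := ε) (δ := bz (!b) + A.length) hw hε hp hx hy hxy (by decide : ((3 : ℕ) : ZMod 2) = 1) ?_ ?_ ?_ ?_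
  · rw [hsum]
    simp [hlo, hlt, hot, Ne.symm hlo, Ne.symm hlt, Ne.symm hot]
    rfl
  · intro c hc
    rw [hsum]
    rw [labels_perm hperm] at hc
    simp only [labels_cons, Finset.mem_insert, hp1, hp2, hp3] at hc
    by_cases c1 : c = l.label
    · subst c1
      simp [withDiag, beta_inOrder, hp1, hp2, hp3, hlo, hlt, hot, Ne.symm hlo, Ne.symm hlt, Ne.symm hot,
        beta_eq_zero_left lA, beta_eq_zero_left lX, beta_eq_zero_left lY, tot_eq_zero lA,
        tot_eq_zero oA, tot_eq_zero oX, tot_eq_zero oY, tot_eq_zero tX, tot_eq_zero tY,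
        tot_eq_zero lX, tot_eq_zero lY, ← e1, hl, two]
    by_cases c2 : c = o.label
    · subst c2
      simp [withDiag, beta_inOrder, hp1, hp2, hp3, hlo, hlt, hot, Ne.symm hlo, Ne.symm hlt, Ne.symm hot,
        beta_eq_zero_left oA, beta_eq_zero_left oX, beta_eq_zero_left oY, tot_eq_zero lA,
        tot_eq_zero oA, tot_eq_zero oX, tot_eq_zero oY, tot_eq_zero tX, tot_eq_zero tY,
        tot_eq_zero lX, tot_eq_zero lY, ← e2, ho, two]
      generalize (A.length : ZMod 2) = a
      clear * -
      revert a b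
      decide
    by_cases c3 : c = t.label
    · subst c3
      simp [withDiag, beta_inOrder, hp1, hp2, hp3, hlo, hlt, hot, Ne.symm hlo, Ne.symm hlt, Ne.symm hot,
        beta_eq_zero_left tA, beta_eq_zero_left tX, beta_eq_zero_left tY, tot_eq_zero lA,
        tot_eq_zero oA, tot_eq_zero oX, tot_eq_zero oY, tot_eq_zero tX, tot_eq_zero tY,
        tot_eq_zero lX, tot_eq_zero lY, ← e3, ht, two]
      generalize (A.length : ZMod 2) = a
      clear * -
      revert a b
      decide
    simp [withDiag, beta_inOrder, hp1, hp2, hp3, c1, c2, c3, Ne.symm c1, Ne.symm c2, Ne.symm c3,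
      beta_eq_zero_right lA, beta_eq_zero_right lX, beta_eq_zero_right lY, beta_eq_zero_right oA,
      beta_eq_zero_right oX, beta_eq_zero_right oY, beta_eq_zero_right tA, beta_eq_zero_right tX,
      beta_eq_zero_right tY, tot_eq_zero lX, tot_eq_zero lY, tot_eq_zero oX, tot_eq_zero oY,
      tot_eq_zero tX, tot_eq_zero tY, hlo, hlt, hot, Ne.symm hlo, Ne.symm hlt, Ne.symm hot]
    grind
  · rw [tau_partner, hx']
  · rw [tau_partner, hy']
    generalize (A.length : ZMod 2) = a
    clear * -
    revert a b
    decide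

/-- The letters of three further crossings. -/
theorem codes_three {ms : List Move} {q q' : Region} (hq : endRegion .R ms = q)
    (h : q = .R ∧ q' = .L ∨ q = .L ∧ q' = .R) (d₁ d₂ d₃ : Dir) :
    let n := ms.length
    let l := (Crossing.mk n q q' d₁).active
    let o := (Crossing.mk (n + 1) q' .C d₂).active
    let t := (Crossing.mk (n + 2) .C q d₃).active
    activeCode (ms ++ [⟨q', d₁⟩, ⟨.C, d₂⟩, ⟨q, d₃⟩]) = activeCode ms ++ [l, o, t] ∧
    leftCode (ms ++ [⟨q', d₁⟩, ⟨.C, d₂⟩, ⟨q, d₃⟩]) ++ rightCode (ms ++ [⟨q', d₁⟩, ⟨.C, d₂⟩, ⟨q, d₃⟩]) =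
      l.partner :: (leftCode ms ++ (inOrder (q == .R) o.partner t.partner ++ rightCode ms)) := by
  intro n l o t
  have e1 : lastCrossing ms ⟨q', d₁⟩ = ⟨n, q, q', d₁⟩ := by rw [lastCrossing, hq]
  have e2 : lastCrossing (ms ++ [⟨q', d₁⟩]) ⟨.C, d₂⟩ = ⟨n + 1, q', .C, d₂⟩ := by
    simp [lastCrossing, n]
  have e3 : lastCrossing (ms ++ [⟨q', d₁⟩] ++ [⟨.C, d₂⟩]) ⟨q, d₃⟩ = ⟨n + 2, .C, q, d₃⟩ := by
    rw [lastCrossing, endRegion_concat]; simp [n]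
  have hl : ms ++ [⟨q', d₁⟩, ⟨.C, d₂⟩, ⟨q, d₃⟩] = ms ++ [⟨q', d₁⟩] ++ [⟨.C, d₂⟩] ++ [⟨q, d₃⟩] := by
    simp
  rw [hl]
  constructor
  · rw [activeCode_append, activeCode_append, activeCode_append, e1, e2, e3]; simp [l, o, t]
  · rcases h with ⟨rfl, rfl⟩ | ⟨rfl, rfl⟩
    · have c1 := codes_straight (ms := ms) (m := ⟨.L, d₁⟩) (by rw [e1]; rfl)
      have c2 := codes_left (ms := ms ++ [⟨.L, d₁⟩]) (m := ⟨.C, d₂⟩) (by rw [e2]; rfl)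
      have c3 := codes_right (ms := ms ++ [⟨.L, d₁⟩] ++ [⟨.C, d₂⟩]) (m := ⟨.R, d₃⟩) (by rw [e3]; rfl)
      rw [c3.1, c3.2, c2.1, c2.2, c1.1, c1.2, e1, e2, e3]
      simp [inOrder, l, o, t]
    · have c1 := codes_straight (ms := ms) (m := ⟨.R, d₁⟩) (by rw [e1]; rfl)
      have c2 := codes_right (ms := ms ++ [⟨.R, d₁⟩]) (m := ⟨.C, d₂⟩) (by rw [e2]; rfl)
      have c3 := codes_left (ms := ms ++ [⟨.R, d₁⟩] ++ [⟨.C, d₂⟩]) (m := ⟨.L, d₃⟩) (by rw [e3]; rfl)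
      rw [c3.1, c3.2, c2.1, c2.2, c1.1, c1.2, e1, e2, e3]
      simp [inOrder, l, o, t]

theorem tuckDiagram_eq {ms : List Move} {q q' : Region} (h0 : ms ≠ [])
    (hq : endRegion .R ms = q) (h : q = .R ∧ q' = .L ∨ q = .L ∧ q' = .R) (d₁ d₂ : Dir) :
    let n := ms.length
    let l := (Crossing.mk n q q' d₁).active
    let o := (Crossing.mk (n + 1) q' .C d₂).active
    let t := (Crossing.mk (n + 2) .C q .i).active
    let x : Letter := ⟨n + 3, true, q == .R⟩
    let y : Letter := ⟨n + 4, false, q == .R⟩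
    tuckDiagram (ms ++ [⟨q', d₁⟩, ⟨.C, d₂⟩]) =
      activeCode ms ++ ([x.partner, y.partner] ++ ([l, o, t] ++ ([x, y] ++
        (l.partner :: (leftCode ms ++ (inOrder (q == .R) o.partner t.partner ++ rightCode ms)))))) := by
  intro n l o t x y
  obtain ⟨c1, c2⟩ := codes_three hq h d₁ d₂ .i
  have hk : (ms ++ [⟨q', d₁⟩, ⟨.C, d₂⟩] : List Move).length = n + 2 := by simp [n]
  have hn : 0 < n := List.length_pos_iff.2 h0
  -- Here `ms ≠ []` is essential: for `n = 0` the truncated index would select the move into `q'`.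
  have hr : (((ms ++ [⟨q', d₁⟩, ⟨.C, d₂⟩] : List Move)[n + 2 - 3]?).map Move.region).getD .R = q := by
    rw [show n + 2 - 3 = n - 1 by omega, List.getElem?_append_left (by omega : n - 1 < n), ← hq,
      endRegion, List.getLast?_eq_getElem?]
  have hlen : (activeCode ms).length = n := by
    rw [activeCode, List.length_map, crossings]
    generalize 0 = k
    generalize Region.R = r
    clear * -
    subst n
    induction ms generalizing k r with
    | nil => rfl
    | cons a ms ih => simp [crossingsFrom, ih]
  rw [tuckDiagram]
  simp only [hk, hr]
  have hl : ms ++ [⟨q', d₁⟩, ⟨.C, d₂⟩] ++ [⟨q, .i⟩] = ms ++ [⟨q', d₁⟩, ⟨.C, d₂⟩, ⟨q, .i⟩] := by simp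
  rw [hl]
  change (activeCode (ms ++ [⟨q', d₁⟩, ⟨.C, d₂⟩, ⟨q, .i⟩])).take n ++ _ ++
    (activeCode (ms ++ [⟨q', d₁⟩, ⟨.C, d₂⟩, ⟨q, .i⟩])).drop n ++ _ ++
    (leftCode (ms ++ [⟨q', d₁⟩, ⟨.C, d₂⟩, ⟨q, .i⟩]) ++ rightCode (ms ++ [⟨q', d₁⟩, ⟨.C, d₂⟩, ⟨q, .i⟩])) = _
  rw [c1, c2, List.take_left' hlen, List.drop_left' hlen]
  simp [x, y, Letter.partner, l, o, t, n]

/-- Without `t₂` and `t₃` this is the open diagram with one more move into `q`, which is good;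
`Good.tuck_of_good` adds the other two crossings. -/
theorem good_tuckDiagram {ms : List Move} {q q' : Region} (hms : RegionChain ms) (h0 : ms ≠ [])
    (hq : endRegion .R ms = q) (h : q = .R ∧ q' = .L ∨ q = .L ∧ q' = .R) (d₁ d₂ : Dir) :
    Good (tuckDiagram (ms ++ [⟨q', d₁⟩, ⟨.C, d₂⟩])) := by
  obtain ⟨c1, c2⟩ := codes_three hq h d₁ d₂ .i
  have hl : ms ++ [⟨q', d₁⟩, ⟨.C, d₂⟩, ⟨q, .i⟩] = ms ++ [⟨q', d₁⟩] ++ [⟨.C, d₂⟩] ++ [⟨q, .i⟩] := by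
    simp
  have hc : RegionChain (ms ++ [⟨q', d₁⟩, ⟨.C, d₂⟩, ⟨q, .i⟩]) := by
    rw [hl, regionChain_append, regionChain_append, regionChain_append, endRegion_concat,
      endRegion_concat, hq]
    rcases h with ⟨rfl, rfl⟩ | ⟨rfl, rfl⟩ <;> simp [hms]
  have hend : endRegion .R (ms ++ [⟨q', d₁⟩, ⟨.C, d₂⟩, ⟨q, .i⟩]) ≠ .C := by
    rw [hl, endRegion_concat]
    rcases h with ⟨rfl, rfl⟩ | ⟨rfl, rfl⟩ <;> simp
  have hg := good_openDiagram hc hend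
  obtain ⟨ε, hε⟩ := exists_inv hc
  have hlab : labels (openDiagram (ms ++ [⟨q', d₁⟩, ⟨.C, d₂⟩, ⟨q, .i⟩])) =
      Finset.range (ms.length + 3) := by
    rw [openDiagram_eq, hε.labels_eq]; simp
  rw [openDiagram_eq, c1, c2, List.append_assoc] at hg hlab
  rw [tuckDiagram_eq h0 hq h]
  refine Good.tuck_of_good hg ?_ ?_ ?_ ?_ ?_ ?_ ?_ ?_
  · rw [hlab]; simp
  · rw [hlab]; simp
  · simp
  all_goals
    first
      | rw [Crossing.tau_active]; rcases h with ⟨rfl, rfl⟩ | ⟨rfl, rfl⟩ <;> rfl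
      | rcases h with ⟨rfl, rfl⟩ | ⟨rfl, rfl⟩ <;> rfl

/-! ### Undoing a tuck -/

/-- Here `x`, `y` are `t₂`, `t₃`, while `r`, `l`, `o`, `t` are the crossings of the last three moves
and `t₁`. First `y` and `l` bound a bigon; once it is removed, `x` and `r` bound one. -/
theorem leads_tuck_straight_aux (r l o t x y : ℕ) (s : Bool) (A Z : GaussCode) :
    Leads (A ++ (⟨r, false, !s⟩ :: ⟨x, false, s⟩ :: ⟨y, true, s⟩ :: ⟨l, true, !s⟩ ::
        ⟨o, false, false⟩ :: ⟨t, true, false⟩ :: ⟨x, true, s⟩ :: ⟨y, false, s⟩ :: ⟨l, false, !s⟩ ::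
        ⟨r, true, !s⟩ :: Z))
      (A ++ (⟨o, false, false⟩ :: ⟨t, true, false⟩ :: Z)) := by
  have h1 := leads_r2 y l s true (A ++ ([⟨r, false, !s⟩, ⟨x, false, s⟩] : GaussCode))
    ([⟨o, false, false⟩, ⟨t, true, false⟩, ⟨x, true, s⟩] : GaussCode) (⟨r, true, !s⟩ :: Z)
  have h2 := leads_r2' x r s false A ([⟨o, false, false⟩, ⟨t, true, false⟩] : GaussCode) Z
  simp only [inOrder, List.append_assoc, List.cons_append, List.nil_append, if_true,
    Bool.false_eq_true, if_false] at h1 h2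
  exact h1.trans h2

/-- Removing the bigon `y`, `l` leaves a triangle `t`, `x`, `r`. Moving a strand across it makes `r`
and `o` bound a bigon, whose removal turns `x` into a kink. Only `t` survives. -/
theorem leads_tuck_center_aux (r l o t x y : ℕ) (s : Bool) (A U V : GaussCode) :
    Leads (A ++ (⟨r, false, true⟩ :: ⟨x, false, s⟩ :: ⟨y, true, s⟩ :: ⟨l, true, !s⟩ ::
        ⟨o, false, false⟩ :: ⟨t, true, false⟩ :: ⟨x, true, s⟩ :: ⟨y, false, s⟩ :: ⟨l, false, !s⟩ ::
        (U ++ ((if s then [⟨o, true, false⟩, ⟨t, false, false⟩, ⟨r, true, true⟩] else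
          [⟨r, true, true⟩, ⟨t, false, false⟩, ⟨o, true, false⟩]) ++ V))))
      (A ++ (⟨t, true, false⟩ :: (U ++ (⟨t, false, false⟩ :: V)))) := by
  have h1 := leads_r2 y l s true (A ++ ([⟨r, false, true⟩, ⟨x, false, s⟩] : GaussCode))
    ([⟨o, false, false⟩, ⟨t, true, false⟩, ⟨x, true, s⟩] : GaussCode)
    (U ++ ((if s then [⟨o, true, false⟩, ⟨t, false, false⟩, ⟨r, true, true⟩] else
          [⟨r, true, true⟩, ⟨t, false, false⟩, ⟨o, true, false⟩]) ++ V))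
  cases s
  · have h2 := leads_r3 t x r false false true true false false A
      ([⟨o, false, false⟩] : GaussCode) U (⟨o, true, false⟩ :: V) rfl rfl
    have h3 := leads_r2' r o true true (A ++ ([⟨x, false, false⟩] : GaussCode))
      (⟨x, true, false⟩ :: ⟨t, true, false⟩ :: (U ++ ([⟨t, false, false⟩] : GaussCode))) V
    have h4 := leads_r1 ⟨x, false, false⟩ A (⟨t, true, false⟩ :: (U ++ (⟨t, false, false⟩ :: V)))
    simp only [inOrder, topStrand, midStrand, botStrand, List.append_assoc, List.cons_append,
      List.nil_append, if_true, Bool.false_eq_true, if_false, Bool.not_false, Bool.not_true,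
      Letter.partner] at h1 h2 h3 h4 ⊢
    exact ((h1.trans h2).trans h3).trans h4
  · have h2 := leads_r3 t x r false true true true true false A
      ([⟨o, false, false⟩] : GaussCode) (U ++ ([⟨o, true, false⟩] : GaussCode)) V rfl rfl
    have h3 := leads_r2' o r false false (A ++ ([⟨x, false, true⟩] : GaussCode))
      (⟨x, true, true⟩ :: ⟨t, true, false⟩ :: U) (⟨t, false, false⟩ :: V)
    have h4 := leads_r1 ⟨x, false, true⟩ A (⟨t, true, false⟩ :: (U ++ (⟨t, false, false⟩ :: V)))
    simp only [inOrder, topStrand, midStrand, botStrand, List.append_assoc, List.cons_append,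
      List.nil_append, if_true, Bool.false_eq_true, if_false, Bool.not_false, Bool.not_true,
      Letter.partner] at h1 h2 h3 h4 ⊢
    exact ((h1.trans h2).trans h3).trans h4

theorem map_relabel_eq_self {σ : Equiv.Perm ℕ} {w : GaussCode} (h : ∀ c ∈ labels w, σ c = c) :
    w.map (Letter.relabel σ) = w := by
  refine (List.map_congr_left fun x hx => ?_).trans (List.map_id w)
  rw [Letter.relabel, h x.label (mem_labels.2 ⟨x, hx, rfl⟩)]; rfl

/-- The letters of a move to the center and back. -/
theorem openDiagram_two {ms : List Move} {q q' : Region} (hq : endRegion .R ms = q')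
    (h : q = .R ∧ q' = .L ∨ q = .L ∧ q' = .R) {t : Region} (ht : t ≠ .C) :
    openDiagram (ms ++ [⟨.C, .o⟩, ⟨t, .i⟩]) =
      activeCode ms ++ (⟨ms.length, false, false⟩ :: ⟨ms.length + 1, true, false⟩ :: (leftCode ms ++
        (inOrder (q == .R) ⟨ms.length, true, false⟩ ⟨ms.length + 1, false, false⟩ ++
          rightCode ms))) := by
  have e1 : lastCrossing ms ⟨.C, .o⟩ = ⟨ms.length, q', .C, .o⟩ := by rw [lastCrossing, hq]
  have e2 : lastCrossing (ms ++ [⟨.C, .o⟩]) ⟨t, .i⟩ = ⟨ms.length + 1, .C, t, .i⟩ := by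
    simp [lastCrossing]
  have hl : ms ++ [⟨.C, .o⟩, ⟨t, .i⟩] = ms ++ [⟨.C, .o⟩] ++ [⟨t, .i⟩] := by simp
  have ht' : t = .L ∨ t = .R := by cases t <;> simp_all
  rw [hl, openDiagram_eq]
  -- The last crossing sits where the left and right sides of the loop meet: at the end of the left
  -- code or the start of the right code. So both choices of `t` give the same word, which is why
  -- reduction I may choose.
  rcases ht' with rfl | rfl <;> rcases h with ⟨rfl, rfl⟩ | ⟨rfl, rfl⟩
  · have c1 := codes_left (ms := ms) (m := ⟨.C, .o⟩) (by rw [e1]; rfl)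
    have c2 := codes_left (ms := ms ++ [⟨.C, .o⟩]) (m := ⟨.L, .i⟩) (by rw [e2]; rfl)
    rw [c2.1, c2.2, c1.1, c1.2, activeCode_append, activeCode_append, e1, e2]
    simp only [List.append_assoc]; rfl
  · have c1 := codes_right (ms := ms) (m := ⟨.C, .o⟩) (by rw [e1]; rfl)
    have c2 := codes_left (ms := ms ++ [⟨.C, .o⟩]) (m := ⟨.L, .i⟩) (by rw [e2]; rfl)
    rw [c2.1, c2.2, c1.1, c1.2, activeCode_append, activeCode_append, e1, e2]
    simp only [List.append_assoc]; rfl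
  · have c1 := codes_left (ms := ms) (m := ⟨.C, .o⟩) (by rw [e1]; rfl)
    have c2 := codes_right (ms := ms ++ [⟨.C, .o⟩]) (m := ⟨.R, .i⟩) (by rw [e2]; rfl)
    rw [c2.1, c2.2, c1.1, c1.2, activeCode_append, activeCode_append, e1, e2]
    simp only [List.append_assoc]; rfl
  · have c1 := codes_right (ms := ms) (m := ⟨.C, .o⟩) (by rw [e1]; rfl)
    have c2 := codes_right (ms := ms ++ [⟨.C, .o⟩]) (m := ⟨.R, .i⟩) (by rw [e2]; rfl)
    rw [c2.1, c2.2, c1.1, c1.2, activeCode_append, activeCode_append, e1, e2]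
    simp only [List.append_assoc]; rfl

theorem leads_tuck_straight {ms : List Move} {q q' : Region} (hms : RegionChain ms)
    (hq : endRegion .R ms = q') (h : q = .R ∧ q' = .L ∨ q = .L ∧ q' = .R) {t : Region}
    (ht : t ≠ .C) :
    Leads (tuckDiagram (ms ++ [⟨q, .o⟩, ⟨q', .i⟩, ⟨.C, .o⟩])) (openDiagram (ms ++ [⟨.C, .o⟩, ⟨t, .i⟩])) := by
  obtain ⟨ε, hε⟩ := exists_inv hms
  obtain ⟨hA, hX, hY⟩ := hε.notMem
  have hl : ms ++ [⟨q, .o⟩, ⟨q', .i⟩, ⟨.C, .o⟩] = ms ++ [⟨q, .o⟩] ++ [⟨q', .i⟩, ⟨.C, .o⟩] := by simp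
  have hl' : ms ++ [⟨.C, .o⟩, ⟨t, .i⟩] = ms ++ [⟨.C, .o⟩] ++ [⟨t, .i⟩] := by simp
  have e1 : lastCrossing ms ⟨q, .o⟩ = ⟨ms.length, q', q, .o⟩ := by rw [lastCrossing, hq]
  have c1 := codes_straight (ms := ms) (m := ⟨q, .o⟩) (by
    rw [e1]; rcases h with ⟨rfl, rfl⟩ | ⟨rfl, rfl⟩ <;> rfl)
  have eq1 := tuckDiagram_eq (ms := ms ++ [⟨q, .o⟩]) (by simp) (by simp) h .i .o
  rw [c1.1, c1.2, activeCode_append, e1] at eq1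
  have l1 := leads_tuck_straight_aux ms.length (ms.length + 1) (ms.length + 2) (ms.length + 3)
    (ms.length + 4) (ms.length + 5) (q == .R) (activeCode ms) (leftCode ms ++
        (inOrder (q == .R) ⟨ms.length + 2, true, false⟩ ⟨ms.length + 3, false, false⟩ ++
          rightCode ms))
  have eq2 : tuckDiagram (ms ++ [⟨q, .o⟩, ⟨q', .i⟩, ⟨.C, .o⟩]) = activeCode ms ++
      (⟨ms.length, false, !(q == .R)⟩ :: ⟨ms.length + 4, false, q == .R⟩ ::
        ⟨ms.length + 5, true, q == .R⟩ :: ⟨ms.length + 1, true, !(q == .R)⟩ ::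
        ⟨ms.length + 2, false, false⟩ :: ⟨ms.length + 3, true, false⟩ ::
        ⟨ms.length + 4, true, q == .R⟩ :: ⟨ms.length + 5, false, q == .R⟩ ::
        ⟨ms.length + 1, false, !(q == .R)⟩ :: ⟨ms.length, true, !(q == .R)⟩ ::
        (leftCode ms ++ (inOrder (q == .R) ⟨ms.length + 2, true, false⟩
          ⟨ms.length + 3, false, false⟩ ++ rightCode ms))) := by
    rw [hl, eq1]
    simp only [List.append_assoc, List.length_append, List.length_singleton]
    rcases h with ⟨rfl, rfl⟩ | ⟨rfl, rfl⟩ <;> rfl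
  rw [eq2]
  refine l1.trans ?_
  have hg : Good (openDiagram (ms ++ [⟨.C, .o⟩, ⟨t, .i⟩])) := by
    refine good_openDiagram ?_ ?_
    · rw [hl', regionChain_append, regionChain_append, endRegion_concat, hq]
      refine ⟨⟨hms, ?_⟩, ht.symm⟩
      rcases h with ⟨rfl, rfl⟩ | ⟨rfl, rfl⟩ <;> simp
    · rw [hl', endRegion_concat]; exact ht
  -- The two surviving crossings carry numbers that are too large by two.
  let σ : Equiv.Perm ℕ := Equiv.swap ms.length (ms.length + 2) *
    Equiv.swap (ms.length + 1) (ms.length + 3)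
  have hσ : ∀ w, (∀ c, ms.length ≤ c → c ∉ labels w) → w.map (Letter.relabel σ) = w := by
    intro w hw
    refine map_relabel_eq_self fun c hc => ?_
    have : c < ms.length := by by_contra hc'; exact hw c (by omega) hc
    simp only [σ, Equiv.Perm.mul_apply, Equiv.swap_apply_def]
    split_ifs <;> omega
  have s2 : σ (ms.length + 2) = ms.length := by
    simp [σ, Equiv.Perm.mul_apply, Equiv.swap_apply_def]
  have s3 : σ (ms.length + 3) = ms.length + 1 := by
    simp [σ, Equiv.Perm.mul_apply, Equiv.swap_apply_def]
  refine leads_of_step (fun _ => hg) ?_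
  convert Step.relabel σ _ using 1
  rw [openDiagram_two hq h ht]
  simp only [List.map_append, List.map_cons, hσ _ hA, hσ _ hX, hσ _ hY]
  cases (q == .R) <;> simp [inOrder, Letter.relabel, s2, s3]

/-- After `leads_tuck_center_aux` the remaining `t₁` and the crossing of the move `C_i` bound a
bigon, as both pass over; its removal leaves `ms`. -/
theorem leads_tuck_center {ms : List Move} {q q' : Region} (hms : endRegion .R ms ≠ .C)
    (h : q = .R ∧ q' = .L ∨ q = .L ∧ q' = .R) :
    Leads (tuckDiagram (ms ++ [⟨.C, .i⟩, ⟨q, .o⟩, ⟨q', .i⟩, ⟨.C, .o⟩])) (openDiagram ms) := by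
  have hl : ms ++ [⟨.C, .i⟩, ⟨q, .o⟩, ⟨q', .i⟩, ⟨.C, .o⟩] =
    ms ++ [⟨.C, .i⟩] ++ [⟨q, .o⟩] ++ [⟨q', .i⟩, ⟨.C, .o⟩] := by simp
  have e2 : lastCrossing (ms ++ [⟨.C, .i⟩]) ⟨q, .o⟩ = ⟨ms.length + 1, .C, q, .o⟩ := by
    simp [lastCrossing]
  have eq1 := tuckDiagram_eq (ms := ms ++ [⟨.C, .i⟩] ++ [⟨q, .o⟩]) (by simp)
    (endRegion_concat _ _ _) h .i .o
  rw [hl, eq1, openDiagram_eq]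
  have hms' : endRegion .R ms = .L ∨ endRegion .R ms = .R := by
    generalize endRegion .R ms = a at *
    clear * - hms
    revert hms
    cases a <;> simp
  have aux := leads_tuck_center_aux (ms.length + 1) (ms.length + 2) (ms.length + 3) (ms.length + 4)
    (ms.length + 5) (ms.length + 6) (q == .R) (activeCode ms ++ [⟨ms.length, true, true⟩])
  rcases hms' with hL | hR
  · have e1 : lastCrossing ms ⟨.C, .i⟩ = ⟨ms.length, .L, .C, .i⟩ := by rw [lastCrossing, hL]
    have c1 := codes_left (ms := ms) (m := ⟨.C, .i⟩) (by rw [e1]; rfl)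
    have fin := leads_r2 ms.length (ms.length + 4) true true (activeCode ms) (leftCode ms)
      (rightCode ms)
    have aux := aux (leftCode ms ++ [⟨ms.length, false, true⟩]) (rightCode ms)
    rcases h with ⟨rfl, rfl⟩ | ⟨rfl, rfl⟩
    · have c2 := codes_right (ms := ms ++ [⟨.C, .i⟩]) (m := ⟨.R, .o⟩) (by rw [e2]; rfl)
      rw [c2.1, c2.2, c1.1, c1.2, activeCode_append, activeCode_append, e1, e2]
      simp only [List.append_assoc, List.length_append, List.length_singleton] at aux fin ⊢
      exact Leads.trans aux fin
    · have c2 := codes_left (ms := ms ++ [⟨.C, .i⟩]) (m := ⟨.L, .o⟩) (by rw [e2]; rfl)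
      rw [c2.1, c2.2, c1.1, c1.2, activeCode_append, activeCode_append, e1, e2]
      simp only [List.append_assoc, List.length_append, List.length_singleton] at aux fin ⊢
      exact Leads.trans aux fin
  · have e1 : lastCrossing ms ⟨.C, .i⟩ = ⟨ms.length, .R, .C, .i⟩ := by rw [lastCrossing, hR]
    have c1 := codes_right (ms := ms) (m := ⟨.C, .i⟩) (by rw [e1]; rfl)
    have fin := leads_r2 ms.length (ms.length + 4) true false (activeCode ms) (leftCode ms)
      (rightCode ms)
    have aux := aux (leftCode ms) (⟨ms.length, false, true⟩ :: rightCode ms)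
    rcases h with ⟨rfl, rfl⟩ | ⟨rfl, rfl⟩
    · have c2 := codes_right (ms := ms ++ [⟨.C, .i⟩]) (m := ⟨.R, .o⟩) (by rw [e2]; rfl)
      rw [c2.1, c2.2, c1.1, c1.2, activeCode_append, activeCode_append, e1, e2]
      simp only [List.append_assoc, List.length_append, List.length_singleton] at aux fin ⊢
      exact Leads.trans aux fin
    · have c2 := codes_left (ms := ms ++ [⟨.C, .i⟩]) (m := ⟨.L, .o⟩) (by rw [e2]; rfl)
      rw [c2.1, c2.2, c1.1, c1.2, activeCode_append, activeCode_append, e1, e2]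
      simp only [List.append_assoc, List.length_append, List.length_singleton] at aux fin ⊢
      exact Leads.trans aux fin

/-! ### Reduced diagrams -/

/-- The directions alternate. -/
def DirChain (ms : List Move) : Prop := ms.IsChain fun m m' => m.dir ≠ m'.dir

/-- Up to constants, the sign is the sum of direction and turn, and `ε` is the sum of position and
turn. Directions alternate, so direction and position differ by a constant. -/
theorem positive_crossingsFrom {ε : ℕ → ZMod 2} {n : ℕ} {k : ZMod 2} {r : Region} {m : Move}
    {ms : List Move} (h : DirChain (m :: ms))
    (hε : Par ε k ((crossingsFrom n r (m :: ms)).map Crossing.active)) :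
    ∀ c ∈ crossingsFrom n r (m :: ms), bz c.positive = ε c.label + (k + bz (m.dir == .i) + 1) := by
  induction ms generalizing n k r m with
  | nil =>
    intro c hc
    simp only [crossingsFrom, List.mem_singleton] at hc
    subst hc
    have h1 := hε.1
    rw [Crossing.tau_active] at h1
    change _ = ε n + _
    change bz _ + k = ε n at h1
    rw [← h1, Crossing.positive]
    generalize (Crossing.mk n r m.region m.dir).turn = t
    change bz ((m.dir == .i) == t) = _
    generalize (m.dir == .i) = d
    clear * -
    revert d t k
    decide
  | cons m' ms ih =>
    intro c hc
    rw [crossingsFrom, List.mem_cons] at hc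
    rcases hc with rfl | hc
    · have h1 := hε.1
      rw [Crossing.tau_active] at h1
      change _ = ε n + _
      change bz _ + k = ε n at h1
      rw [← h1, Crossing.positive]
      generalize (Crossing.mk n r m.region m.dir).turn = t
      change bz ((m.dir == .i) == t) = _
      generalize (m.dir == .i) = d
      clear * -
      revert d t k
      decide
    · have hd : bz (m'.dir == .i) = bz (m.dir == .i) + 1 := by
        have : m.dir ≠ m'.dir := (List.isChain_cons_cons.1 h).1
        generalize m.dir = a at *
        generalize m'.dir = b at *
        clear * - this
        cases a <;> cases b <;> first | exact absurd rfl this | rfl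
      rw [ih (List.isChain_cons_cons.1 h).2 hε.2 c hc, hd]
      grind

theorem exists_crossing_of_mem {ms : List Move} {x : Letter} (hx : x ∈ openDiagram ms) :
    ∃ c ∈ crossings ms, x.label = c.label ∧ x.positive = c.positive := by
  simp only [openDiagram, passiveCode, onPart, List.mem_append, List.mem_reverse, List.mem_map,
    List.mem_filter] at hx
  rcases hx with ⟨c, hc, rfl⟩ | (⟨c, hc, rfl⟩ | ⟨c, hc, rfl⟩) | ⟨c, hc, rfl⟩
  · exact ⟨c, hc, rfl, rfl⟩
  all_goals exact ⟨c, hc.1, rfl, rfl⟩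

/-- In an open diagram with alternating directions the signs agree with the parities. -/
theorem exists_positive_eq {ms : List Move} (h : DirChain ms) {ε : ℕ → ZMod 2}
    (hε : Par ε 0 (activeCode ms)) :
    ∃ κ, ∀ x ∈ openDiagram ms, bz x.positive = ε x.label + κ := by
  cases ms with
  | nil => exact ⟨0, fun x hx => by simp [openDiagram, crossings, crossingsFrom, passiveCode, onPart] at hx⟩
  | cons m ms =>
    refine ⟨0 + bz (m.dir == .i) + 1, fun x hx => ?_⟩
    obtain ⟨c, hc, h1, h2⟩ := exists_crossing_of_mem hx
    rw [h1, h2]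
    exact positive_crossingsFrom h hε c hc

namespace GaussCode

/-- On the crossings the diagonal of `matA` is `ε + κ + 1`, so `matA` is the face matrix of one of
the two colours. -/
theorem proj_matA {w : GaussCode} (hw : WellFormed w) {ε : ℕ → ZMod 2}
    (hp : Proj (labels w) (withDiag (beta w) ε)) {κ : ZMod 2}
    (hκ : ∀ x ∈ w, bz x.positive = ε x.label + κ) : Proj (labels w) (matA w) := by
  have hi : ∀ c ∈ labels w, ind (stateA (labels w) (sgn w)) c = ε c + κ + 1 := by
    intro c hc
    obtain ⟨x, hx, rfl⟩ := mem_labels.1 hc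
    rw [← hκ x hx, ← hw.sgn_eq hx]
    simp only [ind, stateA, Finset.mem_filter, hc, true_and]
    cases sgn w x.label <;> simp [bz]
    rfl
  rcases zmod_two_cases κ with rfl | rfl
  · refine hp.compl.congr fun c hc d _ => ?_
    by_cases hcd : c = d
    · subst hcd
      simp only [matA, withDiag, TieKnot.compl, if_true, hi c hc]
      grind
    · simp [matA, withDiag, TieKnot.compl, hcd, Ne.symm hcd]
  · refine hp.congr fun c hc d _ => ?_
    by_cases hcd : c = d
    · subst hcd
      simp only [matA, withDiag, if_true, hi c hc]
      grind
    · simp [matA, withDiag, hcd]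

theorem beta_loop {A X Y : GaussCode} {e : Letter} (hA : e.label ∉ labels A)
    (hX : e.label ∉ labels X) (hY : e.label ∉ labels Y) {c : ℕ} (hc : e.label ≠ c) :
    beta (A ++ [e] ++ (X ++ e.partner :: Y)) c e.label = tot X c ∧
    beta (A ++ [e] ++ (X ++ e.partner :: Y)) e.label c = tot X c ∧
    ∀ d, e.label ≠ d → beta (A ++ [e] ++ (X ++ e.partner :: Y)) c d = beta (A ++ (X ++ Y)) c d := by
  have hpe : e.partner.label = e.label := rfl
  refine ⟨?_, ?_, fun d hd => ?_⟩
  · simp [hpe, hc, beta_eq_zero_right hA, beta_eq_zero_right hX, beta_eq_zero_right hY,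
      tot_eq_zero hX, tot_eq_zero hY]
    grind
  · simp [hpe, hc, beta_eq_zero_left hA, beta_eq_zero_left hX, beta_eq_zero_left hY,
      tot_eq_zero hX, tot_eq_zero hY, tot_eq_zero hA]
    grind
  · simp [hpe, hc, hd]

theorem beta_straight {A Z : GaussCode} {e : Letter} {c d : ℕ} (hc : e.label ≠ c)
    (hd : e.label ≠ d) : beta (A ++ [e] ++ (e.partner :: Z)) c d = beta (A ++ Z) c d := by
  have hpe : e.partner.label = e.label := rfl
  simp [hpe, hc, hd]

end GaussCode

theorem endRegion_cases (ms : List Move) (m : Move) :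
    (endRegion .R ms ≠ .C ∧ m.region ≠ .C ∧ (lastCrossing ms m).part = .straight) ∨
    ((endRegion .R ms = .L ∨ m.region = .L) ∧ (lastCrossing ms m).part = .left) ∨
    (lastCrossing ms m).part = .right := by
  have key : (lastCrossing ms m).part = (if endRegion .R ms ≠ .C ∧ m.region ≠ .C then .straight
      else if endRegion .R ms = .L ∨ m.region = .L then .left else .right) := rfl
  rw [key]
  split_ifs with h1 h2
  · exact Or.inl ⟨h1.1, h1.2, rfl⟩
  · exact Or.inr (Or.inl ⟨h2, rfl⟩)
  · exact Or.inr (Or.inr rfl)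

/-- Every crossing lies on the straight strand or the left side of the neck loop, or it is
interlaced with the first crossing. -/
theorem tot_or_beta {ms : List Move} {d : Dir} (h : RegionChain (⟨.L, d⟩ :: ms)) :
    tot (leftCode (⟨.L, d⟩ :: ms)) 0 = 1 ∧ ∀ c < ms.length + 1, tot (leftCode (⟨.L, d⟩ :: ms)) c = 1 ∨
      beta (openDiagram (⟨.L, d⟩ :: ms)) c 0 = 1 := by
  induction ms using List.reverseRecOn with
  | nil =>
    have : leftCode [⟨.L, d⟩] = [(Crossing.mk 0 .R .L d).passive] := rfl
    rw [this]
    refine ⟨by simp [Crossing.passive], fun c hc => Or.inl ?_⟩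
    obtain rfl : c = 0 := by simpa using hc
    simp [Crossing.passive]
  | append_singleton ms m ih =>
    rw [← List.cons_append] at h ⊢
    obtain ⟨hms, -⟩ := regionChain_append.1 h
    obtain ⟨i1, i2⟩ := ih hms
    obtain ⟨ε, hε⟩ := exists_inv hms
    obtain ⟨hA, hX, hY⟩ := hε.notMem
    rw [openDiagram_eq] at i2 ⊢
    generalize hms' : (⟨.L, d⟩ : Move) :: ms = p at *
    have hp : p.length = ms.length + 1 := by rw [← hms']; rfl
    rw [activeCode_append]
    set e := (lastCrossing p m).active with he
    have hel : e.label = p.length := rfl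
    have hpel : e.partner.label = p.length := rfl
    rw [← hel] at hA hX hY
    have ne0 : e.label ≠ 0 := by omega
    have split : ∀ {P : ℕ → Prop}, (∀ c < ms.length + 1, e.label ≠ c → P c) → P e.label →
        ∀ c < (ms ++ [m]).length + 1, P c := by
      intro P h1 h2 c hc
      by_cases h3 : e.label = c
      · rw [← h3]; exact h2
      · refine h1 c ?_ h3
        rw [List.length_append, List.length_singleton] at hc
        omega
    rcases endRegion_cases p m with ⟨-, -, hk⟩ | ⟨-, hk⟩ | hk
    · obtain ⟨c1, c2⟩ := codes_straight hk
      rw [c1, c2, ← he]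
      refine ⟨by simp [i1, show e.partner.label ≠ 0 from ne0], split (fun c hc hce => ?_) (Or.inl ?_)⟩
      · rw [List.cons_append, beta_straight hce ne0]
        simpa [hpel, hel ▸ hce] using i2 c hc
      · simp [hpel, hel, tot_eq_zero (hX _ le_rfl)]
        simpa [hel] using tot_eq_zero (hX _ le_rfl)
    · obtain ⟨c1, c2⟩ := codes_left hk
      rw [c1, c2, ← he, List.append_assoc (leftCode p), List.singleton_append]
      refine ⟨by simp [i1, show e.partner.label ≠ 0 from ne0], split (fun c hc hce => ?_) (Or.inl ?_)⟩
      · rw [(beta_loop (hA _ le_rfl) (hX _ le_rfl) (hY _ le_rfl) hce).2.2 0 ne0]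
        simpa [hpel, hel ▸ hce] using i2 c hc
      · simp [hpel, hel]
        simpa [hel] using tot_eq_zero (hX _ le_rfl)
    -- A crossing on the right side is interlaced with all crossings of the left code, and the first
    -- crossing is one of them.
    · obtain ⟨c1, c2⟩ := codes_right hk
      rw [c1, c2, ← he]
      refine ⟨i1, split (fun c hc hce => ?_) (Or.inr ?_)⟩
      · rw [(beta_loop (hA _ le_rfl) (hX _ le_rfl) (hY _ le_rfl) hce).2.2 0 ne0]
        exact i2 c hc
      · rw [(beta_loop (hA _ le_rfl) (hX _ le_rfl) (hY _ le_rfl) ne0).2.1, i1]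

/-- If the last move leaves the center, every crossing is interlaced with another one. -/
theorem exists_interlaced {ms : List Move} {d : Dir} {m : Move}
    (h : RegionChain (⟨.L, d⟩ :: ms ++ [m])) (hC : endRegion .R (⟨.L, d⟩ :: ms) = .C) :
    ∀ c ∈ labels (openDiagram (⟨.L, d⟩ :: ms ++ [m])),
      ∃ c' ∈ labels (openDiagram (⟨.L, d⟩ :: ms ++ [m])),
        c ≠ c' ∧ beta (openDiagram (⟨.L, d⟩ :: ms ++ [m])) c c' = 1 := by
  obtain ⟨hms, -⟩ := regionChain_append.1 h
  obtain ⟨i1, i2⟩ := tot_or_beta hms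
  obtain ⟨ε, hε⟩ := exists_inv hms
  obtain ⟨ε', hε'⟩ := exists_inv h
  obtain ⟨hA, hX, hY⟩ := hε.notMem
  have hlab : labels (openDiagram (⟨.L, d⟩ :: ms ++ [m])) = Finset.range (ms.length + 2) := by
    rw [openDiagram_eq, hε'.labels_eq]; simp
  rw [hlab]
  generalize hms' : (⟨.L, d⟩ : Move) :: ms = p at *
  have hp : p.length = ms.length + 1 := by rw [← hms']; rfl
  -- The last crossing encloses the whole left code, whichever side it is on. So it is interlaced
  -- with the crossings there, the first one included; by `tot_or_beta` all others are interlaced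
  -- with the first one.
  have hw : openDiagram (p ++ [m]) = activeCode p ++ [(lastCrossing p m).active] ++
      (leftCode p ++ (lastCrossing p m).active.partner :: rightCode p) := by
    rw [openDiagram_eq, activeCode_append]
    rcases endRegion_cases p m with ⟨h1, -⟩ | ⟨-, hk⟩ | hk
    · exact absurd hC h1
    · rw [(codes_left hk).1, (codes_left hk).2]; simp
    · rw [(codes_right hk).1, (codes_right hk).2]
  rw [hw]
  set e := (lastCrossing p m).active with he
  have hel : e.label = p.length := rfl
  rw [← hel] at hA hX hY
  have ne0 : e.label ≠ 0 := by omega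
  have bl := fun {c : ℕ} (hc : e.label ≠ c) =>
    beta_loop (hA _ le_rfl) (hX _ le_rfl) (hY _ le_rfl) hc
  intro c hc
  rw [Finset.mem_range] at hc
  by_cases hce : e.label = c
  · refine ⟨0, by simp, by omega, ?_⟩
    rw [← hce, (bl ne0).2.1, i1]
  · by_cases ht : tot (leftCode p) c = 1
    · refine ⟨e.label, by rw [Finset.mem_range]; omega, Ne.symm hce, ?_⟩
      rw [(bl hce).1, ht]
    · refine ⟨0, by simp, ?_, ?_⟩
      · rintro rfl; exact ht i1
      · rw [(bl hce).2.2 0 ne0]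
        exact (i2 c (by omega)).resolve_left ht

/-! ### Reductions of tie sequences -/

/-- Consecutive moves are compatible. -/
def MoveChain (ms : List Move) : Prop :=
  ms.IsChain fun m m' => m.region ≠ m'.region ∧ m.dir ≠ m'.dir

theorem MoveChain.dirChain {ms : List Move} (h : MoveChain ms) : DirChain ms :=
  List.IsChain.imp (fun _ _ h => h.2) h

/-- The first region, if there is one, is the left one. -/
def StartsLeft (ms : List Move) : Prop := ∀ m ∈ ms.head?, m.region = .L

theorem MoveChain.regionChain {ms : List Move} (h : MoveChain ms) (h' : StartsLeft ms) :
    RegionChain ms := by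
  cases ms with
  | nil => simp [RegionChain]
  | cons m ms =>
    have hm := h' m rfl
    have : ((m :: ms).map Move.region).IsChain (· ≠ ·) := by
      rw [List.isChain_map]
      exact List.IsChain.imp (fun _ _ h => h.1) h
    rw [RegionChain, List.map_cons, List.isChain_cons_cons]
    exact ⟨by rw [hm]; simp, this⟩

theorem MoveChain.left {u v : List Move} (h : MoveChain (u ++ v)) : MoveChain u :=
  (List.isChain_append.1 h).1

theorem MoveChain.right {u v : List Move} (h : MoveChain (u ++ v)) : MoveChain v :=
  (List.isChain_append.1 h).2.1

theorem StartsLeft.left {u v : List Move} (h : StartsLeft (u ++ v)) : StartsLeft u := by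
  cases u with
  | nil => intro m hm; simp at hm
  | cons a u => exact h

/-- The lists of moves without a tuck that occur in reductions of tie sequences. -/
structure OpenSequence (ms : List Move) : Prop where
  chain : MoveChain ms
  start : StartsLeft ms
  closed : endRegion .R ms ≠ .C

theorem OpenSequence.regionChain {ms : List Move} (h : OpenSequence ms) : RegionChain ms :=
  h.chain.regionChain h.start

theorem OpenSequence.good {ms : List Move} (h : OpenSequence ms) : Good (openDiagram ms) :=
  good_openDiagram h.regionChain h.closed

theorem endRegion_append_ne {r : Region} {ms f : List Move} (h : endRegion r ms ≠ .C)
    (hf : ∀ m ∈ f, m.region ≠ .C) : endRegion r (ms ++ f) ≠ .C := by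
  induction f using List.reverseRecOn with
  | nil => simpa using h
  | append_singleton f m ih =>
    rw [← List.append_assoc, endRegion_concat]
    exact hf m (by simp)

/-- Final moves between left and right untwist one kink at a time, the last move first. This
realises reductions III and IV. -/
theorem leads_openDiagram_append {ms f : List Move} (h : endRegion .R ms ≠ .C)
    (hf : ∀ m ∈ f, m.region ≠ .C) : Leads (openDiagram (ms ++ f)) (openDiagram ms) := by
  induction f using List.reverseRecOn with
  | nil => rw [List.append_nil]; exact fun hg => ⟨hg, .refl _⟩
  | append_singleton f m ih =>
    rw [← List.append_assoc]
    have hf' : ∀ m ∈ f, m.region ≠ .C := fun m hm => hf m (by simp [hm])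
    exact (leads_straight (endRegion_append_ne h hf') (hf m (by simp))).trans (ih hf')

theorem move_injective : Function.Injective Symb.move := fun _ _ h => Symb.move.inj h

theorem T_notMem_map (ms : List Move) : Symb.T ∉ ms.map Symb.move := by simp

theorem tieMoves_map (ms : List Move) : tieMoves (ms.map Symb.move) = ms := by
  rw [tieMoves, List.filterMap_map]
  exact List.filterMap_some

theorem tieDiagram_map (ms : List Move) : tieDiagram (ms.map Symb.move) = openDiagram ms := by
  rw [tieDiagram, if_neg (T_notMem_map ms), tieMoves_map]

theorem tieDiagram_map_append (ms : List Move) :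
    tieDiagram (ms.map Symb.move ++ [.T]) = tuckDiagram ms := by
  rw [tieDiagram, if_pos (by simp)]
  congr 1
  rw [tieMoves, List.filterMap_append]
  change tieMoves _ ++ [] = ms
  rw [tieMoves_map, List.append_nil]

/-- A reduction of a sequence without tuck. -/
theorem OpenSequence.reduction {ms : List Move} (h : OpenSequence ms) {r : List Symb}
    (hr : Reduction (ms.map Symb.move) r) : ∃ ms', r = ms'.map Symb.move ∧ OpenSequence ms' ∧
      Leads (openDiagram ms) (openDiagram ms') := by
  have hT := T_notMem_map ms
  generalize hs : ms.map Symb.move = s at hr hT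
  cases hr with
  | zero => simp at hT
  | oneL p t ht => simp at hT
  | oneR p t ht => simp at hT
  | twoRL => simp at hT
  | twoLR => simp at hT
  | three f hf =>
    obtain ⟨f', rfl, hf0, hfC, -⟩ := hf
    cases List.map_injective_iff.2 move_injective hs
    refine ⟨[], rfl, ⟨List.isChain_nil, fun m hm => by simp at hm, by simp⟩, ?_⟩
    exact leads_openDiagram_append (ms := []) (by simp) hfC
  | four p d x f hf hxf =>
    obtain ⟨f', hf', hf0, hfC, -⟩ := hxf
    rw [hf'] at hs
    obtain ⟨u, g, rfl, hu, hg⟩ := List.map_eq_append_iff.1 hs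
    obtain rfl := List.map_injective_iff.2 move_injective hg
    cases g with
    | nil => exact absurd rfl hf0
    | cons m g =>
      simp only [List.map_cons, List.cons.injEq] at hf'
      have hl : u ++ m :: g = u ++ [m] ++ g := by simp
      rw [hl] at h ⊢
      have hm := hfC m (by simp)
      refine ⟨u ++ [m], ?_, ⟨h.chain.left, h.start.left, ?_⟩, ?_⟩
      · rw [List.map_append, hu, hf'.1]; simp
      · rw [endRegion_concat]; exact hm
      · refine leads_openDiagram_append ?_ fun m hm => hfC m (by simp [hm])
        rw [endRegion_concat]; exact hm

theorem exists_split_center (ms : List Move) : (∀ m ∈ ms, m.region ≠ .C) ∨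
    ∃ p d f, ms = p ++ ⟨.C, d⟩ :: f ∧ ∀ m ∈ f, m.region ≠ .C := by
  induction ms using List.reverseRecOn with
  | nil => exact Or.inl (by simp)
  | append_singleton ms m ih =>
    by_cases hm : m.region = .C
    · refine Or.inr ⟨ms, m.dir, [], ?_, by simp⟩
      rw [← hm]
    · rcases ih with ih | ⟨p, d, f, rfl, hf⟩
      · left
        intro a ha
        rcases List.mem_append.1 ha with ha | ha
        · exact ih a ha
        · rw [List.mem_singleton.1 ha]; exact hm
      · refine Or.inr ⟨p, d, f ++ [m], by simp, ?_⟩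
        intro a ha
        rcases List.mem_append.1 ha with ha | ha
        · exact hf a ha
        · rw [List.mem_singleton.1 ha]; exact hm

/-- A sequence without tuck to which no reduction applies ends with a move out of the center. -/
theorem OpenSequence.irreducible {ms : List Move} (h : OpenSequence ms)
    (hr : ∀ r, ¬ Reduction (ms.map Symb.move) r) :
    ms = [] ∨ ∃ p d m, ms = p ++ [⟨.C, d⟩] ++ [m] := by
  rcases exists_split_center ms with hC | ⟨p, d, f, rfl, hf⟩
  · left
    by_contra h0
    exact hr _ (.three _ ⟨ms, rfl, h0, hC, h.chain⟩)
  · right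
    cases f with
    | nil => exact absurd (endRegion_concat _ _ _) h.closed
    | cons m f =>
      cases f with
      | nil => exact ⟨p, d, m, by simp⟩
      | cons m' f =>
        -- Two or more moves after the last visit to the center would allow reduction IV.
        refine absurd (Reduction.four (p.map Symb.move) d (.move m) ((m' :: f).map Symb.move)
          (by simp) ⟨m :: m' :: f, rfl, by simp, hf, ?_⟩) ?_
        · exact (MoveChain.right (u := [⟨.C, d⟩]) (MoveChain.right h.chain))
        · convert hr _ using 2
          simp

/-- The diagram of an irreducible sequence is reduced, alternating and minimal. -/
theorem OpenSequence.minimal {ms : List Move} (h : OpenSequence ms)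
    (hr : ∀ r, ¬ Reduction (ms.map Symb.move) r) :
    IsReduced (openDiagram ms) ∧ IsAlternating (openDiagram ms) ∧
      ∀ w, WellFormed w → Equivalent (openDiagram ms) w → numCrossings (openDiagram ms) ≤ numCrossings w := by
  have hi : ∀ c ∈ labels (openDiagram ms), ∃ d ∈ labels (openDiagram ms),
      c ≠ d ∧ beta (openDiagram ms) c d = 1 := by
    rcases h.irreducible hr with rfl | ⟨p, d, m, rfl⟩
    · intro c hc
      exact absurd hc (Finset.notMem_empty c)
    · cases p with
      -- The first move goes to the left, so it cannot be the move to the center.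
      | nil => exact absurd (h.start _ rfl) (by simp)
      | cons a p =>
        obtain ⟨ar, ad⟩ := a
        obtain rfl : ar = .L := h.start _ rfl
        have hc := h.regionChain
        rw [List.cons_append] at hc ⊢
        exact exists_interlaced hc (by rw [← List.cons_append, endRegion_concat])
  obtain ⟨ε, hε⟩ := exists_inv h.regionChain
  obtain ⟨κ, hκ⟩ := exists_positive_eq h.chain.dirChain hε.par_active
  obtain ⟨hp, hq⟩ := hε.par_proj h.closed
  rw [← openDiagram_eq] at hp hq
  have hw : WellFormed (openDiagram ms) := hε.wellFormed
  exact ⟨isReduced_of_interlaced hw hp hq hi, isAlternating_of_par hw hp κ hκ, fun w hw' hww' =>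
    numCrossings_le_of_equivalent hw hw' hww' (proj_matA hw hq hκ) hi⟩

/-! ### Reductions of sequences with a tuck -/

/-- The form of a tie sequence. -/
theorem IsTieSequence.exists_eq {s : List Symb} (hs : IsTieSequence s) : ∃ p q q',
    (q = Region.R ∧ q' = Region.L ∨ q = .L ∧ q' = .R) ∧
    s = (p ++ [⟨q, .o⟩, ⟨q', .i⟩, ⟨.C, .o⟩]).map Symb.move ++ [.T] ∧
    MoveChain (p ++ [⟨q, .o⟩, ⟨q', .i⟩, ⟨.C, .o⟩]) ∧
    StartsLeft (p ++ [⟨q, .o⟩, ⟨q', .i⟩, ⟨.C, .o⟩]) := by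
  obtain ⟨ms, rfl, ⟨d, hd⟩, hc, hend⟩ := hs
  have key : ∀ q q' : Region,
      [Symb.move ⟨q, .o⟩, .move ⟨q', .i⟩, Co, .T] <:+ ms.map Symb.move ++ [.T] →
      ∃ p, ms = p ++ [⟨q, .o⟩, ⟨q', .i⟩, ⟨.C, .o⟩] := by
    rintro q q' ⟨t, ht⟩
    have : t ++ ([⟨q, .o⟩, ⟨q', .i⟩, ⟨.C, .o⟩] : List Move).map Symb.move = ms.map Symb.move := by
      refine List.append_cancel_right (bs := [Symb.T]) ?_
      rw [← ht]; simp
    obtain ⟨p, g, rfl, -, hg⟩ := List.map_eq_append_iff.1 this.symm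
    obtain rfl := List.map_injective_iff.2 move_injective hg
    exact ⟨p, rfl⟩
  have hs : StartsLeft ms := fun m hm => by rw [hd] at hm; cases hm; rfl
  rcases hend with h | h
  · obtain ⟨p, rfl⟩ := key _ _ h
    exact ⟨p, .L, .R, Or.inr ⟨rfl, rfl⟩, rfl, hc, hs⟩
  · obtain ⟨p, rfl⟩ := key _ _ h
    exact ⟨p, .R, .L, Or.inl ⟨rfl, rfl⟩, rfl, hc, hs⟩

theorem moveChain_append {u : List Move} {m m' : Move} :
    MoveChain (u ++ [m] ++ [m']) ↔
      MoveChain (u ++ [m]) ∧ m.region ≠ m'.region ∧ m.dir ≠ m'.dir := by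
  rw [MoveChain, List.isChain_append]
  simp [MoveChain]

theorem StartsLeft.append {u v : List Move} (h : StartsLeft u) (h0 : u ≠ []) :
    StartsLeft (u ++ v) := by
  cases u with
  | nil => exact absurd rfl h0
  | cons a u => exact h

theorem exists_of_append_eq {P : List Symb} {g ms : List Move}
    (h : P ++ (g.map Symb.move ++ [.T]) = ms.map Symb.move ++ [.T]) :
    ∃ p, P = p.map Symb.move ∧ ms = p ++ g := by
  rw [← List.append_assoc] at h
  obtain ⟨p, g', rfl, hp, hg⟩ := List.map_eq_append_iff.1 (List.append_cancel_right h).symm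
  cases List.map_injective_iff.2 move_injective hg
  exact ⟨p, hp.symm, rfl⟩

/-- Reductions of a tie sequence after a move between left and right. -/
theorem openSequence_tuck_straight {p : List Move} {q q' : Region}
    (h : q = .R ∧ q' = .L ∨ q = .L ∧ q' = .R)
    (hc : MoveChain (p ++ [⟨q', .i⟩] ++ [⟨q, .o⟩, ⟨q', .i⟩, ⟨.C, .o⟩]))
    (hs : StartsLeft (p ++ [⟨q', .i⟩] ++ [⟨q, .o⟩, ⟨q', .i⟩, ⟨.C, .o⟩])) {t : Region} (ht : t ≠ .C) :
    OpenSequence (p ++ [⟨q', .i⟩] ++ [⟨.C, .o⟩, ⟨t, .i⟩]) ∧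
    Leads (tuckDiagram (p ++ [⟨q', .i⟩] ++ [⟨q, .o⟩, ⟨q', .i⟩, ⟨.C, .o⟩]))
      (openDiagram (p ++ [⟨q', .i⟩] ++ [⟨.C, .o⟩, ⟨t, .i⟩])) := by
  have hl : p ++ [⟨q', .i⟩] ++ [⟨.C, .o⟩, ⟨t, .i⟩] =
    p ++ [⟨q', .i⟩] ++ [⟨.C, .o⟩] ++ [⟨t, .i⟩] := by simp
  refine ⟨⟨?_, hs.left.append (by simp), ?_⟩,
    leads_tuck_straight (hc.left.regionChain hs.left) (endRegion_concat _ _ _) h ht⟩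
  · rw [hl, moveChain_append, moveChain_append]
    refine ⟨⟨hc.left, ?_⟩, ht.symm, by simp⟩
    rcases h with ⟨rfl, rfl⟩ | ⟨rfl, rfl⟩ <;> simp
  · rw [hl, endRegion_concat]; exact ht

/-- Reductions of a tie sequence after a move to the center. -/
theorem openSequence_tuck_center {p : List Move} {q q' : Region}
    (h : q = .R ∧ q' = .L ∨ q = .L ∧ q' = .R)
    (hc : MoveChain (p ++ [⟨.C, .i⟩, ⟨q, .o⟩, ⟨q', .i⟩, ⟨.C, .o⟩]))
    (hs : StartsLeft (p ++ [⟨.C, .i⟩, ⟨q, .o⟩, ⟨q', .i⟩, ⟨.C, .o⟩])) :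
    OpenSequence p ∧ Leads (tuckDiagram (p ++ [⟨.C, .i⟩, ⟨q, .o⟩, ⟨q', .i⟩, ⟨.C, .o⟩])) (openDiagram p) := by
  have hr := hc.regionChain hs
  rw [show p ++ [⟨.C, .i⟩, ⟨q, .o⟩, ⟨q', .i⟩, ⟨.C, .o⟩] =
    p ++ [⟨.C, .i⟩] ++ [⟨q, .o⟩] ++ [⟨q', .i⟩] ++ [⟨.C, .o⟩] by simp] at hr
  simp only [regionChain_append] at hr
  have hp := hr.1.1.1.2
  exact ⟨⟨hc.left, hs.left, hp⟩, leads_tuck_center hp h⟩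

/-- The start on the right plays the part of a preceding region `q'`, so the tuck is undone as in
reduction I; what remains are two nested kinks. -/
theorem leads_tuck_empty :
    Leads (tuckDiagram [⟨.L, .o⟩, ⟨.R, .i⟩, ⟨.C, .o⟩]) (openDiagram []) := by
  have h1 := leads_tuck_straight (ms := []) (q := .L) (q' := .R) (t := .L) (by simp [RegionChain])
    rfl (Or.inr ⟨rfl, rfl⟩) (by simp)
  have h2 := leads_r1 ⟨1, true, false⟩ [⟨0, false, false⟩] [⟨0, true, false⟩]
  have h3 := leads_r1 ⟨0, false, false⟩ [] []
  exact (h1.trans h2).trans h3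

/-- A reduction of a tie sequence. -/
theorem IsTieSequence.reduction {s r : List Symb} (hs : IsTieSequence s) (hr : Reduction s r) :
    ∃ ms, r = ms.map Symb.move ∧ OpenSequence ms ∧ Leads (tieDiagram s) (openDiagram ms) := by
  obtain ⟨p, q, q', h, hsp, hc, hl⟩ := hs.exists_eq
  rw [hsp, tieDiagram_map_append]
  -- The last four moves are determined by the sequence, so the pattern of a reduction must coincide
  -- with the known ending.
  have key : ∀ {P : List Symb} {m : Move} {a b : Region},
      P ++ ([m, ⟨a, .o⟩, ⟨b, .i⟩, ⟨.C, .o⟩].map Symb.move ++ [.T]) = s →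
      ∃ p', P = p'.map Symb.move ∧ p = p' ++ [m] ∧ a = q ∧ b = q' := by
    intro P m a b hP
    rw [hsp] at hP
    obtain ⟨p', hp', e⟩ := exists_of_append_eq hP
    rw [show p' ++ [m, ⟨a, .o⟩, ⟨b, .i⟩, ⟨.C, .o⟩] =
      p' ++ [m] ++ [⟨a, .o⟩, ⟨b, .i⟩, ⟨.C, .o⟩] by simp] at e
    obtain ⟨e1, e2⟩ := List.append_inj' e rfl
    simp only [List.cons.injEq, Move.mk.injEq, and_true] at e2
    exact ⟨p', hp', e1, e2.1.symm, e2.2.symm⟩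
  have one : ∀ {P : List Symb} {t : Symb} {a b : Region},
      P ++ ([⟨b, .i⟩, ⟨a, .o⟩, ⟨b, .i⟩, ⟨.C, .o⟩].map Symb.move ++ [.T]) = s → (t = Li ∨ t = Ri) →
      ∃ ms, P ++ [.move ⟨b, .i⟩, Co, t] = ms.map Symb.move ∧ OpenSequence ms ∧
        Leads (tuckDiagram (p ++ [⟨q, .o⟩, ⟨q', .i⟩, ⟨.C, .o⟩])) (openDiagram ms) := by
    intro P t a b hP ht
    obtain ⟨p', rfl, rfl, rfl, rfl⟩ := key hP
    obtain ⟨t', ht', rfl⟩ : ∃ t' : Region, t' ≠ .C ∧ t = .move ⟨t', .i⟩ := by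
      rcases ht with rfl | rfl
      · exact ⟨.L, by simp, rfl⟩
      · exact ⟨.R, by simp, rfl⟩
    exact ⟨p' ++ [⟨b, .i⟩] ++ [⟨.C, .o⟩, ⟨t', .i⟩], by simp, openSequence_tuck_straight h hc hl ht'⟩
  have two : ∀ {P : List Symb} {a b : Region},
      P ++ ([⟨.C, .i⟩, ⟨a, .o⟩, ⟨b, .i⟩, ⟨.C, .o⟩].map Symb.move ++ [.T]) = s →
      ∃ ms, P = ms.map Symb.move ∧ OpenSequence ms ∧
        Leads (tuckDiagram (p ++ [⟨q, .o⟩, ⟨q', .i⟩, ⟨.C, .o⟩])) (openDiagram ms) := by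
    intro P a b hP
    obtain ⟨p', rfl, rfl, rfl, rfl⟩ := key hP
    rw [List.append_assoc] at hc hl ⊢
    exact ⟨p', rfl, openSequence_tuck_center h hc hl⟩
  have hT : Symb.T ∈ s := by rw [hsp]; simp
  cases hr with
  | zero =>
    obtain ⟨p', hp', e⟩ := exists_of_append_eq (P := []) (g := [⟨.L, .o⟩, ⟨.R, .i⟩, ⟨.C, .o⟩]) hsp
    obtain rfl : p' = [] := by simpa using hp'.symm
    rw [e]
    exact ⟨[], rfl, ⟨List.isChain_nil, fun m hm => by simp at hm, by simp⟩, leads_tuck_empty⟩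
  | oneL P t ht => exact one (a := .R) (b := .L) rfl ht
  | oneR P t ht => exact one (a := .L) (b := .R) rfl ht
  | twoRL => exact two (a := .R) (b := .L) rfl
  | twoLR => exact two (a := .L) (b := .R) rfl
  | three f hf =>
    obtain ⟨f', rfl, -⟩ := hf
    simp at hT
  -- Reduction IV needs a final move, but a tie sequence ends with `T`.
  | four P d x f hf hxf =>
    obtain ⟨f', hf', hf0, -⟩ := hxf
    rw [hf'] at hsp
    obtain ⟨g, m, rfl⟩ := (List.eq_nil_or_concat' f').resolve_left hf0
    rw [List.map_append, ← List.append_assoc] at hsp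
    simpa using (List.append_inj' hsp rfl).2

theorem IsTieSequence.good {s : List Symb} (hs : IsTieSequence s) : Good (tieDiagram s) := by
  obtain ⟨p, q, q', h, hsp, hc, hl⟩ := hs.exists_eq
  have e : p ++ [⟨q, .o⟩, ⟨q', .i⟩, ⟨.C, .o⟩] = p ++ [⟨q, .o⟩] ++ [⟨q', .i⟩, ⟨.C, .o⟩] := by simp
  rw [hsp, tieDiagram_map_append]
  rw [e] at hc hl ⊢
  exact good_tuckDiagram (hc.left.regionChain hl.left) (by simp) (endRegion_concat _ _ _) h _ _

/-- A move before the final three has direction in and a region other than `q`, so reduction I or II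
applies. Without such a move the first region forces the ending of reduction 0. -/
theorem IsTieSequence.exists_reduction {s : List Symb} (hs : IsTieSequence s) :
    ∃ r, Reduction s r := by
  obtain ⟨p, q, q', h, rfl, hc, hl⟩ := hs.exists_eq
  rcases List.eq_nil_or_concat' p with rfl | ⟨p, m, rfl⟩
  · have : q = .L := hl _ rfl
    rcases h with ⟨rfl, rfl⟩ | ⟨rfl, rfl⟩
    · exact absurd this (by simp)
    · exact ⟨_, .zero⟩
  · have e : p ++ [m] ++ [⟨q, .o⟩, ⟨q', .i⟩, ⟨.C, .o⟩] =
      p ++ [m] ++ [⟨q, .o⟩] ++ [⟨q', .i⟩] ++ [⟨.C, .o⟩] := by simp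
    rw [e] at hc
    have hm := (moveChain_append.1 hc.left.left).2
    obtain ⟨mr, md⟩ := m
    cases md with
    | o => exact absurd rfl hm.2
    | i =>
      simp only [List.append_assoc, List.map_append]
      rcases h with ⟨rfl, rfl⟩ | ⟨rfl, rfl⟩ <;> cases mr
      · exact ⟨_, .oneL _ Li (Or.inl rfl)⟩
      · exact absurd rfl hm.1
      · exact ⟨_, .twoRL _⟩
      · exact absurd rfl hm.1
      · exact ⟨_, .oneR _ Li (Or.inl rfl)⟩
      · exact ⟨_, .twoLR _⟩

/-! ### Termination and the final assembly -/

theorem Reduction.length_lt {s r : List Symb} (h : Reduction s r) : r.length < s.length := by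
  cases h with
  | three f hf =>
    obtain ⟨f', rfl, h0, -⟩ := hf
    simpa using List.length_pos_iff.2 h0
  | four p d x f hf hxf =>
    have := List.length_pos_iff.2 hf
    simp only [List.length_append, List.length_cons, List.length_nil]
    omega
  | _ => simp

theorem exists_isReducedSequenceOf (s : List Symb) : ∃ r, IsReducedSequenceOf r s := by
  induction hn : s.length using Nat.strong_induction_on generalizing s with
  | _ n ih =>
    by_cases h : ∃ r, Reduction s r
    · obtain ⟨r, hr⟩ := h
      obtain ⟨r', h1, h2⟩ := ih _ (hn ▸ hr.length_lt) r rfl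
      exact ⟨r', .head hr h1, h2⟩
    · exact ⟨s, .refl, fun r hr => h ⟨r, hr⟩⟩

theorem IsTieSequence.reduced {s r : List Symb} (hs : IsTieSequence s)
    (hr : IsReducedSequenceOf r s) : ∃ ms, r = ms.map Symb.move ∧ OpenSequence ms ∧
      Equivalent (tieDiagram s) (openDiagram ms) := by
  have key : ∀ r, Relation.ReflTransGen Reduction s r → r = s ∨ ∃ ms, r = ms.map Symb.move ∧
      OpenSequence ms ∧ Equivalent (tieDiagram s) (openDiagram ms) := by
    intro r h
    induction h with
    | refl => exact Or.inl rfl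
    | tail _ hred ih =>
      right
      rcases ih with rfl | ⟨ms, rfl, ho, he⟩
      · obtain ⟨ms, rfl, ho, hl⟩ := hs.reduction hred
        exact ⟨ms, rfl, ho, (hl hs.good).2⟩
      · obtain ⟨ms', rfl, ho', hl⟩ := ho.reduction hred
        exact ⟨ms', rfl, ho', he.trans _ _ _ (hl ho.good).2⟩
  -- A tie sequence is itself reducible, so at least one reduction takes place and the tuck is gone.
  rcases key r hr.1 with rfl | h
  · obtain ⟨r', hr'⟩ := hs.exists_reduction
    exact absurd hr' (hr.2 r')
  · exact h

end TieKnot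

theorem mainTheorem4 (s : List TieKnot.Symb) (hs : TieKnot.IsTieSequence s) :
    (TieKnot.tieDiagram s).IsKnotDiagram ∧
    (∃ r, TieKnot.IsReducedSequenceOf r s) ∧
    ∀ r, TieKnot.IsReducedSequenceOf r s →
      (TieKnot.tieDiagram r).IsKnotDiagram ∧
      (TieKnot.tieDiagram s).Equivalent (TieKnot.tieDiagram r) ∧
      (TieKnot.tieDiagram r).IsReduced ∧
      (TieKnot.tieDiagram r).IsAlternating ∧
      (TieKnot.tieDiagram r).numCrossings = (TieKnot.tieDiagram s).crossingNumber := by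
  refine ⟨hs.good.isKnotDiagram, TieKnot.exists_isReducedSequenceOf s, fun r hr => ?_⟩
  obtain ⟨ms, rfl, ho, he⟩ := hs.reduced hr
  obtain ⟨h1, h2, h3⟩ := ho.minimal hr.2
  rw [TieKnot.tieDiagram_map]
  refine ⟨ho.good.isKnotDiagram, he, h1, h2, le_antisymm ?_ ?_⟩
  -- The reduced diagram also shows that the set of crossing numbers is nonempty, so `sInf` is a
  -- true minimum.
  · refine le_csInf ⟨_, _, ho.good.isKnotDiagram, he, rfl⟩ ?_
    rintro n ⟨w, hw, hsw, rfl⟩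
    exact h3 w hw.1 ((he.symm _ _).trans _ _ _ hsw)
  · exact Nat.sInf_le ⟨_, ho.good.isKnotDiagram, he, rfl⟩
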